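/- Let $\Omega\subset\mathbb{R}^n$ be open, and let $C^1_0(\Omega,\mathbb{R}^n)$ denote the $C^1$ vector fields $u$ on $\Omega$ such that $u$ and $Du$ vanish at $\partial\Omega$ and at infinity. Let $V\subset C^1_0(\Omega,\mathbb{R}^n)$ be an admissible reproducing kernel Hilbert space, i.e. there is a constant $C>0$ with $\|u\|_\infty+\|Du\|_\infty\le C\|u\|_V$ for all $u\in V$, and let $K:\Omega\times\Omega\to\mathbb{R}^{n\times n}$ be its reproducing kernel. Let $X^2=L^2([0,1],V)$. For $v\in X^2$ let $\varphi^v_t:\Omega\to\Omega$, $0\le t\le 1$, be the flow of $v$, i.e. $\varphi^v_t(x)=x+\int_0^t v(\tau,\varphi^v_\tau(x))\,d\tau$, and put $\varphi^v_{s,t}=\varphi^v_t\circ(\varphi^v_s)^{-1}$. Let $Y$ be a real Hilbert space (the data space, e.g. an $L^2$ space), $N\ge 1$, $t_i=i/N$, $\mu_2\in\mathbb{R}$, let $T_t:L^2(\Omega,\mathbb{R})\to Y$ be bounded linear operators with adjoints $T_t^*$, and let $g_t\in Y$. Let $f\in L^2(\Omega,\mathbb{R})$ be differentiable on $\Omega$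 with $\nabla f\in L^2(\Omega,\mathbb{R}^n)$. Define $$J_f(v)=\frac1N\sum_{i=1}^N\Bigl[\bigl\|T_{t_i}(f\circ\varphi^v_{t_i,0})-g_{t_i}\bigr\|_Y^2+\mu_2\int_0^{t_i}\|v(\tau,\cdot)\|_V^2\,d\tau\Bigr],\qquad v\in X^2,$$ $$h^{f,v}_{\tau,t}=\begin{cases}|D\varphi^v_{\tau,t}|\;T_t^*\bigl(T_t(f\circ\varphi^v_{t,0})-g_t\bigr)\circ\varphi^v_{\tau,t},&\tau\le t,\\0,&t<\tau,\end{cases}\qquad v_{\tau,t}=\begin{cases}v(\tau,\cdot),&\tau\le t,\\0,&t<\tau,\end{cases}$$ where $|D\varphi|$ is the Jacobian determinant. Then $J_f$ is well defined: for every $v\in X^2$ the flow exists, each $\varphi^v_s$ ($0\le s\le 1$) is a bijection of $\Omega$, each $\varphi^v_{s,t}$ ($0\le s,t\le 1$) is $C^1$ on $\Omega$, and $f\circ\varphi^v_{s,0}\in L^2(\Omega)$. Moreover $J_f:X^2\to\mathbb{R}$ is differentiable at every $v\in X^2$, and its $X^2$-gradient is $$\nabla J_f(v)(t,x)=-\frac2N\int_\Omega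 K(x,y)\,\nabla(f\circ\varphi^v_{t,0})(y)\sum_{\{i\ge1:\,t_i\ge t\}}h^{f,v}_{t,t_i}(y)\,dy+\frac{2\mu_2}{N}\sum_{\{i\ge1:\,t_i\ge t\}}v_{t,t_i}(x)$$ for almost every $t\in[0,1]$ and all $x\in\Omega$, where the integrand is integrable over $\Omega$ for all $t\in[0,1]$, $x\in\Omega$. -/

import Mathlib

open MeasureTheory Set
open scoped Gradient

noncomputable section

/-- The space `L²([0,1], V)` of time-dependent velocity fields. -/
abbrev VelocitySpace (V : Type*) [NormedAddCommGroup V] : Type _ :=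
  Lp V 2 (volume.restrict (Icc (0 : ℝ) 1))

/-- The space `L²(Ω, ℝ)` of images on `Ω`. -/
abbrev ImageSpace {n : ℕ} (Ω : Set (EuclideanSpace ℝ (Fin n))) : Type :=
  Lp ℝ 2 (volume.restrict Ω)

/-- The element of `L²(Ω, ℝ)` represented by `u` (by convention `0` if `u` is not
square-integrable on `Ω`). -/
def toImage {n : ℕ} (Ω : Set (EuclideanSpace ℝ (Fin n))) (u : EuclideanSpace ℝ (Fin n) → ℝ) :
    ImageSpace Ω :=
  open Classical in if h : MemLp u 2 (volume.restrict Ω) then h.toLp u else 0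

/-- Membership in `C¹₀(Ω, ℝⁿ)`: `u` is continuously differentiable on `Ω`, and `u` and `Du` vanish
at the boundary of `Ω` and at infinity. Only the values of `u` on the open set `Ω` matter. -/
structure IsC10 {n : ℕ} (Ω : Set (EuclideanSpace ℝ (Fin n)))
    (u : EuclideanSpace ℝ (Fin n) → EuclideanSpace ℝ (Fin n)) : Prop where
  contDiffOn : ContDiffOn ℝ 1 u Ω
  vanish : ∀ ε : ℝ, 0 < ε → ∃ K : Set (EuclideanSpace ℝ (Fin n)), IsCompact K ∧ K ⊆ Ω ∧
    ∀ x ∈ Ω \ K, ‖u x‖ < ε ∧ ‖fderiv ℝ u x‖ < ε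

section Velocity

variable {n : ℕ} {Ω : Set (EuclideanSpace ℝ (Fin n))}
  {V : Type*} [NormedAddCommGroup V] [InnerProductSpace ℝ V]
  [RKHS ℝ V Ω (EuclideanSpace ℝ (Fin n))]

/-- The vector field on `Ω` given by an element of `V`, extended by zero to `ℝⁿ`. -/
def vectorField (u : V) : EuclideanSpace ℝ (Fin n) → EuclideanSpace ℝ (Fin n) :=
  Function.extend (Subtype.val : Ω → EuclideanSpace ℝ (Fin n)) (fun x => u x) 0

variable (V) in
/-- `V` is admissible: it is contained in `C¹₀(Ω, ℝⁿ)`, and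
`sup ‖u‖ + sup ‖Du‖ ≤ C ‖u‖_V` for some constant `C`. -/
structure IsAdmissible : Prop where
  isC10 : ∀ u : V, IsC10 Ω (vectorField u)
  bound : ∃ C : ℝ, 0 < C ∧ ∀ u : V, ∀ x ∈ Ω, ∀ y ∈ Ω,
    ‖vectorField u x‖ + ‖fderiv ℝ (vectorField u) y‖ ≤ C * ‖u‖

/-- `φ` is the flow on `Ω`, for times in `[0,1]`, of the time-dependent velocity field `v`:
`∂ₜ φₜ(x) = v(t, φₜ(x))`, `φ₀(x) = x`, in integrated form. -/
structure IsFlow (v : ℝ → V) (φ : ℝ → EuclideanSpace ℝ (Fin n) → EuclideanSpace ℝ (Fin n)) :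
    Prop where
  mapsTo : ∀ t ∈ Icc (0 : ℝ) 1, MapsTo (φ t) Ω Ω
  intervalIntegrable : ∀ x ∈ Ω,
    IntervalIntegrable (fun τ => vectorField (v τ) (φ τ x)) volume 0 1
  eq : ∀ x ∈ Ω, ∀ t ∈ Icc (0 : ℝ) 1, φ t x = x + ∫ τ in (0 : ℝ)..t, vectorField (v τ) (φ τ x)

/-- The flow `φₜᵛ` of `v`. -/
def flow (v : VelocitySpace V) :
    ℝ → EuclideanSpace ℝ (Fin n) → EuclideanSpace ℝ (Fin n) :=
  open Classical in
  if h : ∃ φ : ℝ → EuclideanSpace ℝ (Fin n) → EuclideanSpace ℝ (Fin n), IsFlow (⇑v) φ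
  then h.choose else fun _ x => x

/-- `φ_{s,t}ᵛ = φₜᵛ ∘ (φₛᵛ)⁻¹`, the inverse being that of `φₛᵛ` as a self-map of `Ω`. -/
def flowBetween (v : VelocitySpace V) (s t : ℝ) :
    EuclideanSpace ℝ (Fin n) → EuclideanSpace ℝ (Fin n) :=
  flow v t ∘ Function.invFunOn (flow v s) Ω

variable {Y : Type*} [NormedAddCommGroup Y] [InnerProductSpace ℝ Y]

/-- The registration functional
`J_f(v) = (1/N) ∑ᵢ (‖T_{tᵢ}(f ∘ φ_{tᵢ,0}ᵛ) - g_{tᵢ}‖² + μ₂ ∫₀^{tᵢ} ‖v(τ)‖²_V dτ)`, `tᵢ = i/N`. -/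
def registrationFunctional (N : ℕ) (T : ℝ → ImageSpace Ω →L[ℝ] Y) (g : ℝ → Y) (μ₂ : ℝ)
    (f : EuclideanSpace ℝ (Fin n) → ℝ) (v : VelocitySpace V) : ℝ :=
  (1 / (N : ℝ)) * ∑ i ∈ Finset.Icc 1 N,
    (‖T ((i : ℝ) / N) (toImage Ω (f ∘ flowBetween v ((i : ℝ) / N) 0)) - g ((i : ℝ) / N)‖ ^ 2
      + μ₂ * ∫ τ in (0 : ℝ)..((i : ℝ) / N), ‖v τ‖ ^ 2)

/-- `h_{τ,t} = |Dφ_{τ,t}| · T_t*(T_t(f ∘ φ_{t,0}) - g_t) ∘ φ_{τ,t}` if `τ ≤ t`, and `0` otherwise. -/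
def hTerm [CompleteSpace Y] (T : ℝ → ImageSpace Ω →L[ℝ] Y) (g : ℝ → Y)
    (f : EuclideanSpace ℝ (Fin n) → ℝ) (v : VelocitySpace V) (τ t : ℝ)
    (y : EuclideanSpace ℝ (Fin n)) : ℝ :=
  if τ ≤ t then
    (fderiv ℝ (flowBetween v τ t) y).det *
      (ContinuousLinearMap.adjoint (T t) (T t (toImage Ω (f ∘ flowBetween v t 0)) - g t))
        (flowBetween v τ t y)
  else 0

/-- `v_{τ,t} = v(τ)` if `τ ≤ t`, and `0` otherwise. -/
def truncatedVelocity (v : VelocitySpace V) (τ t : ℝ) : V :=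
  if τ ≤ t then v τ else 0

/-- The integrand
`K(x,y) ∇(f ∘ φ_{t,0})(y) ∑_{i ≥ 1, tᵢ ≥ t} h_{t,tᵢ}(y)`, with `K` the reproducing kernel of `V`. -/
def gradientIntegrand [CompleteSpace V] [CompleteSpace Y] (N : ℕ)
    (T : ℝ → ImageSpace Ω →L[ℝ] Y) (g : ℝ → Y)
    (f : EuclideanSpace ℝ (Fin n) → ℝ) (v : VelocitySpace V) (t : ℝ) (x y : Ω) :
    EuclideanSpace ℝ (Fin n) :=
  RKHS.kernel V x y
    ((∑ i ∈ (Finset.Icc 1 N).filter (fun i : ℕ => t ≤ (i : ℝ) / N), hTerm T g f v t ((i : ℝ) / N) (y : _)) •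
      ∇ (f ∘ flowBetween v t 0) (y : EuclideanSpace ℝ (Fin n)))

end Velocity

end

open Filter Topology

/-- Lebesgue measure on the time interval `[0,1]`. -/
local notation "μI" => (volume.restrict (Icc (0 : ℝ) 1) : Measure ℝ)

section Volterra

instance isProbabilityMeasure_unitInterval : IsProbabilityMeasure μI :=
  ⟨by simp⟩

lemma setIntegral_exp_weight_le {l : ℝ} (hl : 0 < l) (s t : ℝ) :
    ∫ τ in uIoc s t, Real.exp (l * |τ - s|) ^ 2 ∂μI ≤ Real.exp (l * |t - s|) ^ 2 / (2 * l) := by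
  have hc : Continuous fun τ : ℝ => Real.exp (l * |τ - s|) ^ 2 := by fun_prop
  have h1 : ∫ τ in uIoc s t, Real.exp (l * |τ - s|) ^ 2 ∂μI ≤
      ∫ τ in uIoc s t, Real.exp (l * |τ - s|) ^ 2 := by
    refine integral_mono_measure ?_ (ae_of_all _ fun τ => by positivity) ?_
    · exact Measure.restrict_mono_measure Measure.restrict_le_self _
    · exact (hc.intervalIntegrable s t).def'
  refine h1.trans ?_
  rcases le_total s t with h | h
  · rw [uIoc_of_le h, ← intervalIntegral.integral_of_le h]
    have h2 : ∫ τ in s..t, Real.exp (l * |τ - s|) ^ 2 =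
        ∫ τ in s..t, Real.exp (2 * l * (τ - s)) := by
      refine intervalIntegral.integral_congr fun τ hτ => ?_
      rw [uIcc_of_le h] at hτ
      rw [abs_of_nonneg (by linarith [hτ.1]), ← Real.exp_nat_mul]
      congr 1; push_cast; ring
    have hd : ∀ τ ∈ uIcc s t, HasDerivAt (fun τ => Real.exp (2 * l * (τ - s)) / (2 * l))
        (Real.exp (2 * l * (τ - s))) τ := fun τ _ => by
      have := (((hasDerivAt_id τ).sub_const s).const_mul (2 * l)).exp.div_const (2 * l)
      convert! this using 1
      simp only [id]; field_simp
    rw [h2, intervalIntegral.integral_eq_sub_of_hasDerivAt hd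
      ((by fun_prop : Continuous fun τ => Real.exp (2 * l * (τ - s))).intervalIntegrable _ _),
      abs_of_nonneg (by linarith), ← Real.exp_nat_mul]
    have : (0 : ℝ) ≤ Real.exp (2 * l * (s - s)) / (2 * l) := by positivity
    have e : ((2 : ℕ) : ℝ) * (l * (t - s)) = 2 * l * (t - s) := by push_cast; ring
    rw [e]; linarith
  · rw [uIoc_of_ge h, ← intervalIntegral.integral_of_le h]
    have h2 : ∫ τ in t..s, Real.exp (l * |τ - s|) ^ 2 =
        ∫ τ in t..s, Real.exp (2 * l * (s - τ)) := by
      refine intervalIntegral.integral_congr fun τ hτ => ?_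
      rw [uIcc_of_le h] at hτ
      rw [abs_of_nonpos (by linarith [hτ.2]), ← Real.exp_nat_mul]
      congr 1; push_cast; ring
    have hd : ∀ τ ∈ uIcc t s, HasDerivAt (fun τ => -(Real.exp (2 * l * (s - τ)) / (2 * l)))
        (Real.exp (2 * l * (s - τ))) τ := fun τ _ => by
      have := (((hasDerivAt_id τ).const_sub s).const_mul (2 * l)).exp.div_const (2 * l) |>.neg
      convert! this using 1
      simp only [id]; field_simp
    rw [h2, intervalIntegral.integral_eq_sub_of_hasDerivAt hd
      ((by fun_prop : Continuous fun τ => Real.exp (2 * l * (s - τ))).intervalIntegrable _ _),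
      abs_of_nonpos (by linarith), ← Real.exp_nat_mul]
    have : (0 : ℝ) ≤ Real.exp (2 * l * (s - s)) / (2 * l) := by positivity
    have e : ((2 : ℕ) : ℝ) * (l * -(t - s)) = 2 * l * (s - t) := by push_cast; ring
    rw [e]; linarith

lemma integrable_mul_exp_weight {b : ℝ → ℝ} (hb : MemLp b 2 μI) (l s t : ℝ) :
    IntegrableOn (fun τ => b τ * Real.exp (l * |τ - s|)) (uIoc s t) μI := by
  have hc : Continuous fun τ : ℝ => Real.exp (l * |τ - s|) := by fun_prop
  refine IntegrableOn.mono_set ?_ uIoc_subset_uIcc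
  exact ((hb.integrable (by norm_num)).integrableOn).mul_continuousOn hc.continuousOn isCompact_uIcc

lemma setIntegral_mul_exp_weight_le {b : ℝ → ℝ} (hb : MemLp b 2 μI) {B l : ℝ} (hl : 0 < l)
    (hB : ∫ τ, b τ ^ 2 ∂μI ≤ B ^ 2) (s t : ℝ) :
    ∫ τ in uIoc s t, b τ * Real.exp (l * |τ - s|) ∂μI ≤
      (B ^ 2 / (2 * l) + 1 / 4) * Real.exp (l * |t - s|) := by
  set e := Real.exp (l * |t - s|) with he
  have hepos : 0 < e := Real.exp_pos _
  have hc : Continuous fun τ : ℝ => Real.exp (l * |τ - s|) ^ 2 := by fun_prop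
  have hi1 : IntegrableOn (fun τ => e / (2 * l) * b τ ^ 2) (uIoc s t) μI :=
    (hb.integrable_sq.const_mul _).integrableOn
  have hi2 : IntegrableOn (fun τ => l / (2 * e) * Real.exp (l * |τ - s|) ^ 2) (uIoc s t) μI :=
    Integrable.const_mul ((hc.intervalIntegrable s t).def'.mono_measure
      Measure.restrict_le_self) _
  calc ∫ τ in uIoc s t, b τ * Real.exp (l * |τ - s|) ∂μI
      ≤ ∫ τ in uIoc s t, (e / (2 * l) * b τ ^ 2 + l / (2 * e) * Real.exp (l * |τ - s|) ^ 2) ∂μI := by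
        refine integral_mono (integrable_mul_exp_weight hb l s t) (hi1.add hi2) fun τ => ?_
        have key : 0 ≤ (e * b τ - l * Real.exp (l * |τ - s|)) ^ 2 / (2 * e * l) := by positivity
        have : (e * b τ - l * Real.exp (l * |τ - s|)) ^ 2 / (2 * e * l) =
          e / (2 * l) * b τ ^ 2 + l / (2 * e) * Real.exp (l * |τ - s|) ^ 2
            - b τ * Real.exp (l * |τ - s|) := by field_simp; ring
        simp only; linarith
    _ = e / (2 * l) * ∫ τ in uIoc s t, b τ ^ 2 ∂μI
        + l / (2 * e) * ∫ τ in uIoc s t, Real.exp (l * |τ - s|) ^ 2 ∂μI := by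
        rw [integral_add hi1 hi2, integral_const_mul, integral_const_mul]
    _ ≤ e / (2 * l) * B ^ 2 + l / (2 * e) * (e ^ 2 / (2 * l)) := by
        gcongr
        · exact (setIntegral_le_integral hb.integrable_sq (ae_of_all _ fun τ => sq_nonneg _)).trans hB
        · exact setIntegral_exp_weight_le hl s t
    _ = _ := by field_simp; ring

/-- A form of Grönwall's inequality with square-integrable weight. -/
lemma gronwall_sq_integrable {a : ℝ → ℝ} (ha : MemLp a 2 μI) (ha0 : ∀ τ, 0 ≤ a τ) {A : ℝ}
    (hA : ∫ τ, a τ ^ 2 ∂μI ≤ A ^ 2) {ρ : ℝ → ℝ} (hρ : Continuous ρ) (hρ0 : ∀ t, 0 ≤ ρ t) {b s : ℝ}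
    (h : ∀ t, ρ t ≤ b + ∫ τ in uIoc s t, a τ * ρ τ ∂μI) (t : ℝ) :
    ρ t ≤ 2 * Real.exp ((2 * A ^ 2 + 1) * |t - s|) * b := by
  set l := 2 * A ^ 2 + 1 with hl
  have hl0 : 0 < l := by positivity
  set T := |t - s| with hT
  have hT0 : 0 ≤ T := abs_nonneg _
  have hcont : Continuous fun r => Real.exp (-(l * |r - s|)) * ρ r := by fun_prop
  obtain ⟨r, hr, hmax⟩ := (isCompact_Icc (a := s - T) (b := s + T)).exists_isMaxOn
    ⟨s, by constructor <;> linarith⟩ hcont.continuousOn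
  set m := Real.exp (-(l * |r - s|)) * ρ r with hm
  have hm0 : 0 ≤ m := mul_nonneg (Real.exp_pos _).le (hρ0 r)
  have hle : ∀ τ, |τ - s| ≤ T → ρ τ ≤ m * Real.exp (l * |τ - s|) := fun τ hτ => by
    have h1 := hmax (show τ ∈ Icc (s - T) (s + T) by
      rw [abs_le] at hτ; constructor <;> linarith)
    simp only [mem_ofPred_eq] at h1
    calc ρ τ = Real.exp (-(l * |τ - s|)) * ρ τ * Real.exp (l * |τ - s|) := by
          rw [mul_right_comm, ← Real.exp_add]; simp
      _ ≤ _ := by gcongr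
  have hb0 : 0 ≤ b := by have := h s; simp at this; linarith [hρ0 s]
  have hrT : |r - s| ≤ T := by rw [abs_le]; constructor <;> linarith [hr.1, hr.2]
  have hint : ∫ τ in uIoc s r, a τ * ρ τ ∂μI ≤ m * (1 / 2 * Real.exp (l * |r - s|)) := by
    calc ∫ τ in uIoc s r, a τ * ρ τ ∂μI
        ≤ ∫ τ in uIoc s r, m * (a τ * Real.exp (l * |τ - s|)) ∂μI := by
          refine setIntegral_mono_on ?_ ((integrable_mul_exp_weight ha l s r).const_mul m)
            measurableSet_uIoc fun τ hτ => ?_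
          · refine IntegrableOn.mono_set ?_ uIoc_subset_uIcc
            exact ((ha.integrable (by norm_num)).integrableOn).mul_continuousOn hρ.continuousOn
              isCompact_uIcc
          · have := hle τ ((abs_sub_left_of_mem_uIcc (uIoc_subset_uIcc hτ)).trans hrT)
            calc a τ * ρ τ ≤ a τ * (m * Real.exp (l * |τ - s|)) := by gcongr; exact ha0 τ
              _ = _ := by ring
      _ = m * ∫ τ in uIoc s r, a τ * Real.exp (l * |τ - s|) ∂μI := integral_const_mul _ _
      _ ≤ m * ((A ^ 2 / (2 * l) + 1 / 4) * Real.exp (l * |r - s|)) := by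
          gcongr; exact setIntegral_mul_exp_weight_le ha hl0 hA s r
      _ ≤ _ := by
          gcongr
          have : A ^ 2 / (2 * l) ≤ 1 / 4 := by rw [div_le_div_iff₀ (by positivity) (by norm_num)]; linarith
          linarith
  have hm2 : m ≤ b + m / 2 := by
    calc m ≤ Real.exp (-(l * |r - s|)) * (b + m * (1 / 2 * Real.exp (l * |r - s|))) := by
          rw [hm]; gcongr; exact (h r).trans (by gcongr)
      _ = Real.exp (-(l * |r - s|)) * b
          + m / 2 * (Real.exp (-(l * |r - s|)) * Real.exp (l * |r - s|)) := by ring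
      _ = Real.exp (-(l * |r - s|)) * b + m / 2 := by rw [← Real.exp_add]; simp
      _ ≤ 1 * b + m / 2 := by
          gcongr; exact Real.exp_le_one_iff.2 (by simp only [Left.neg_nonpos_iff]; positivity)
      _ = _ := by ring
  calc ρ t ≤ m * Real.exp (l * T) := hle t le_rfl
    _ ≤ (2 * b) * Real.exp (l * T) := by gcongr; linarith
    _ = _ := by ring

variable {G : Type*} [NormedAddCommGroup G]

/-- Carathéodory conditions for a time-dependent vector field `F` on `G`, with square-integrable
Lipschitz constants `a` and square-integrable bound `b` at the origin. -/
structure IsCaratheodory (F : ℝ → G → G) (a b : ℝ → ℝ) : Prop where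
  memLp_lip : MemLp a 2 μI
  memLp_bound : MemLp b 2 μI
  lip_nonneg : ∀ τ, 0 ≤ a τ
  lip : ∀ τ x y, ‖F τ x - F τ y‖ ≤ a τ * ‖x - y‖
  bound : ∀ τ, ‖F τ 0‖ ≤ b τ
  aestronglyMeasurable : ∀ x : ℝ → G, Continuous x → AEStronglyMeasurable (fun τ => F τ (x τ)) μI

namespace IsCaratheodory

variable {F : ℝ → G → G} {a b : ℝ → ℝ}

lemma norm_le (hF : IsCaratheodory F a b) (τ : ℝ) (x : G) : ‖F τ x‖ ≤ a τ * ‖x‖ + b τ := by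
  calc ‖F τ x‖ = ‖(F τ x - F τ 0) + F τ 0‖ := by rw [sub_add_cancel]
    _ ≤ ‖F τ x - F τ 0‖ + ‖F τ 0‖ := norm_add_le _ _
    _ ≤ a τ * ‖x - 0‖ + b τ := add_le_add (hF.lip τ x 0) (hF.bound τ)
    _ = _ := by rw [sub_zero]

lemma intervalIntegrable (hF : IsCaratheodory F a b) {x : ℝ → G} (hx : Continuous x) (s t : ℝ) :
    IntervalIntegrable (fun τ => F τ (x τ)) μI s t := by
  rw [intervalIntegrable_iff]
  have h1 : IntegrableOn (fun τ => a τ * ‖x τ‖ + b τ) (uIoc s t) μI := by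
    refine Integrable.add ?_ (hF.memLp_bound.integrable (by norm_num)).integrableOn
    refine IntegrableOn.mono_set ?_ uIoc_subset_uIcc
    exact ((hF.memLp_lip.integrable (by norm_num)).integrableOn).mul_continuousOn
      hx.norm.continuousOn isCompact_uIcc
  exact h1.mono' (hF.aestronglyMeasurable x hx).restrict (ae_of_all _ fun τ => hF.norm_le τ _)

end IsCaratheodory

variable [NormedSpace ℝ G]

/-- `x` solves `x' = F(t,x)`, `x(s) = x₀` in integrated form; `F` acts only at times in `[0,1]`. -/
structure IsSolution (F : ℝ → G → G) (s : ℝ) (x₀ : G) (x : ℝ → G) : Prop where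
  continuous : Continuous x
  eq : ∀ t, x t = x₀ + ∫ τ in s..t, F τ (x τ) ∂μI

namespace IsSolution

variable {F : ℝ → G → G} {a b : ℝ → ℝ} {s : ℝ} {x₀ : G} {x : ℝ → G}

lemma apply_initial (hx : IsSolution F s x₀ x) : x s = x₀ := by simpa using hx.eq s

lemma restart (hF : IsCaratheodory F a b) (hx : IsSolution F s x₀ x) (r : ℝ) :
    IsSolution F r (x r) x := by
  refine ⟨hx.continuous, fun t => ?_⟩
  rw [hx.eq t, hx.eq r, add_assoc, intervalIntegral.integral_add_adjacent_intervals]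
  exacts [hF.intervalIntegrable hx.continuous _ _, hF.intervalIntegrable hx.continuous _ _]

end IsSolution

namespace IsCaratheodory

variable {F : ℝ → G → G} {a b : ℝ → ℝ}

/-- Stability of solutions: if `y` solves `y' = F(t,y) + e` up to an integrable error `e`, then `y`
is close to the solution. -/
lemma norm_sub_le (hF : IsCaratheodory F a b) {A : ℝ} (hA : ∫ τ, a τ ^ 2 ∂μI ≤ A ^ 2)
    {s : ℝ} {x₀ : G} {x : ℝ → G} (hx : IsSolution F s x₀ x) {y : ℝ → G} (hy : Continuous y)
    {e : ℝ} (h : ∀ t, ‖y t - x₀ - ∫ τ in s..t, F τ (y τ) ∂μI‖ ≤ e) (t : ℝ) :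
    ‖y t - x t‖ ≤ 2 * Real.exp ((2 * A ^ 2 + 1) * |t - s|) * e := by
  refine gronwall_sq_integrable hF.memLp_lip hF.lip_nonneg hA
    ((hy.sub hx.continuous).norm) (fun t => norm_nonneg _) (s := s) (fun t => ?_) t
  change ‖y t - x t‖ ≤ e + ∫ τ in uIoc s t, a τ * ‖y τ - x τ‖ ∂μI
  have hint : IntegrableOn (fun τ => a τ * ‖y τ - x τ‖) (uIoc s t) μI := by
    refine IntegrableOn.mono_set ?_ uIoc_subset_uIcc
    exact ((hF.memLp_lip.integrable (by norm_num)).integrableOn).mul_continuousOn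
      (hy.sub hx.continuous).norm.continuousOn isCompact_uIcc
  have h1 : y t - x t = (y t - x₀ - ∫ τ in s..t, F τ (y τ) ∂μI)
      + ∫ τ in s..t, (F τ (y τ) - F τ (x τ)) ∂μI := by
    rw [intervalIntegral.integral_sub (hF.intervalIntegrable hy _ _)
      (hF.intervalIntegrable hx.continuous _ _), hx.eq t]
    abel
  rw [h1]
  refine (norm_add_le _ _).trans (add_le_add (h t) ?_)
  refine intervalIntegral.norm_integral_le_integral_norm_uIoc.trans ?_
  refine setIntegral_mono_on ?_ hint measurableSet_uIoc fun τ _ => hF.lip _ _ _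
  exact ((hF.intervalIntegrable hy s t).sub (hF.intervalIntegrable hx.continuous s t)).norm.def'

lemma eq_of_isSolution (hF : IsCaratheodory F a b) {s : ℝ} {x₀ : G} {x y : ℝ → G}
    (hx : IsSolution F s x₀ x) (hy : IsSolution F s x₀ y) : x = y := by
  funext t
  have hA : ∫ τ, a τ ^ 2 ∂μI ≤ (√(∫ τ, a τ ^ 2 ∂μI)) ^ 2 := by
    rw [Real.sq_sqrt (integral_nonneg fun τ => sq_nonneg _)]
  have := hF.norm_sub_le hA hx hy.continuous (e := 0)
    (fun t => by rw [hy.eq t]; simp) t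
  rw [mul_zero, norm_le_zero_iff, sub_eq_zero] at this
  exact this.symm

variable [CompleteSpace G]

theorem exists_isSolution (hF : IsCaratheodory F a b) (s : ℝ) (x₀ : G) :
    ∃ x, IsSolution F s x₀ x := by
  set A := √(∫ τ, a τ ^ 2 ∂μI) with hAdef
  have hA : ∫ τ, a τ ^ 2 ∂μI ≤ A ^ 2 := by
    rw [Real.sq_sqrt (integral_nonneg fun τ => sq_nonneg _)]
  set B := √(∫ τ, b τ ^ 2 ∂μI) with hBdef
  have hB : ∫ τ, b τ ^ 2 ∂μI ≤ B ^ 2 := by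
    rw [Real.sq_sqrt (integral_nonneg fun τ => sq_nonneg _)]
  set l := 2 * A ^ 2 + 1 with hl
  have hl0 : 0 < l := by positivity
  have hA4 : A ^ 2 / (2 * l) + 1 / 4 ≤ 1 / 2 := by
    have : A ^ 2 / (2 * l) ≤ 1 / 4 := by
      rw [div_le_div_iff₀ (by positivity) (by norm_num)]; linarith
    linarith
  have hEc : Continuous fun t : ℝ => Real.exp (-(l * |t - s|)) := by fun_prop
  have hEc' : Continuous fun t : ℝ => Real.exp (l * |t - s|) := by fun_prop
  have hE : ∀ t : ℝ, Real.exp (-(l * |t - s|)) * Real.exp (l * |t - s|) = 1 := fun t => by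
    rw [← Real.exp_add]; simp
  have hE1 : ∀ t : ℝ, Real.exp (-(l * |t - s|)) ≤ 1 := fun t =>
    Real.exp_le_one_iff.2 (by simp only [Left.neg_nonpos_iff]; positivity)
  have hcont : ∀ y : BoundedContinuousFunction ℝ G,
      Continuous fun τ => Real.exp (l * |τ - s|) • y τ := fun y => hEc'.smul y.continuous
  -- the integral operator in exponentially weighted variables
  have hbd : ∀ (y : BoundedContinuousFunction ℝ G) (t : ℝ),
      ‖Real.exp (-(l * |t - s|)) • (x₀ + ∫ τ in s..t, F τ (Real.exp (l * |τ - s|) • y τ) ∂μI)‖ ≤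
        ‖x₀‖ + (‖y‖ * (1 / 2) + (B ^ 2 / (2 * l) + 1 / 4)) := by
    intro y t
    have h1 : ‖∫ τ in s..t, F τ (Real.exp (l * |τ - s|) • y τ) ∂μI‖ ≤
        (‖y‖ * (1 / 2) + (B ^ 2 / (2 * l) + 1 / 4)) * Real.exp (l * |t - s|) := by
      calc ‖∫ τ in s..t, F τ (Real.exp (l * |τ - s|) • y τ) ∂μI‖
          ≤ ∫ τ in uIoc s t, ‖F τ (Real.exp (l * |τ - s|) • y τ)‖ ∂μI :=
            intervalIntegral.norm_integral_le_integral_norm_uIoc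
        _ ≤ ∫ τ in uIoc s t, (‖y‖ * (a τ * Real.exp (l * |τ - s|))
              + b τ * Real.exp (l * |τ - s|)) ∂μI := by
            refine setIntegral_mono_on (hF.intervalIntegrable (hcont y) s t).norm.def'
              (((integrable_mul_exp_weight hF.memLp_lip l s t).const_mul _).add
                (integrable_mul_exp_weight hF.memLp_bound l s t)) measurableSet_uIoc fun τ _ => ?_
            refine (hF.norm_le τ _).trans ?_
            rw [norm_smul, Real.norm_of_nonneg (Real.exp_pos _).le]
            have h2 := y.norm_coe_le_norm τ
            have h3 : 0 ≤ b τ := (norm_nonneg _).trans (hF.bound τ)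
            have h4 : 1 ≤ Real.exp (l * |τ - s|) := Real.one_le_exp (by positivity)
            have h5 := mul_le_mul_of_nonneg_left h4 h3
            have h6 := mul_le_mul_of_nonneg_left h2
              (mul_nonneg (hF.lip_nonneg τ) (Real.exp_pos (l * |τ - s|)).le)
            linarith
        _ = ‖y‖ * ∫ τ in uIoc s t, a τ * Real.exp (l * |τ - s|) ∂μI
              + ∫ τ in uIoc s t, b τ * Real.exp (l * |τ - s|) ∂μI := by
            rw [integral_add ((integrable_mul_exp_weight hF.memLp_lip l s t).const_mul _)
                (integrable_mul_exp_weight hF.memLp_bound l s t), integral_const_mul]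
        _ ≤ ‖y‖ * ((A ^ 2 / (2 * l) + 1 / 4) * Real.exp (l * |t - s|))
              + (B ^ 2 / (2 * l) + 1 / 4) * Real.exp (l * |t - s|) := by
            gcongr
            · exact setIntegral_mul_exp_weight_le hF.memLp_lip hl0 hA s t
            · exact setIntegral_mul_exp_weight_le hF.memLp_bound hl0 hB s t
        _ ≤ ‖y‖ * ((1 / 2) * Real.exp (l * |t - s|))
              + (B ^ 2 / (2 * l) + 1 / 4) * Real.exp (l * |t - s|) := by gcongr
        _ = _ := by ring
    rw [norm_smul, Real.norm_of_nonneg (Real.exp_pos _).le]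
    calc _ ≤ Real.exp (-(l * |t - s|)) * (‖x₀‖
          + (‖y‖ * (1 / 2) + (B ^ 2 / (2 * l) + 1 / 4)) * Real.exp (l * |t - s|)) := by
          gcongr; exact (norm_add_le _ _).trans (by gcongr)
      _ = Real.exp (-(l * |t - s|)) * ‖x₀‖ + (‖y‖ * (1 / 2) + (B ^ 2 / (2 * l) + 1 / 4))
          * (Real.exp (-(l * |t - s|)) * Real.exp (l * |t - s|)) := by ring
      _ ≤ 1 * ‖x₀‖ + (‖y‖ * (1 / 2) + (B ^ 2 / (2 * l) + 1 / 4)) * 1 := by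
          rw [hE]; gcongr; exact hE1 t
      _ = _ := by ring
  let P : BoundedContinuousFunction ℝ G → BoundedContinuousFunction ℝ G := fun y =>
    BoundedContinuousFunction.ofNormedAddCommGroup
      (fun t => Real.exp (-(l * |t - s|)) •
        (x₀ + ∫ τ in s..t, F τ (Real.exp (l * |τ - s|) • y τ) ∂μI))
      (hEc.smul (continuous_const.add (intervalIntegral.continuous_primitive
        (fun _ _ => hF.intervalIntegrable (hcont y) _ _) s)))
      _ (hbd y)
  have hP : ContractingWith (1 / 2 : NNReal) P := by
    refine ⟨by rw [← NNReal.coe_lt_coe]; norm_num, LipschitzWith.of_dist_le_mul fun y z => ?_⟩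
    rw [BoundedContinuousFunction.dist_le (by positivity)]
    intro t
    have h0 : P y t - P z t = Real.exp (-(l * |t - s|)) • ∫ τ in s..t,
        (F τ (Real.exp (l * |τ - s|) • y τ) - F τ (Real.exp (l * |τ - s|) • z τ)) ∂μI := by
      rw [intervalIntegral.integral_sub (hF.intervalIntegrable (hcont y) _ _)
        (hF.intervalIntegrable (hcont z) _ _)]
      simp only [P, BoundedContinuousFunction.coe_ofNormedAddCommGroup]
      rw [← smul_sub]; congr 1; abel
    rw [dist_eq_norm, h0, norm_smul, Real.norm_of_nonneg (Real.exp_pos _).le]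
    have h1 : ‖∫ τ in s..t, (F τ (Real.exp (l * |τ - s|) • y τ)
        - F τ (Real.exp (l * |τ - s|) • z τ)) ∂μI‖ ≤
          dist y z * ((1 / 2) * Real.exp (l * |t - s|)) := by
      calc _ ≤ ∫ τ in uIoc s t, ‖F τ (Real.exp (l * |τ - s|) • y τ)
              - F τ (Real.exp (l * |τ - s|) • z τ)‖ ∂μI :=
            intervalIntegral.norm_integral_le_integral_norm_uIoc
        _ ≤ ∫ τ in uIoc s t, dist y z * (a τ * Real.exp (l * |τ - s|)) ∂μI := by
            refine setIntegral_mono_on ((hF.intervalIntegrable (hcont y) s t).sub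
              (hF.intervalIntegrable (hcont z) s t)).norm.def'
              ((integrable_mul_exp_weight hF.memLp_lip l s t).const_mul _)
              measurableSet_uIoc fun τ _ => ?_
            refine (hF.lip τ _ _).trans ?_
            rw [← smul_sub, norm_smul, Real.norm_of_nonneg (Real.exp_pos _).le, ← dist_eq_norm]
            have h2 := BoundedContinuousFunction.dist_coe_le_dist (f := y) (g := z) τ
            have h6 := mul_le_mul_of_nonneg_left h2
              (mul_nonneg (hF.lip_nonneg τ) (Real.exp_pos (l * |τ - s|)).le)
            linarith
        _ = dist y z * ∫ τ in uIoc s t, a τ * Real.exp (l * |τ - s|) ∂μI :=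
            integral_const_mul _ _
        _ ≤ dist y z * ((A ^ 2 / (2 * l) + 1 / 4) * Real.exp (l * |t - s|)) := by
            gcongr; exact setIntegral_mul_exp_weight_le hF.memLp_lip hl0 hA s t
        _ ≤ _ := by gcongr
    calc _ ≤ Real.exp (-(l * |t - s|)) * (dist y z * ((1 / 2) * Real.exp (l * |t - s|))) := by
          gcongr
      _ = dist y z * (1 / 2) * (Real.exp (-(l * |t - s|)) * Real.exp (l * |t - s|)) := by ring
      _ = _ := by rw [hE]; push_cast; ring
  obtain ⟨y, hy, -⟩ := hP.exists_fixedPoint 0 (edist_ne_top _ _)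
  refine ⟨fun t => Real.exp (l * |t - s|) • y t, hcont y, fun t => ?_⟩
  have h1 : y t = Real.exp (-(l * |t - s|)) •
      (x₀ + ∫ τ in s..t, F τ (Real.exp (l * |τ - s|) • y τ) ∂μI) := by
    conv_lhs => rw [← hy]
    rfl
  conv_lhs => rw [h1, smul_smul, mul_comm, hE, one_smul]

end IsCaratheodory

end Volterra

section ProductRule

variable {G₁ G₂ G₃ : Type*} [NormedAddCommGroup G₁] [NormedSpace ℝ G₁] [CompleteSpace G₁]
  [NormedAddCommGroup G₂] [NormedSpace ℝ G₂] [CompleteSpace G₂]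
  [NormedAddCommGroup G₃] [NormedSpace ℝ G₃] [CompleteSpace G₃]

lemma bilin_integral_integral_eq (B : G₁ →L[ℝ] G₂ →L[ℝ] G₃) {m : ℝ → G₁} {n : ℝ → G₂}
    (hm : Integrable m μI) (hn : Integrable n μI) {s t : ℝ} (hst : s ≤ t) :
    B (∫ τ in s..t, m τ ∂μI) (∫ τ in s..t, n τ ∂μI) =
      (∫ σ in s..t, B (m σ) (∫ τ in s..σ, n τ ∂μI) ∂μI)
        + ∫ τ in s..t, B (∫ σ in s..τ, m σ ∂μI) (n τ) ∂μI := by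
  set κ := (μI).restrict (Ioc s t) with hκ
  have hm' : Integrable m κ := hm.restrict
  have hn' : Integrable n κ := hn.restrict
  have hf : Integrable (fun z : ℝ × ℝ => B (m z.1) (n z.2)) (κ.prod κ) :=
    hm'.op_fst_snd (op := fun x y => B x y) (by fun_prop) ⟨‖B‖, B.le_opNorm₂⟩ hn'
  set S : Set (ℝ × ℝ) := {z | z.2 ≤ z.1} with hS
  have hSm : MeasurableSet S := measurableSet_le measurable_snd measurable_fst
  set f : ℝ × ℝ → G₃ := fun z => B (m z.1) (n z.2) with hfdef
  have e0 : ∫ z, f z ∂(κ.prod κ) = ∫ z, S.indicator f z ∂(κ.prod κ)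
      + ∫ z, Sᶜ.indicator f z ∂(κ.prod κ) := by
    rw [integral_indicator hSm, integral_indicator hSm.compl, integral_add_compl hSm hf]
  have e1 : ∫ z, S.indicator f z ∂(κ.prod κ) =
      ∫ σ in s..t, B (m σ) (∫ τ in s..σ, n τ ∂μI) ∂μI := by
    rw [integral_prod _ (hf.indicator hSm), intervalIntegral.integral_of_le hst]
    refine setIntegral_congr_fun measurableSet_Ioc fun σ hσ => ?_
    have : (fun τ => S.indicator f (σ, τ)) = (Iic σ).indicator fun τ => B (m σ) (n τ) := by
      ext τ; simp [Set.indicator, hS, hfdef]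
    simp only [this]
    rw [integral_indicator measurableSet_Iic, hκ, Measure.restrict_restrict measurableSet_Iic,
      intervalIntegral.integral_of_le hσ.1.le, ← ContinuousLinearMap.integral_comp_comm _ hn.restrict]
    congr 2
    ext x; simp only [mem_inter_iff, mem_Iic, mem_Ioc]
    exact ⟨fun h => ⟨h.2.1, h.1⟩, fun h => ⟨h.2, h.1, h.2.trans hσ.2⟩⟩
  have e2 : ∫ z, Sᶜ.indicator f z ∂(κ.prod κ) =
      ∫ τ in s..t, B (∫ σ in s..τ, m σ ∂μI) (n τ) ∂μI := by
    rw [integral_prod_symm _ (hf.indicator hSm.compl), intervalIntegral.integral_of_le hst]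
    refine setIntegral_congr_fun measurableSet_Ioc fun τ hτ => ?_
    have : (fun σ => Sᶜ.indicator f (σ, τ)) = (Iio τ).indicator fun σ => B.flip (n τ) (m σ) := by
      ext σ; simp [Set.indicator, hS, hfdef]
    simp only [this]
    rw [integral_indicator measurableSet_Iio, hκ, Measure.restrict_restrict measurableSet_Iio,
      intervalIntegral.integral_of_le hτ.1.le, ← ContinuousLinearMap.flip_apply,
      ← ContinuousLinearMap.integral_comp_comm _ hm.restrict, integral_Ioc_eq_integral_Ioo]
    congr 2
    ext x; simp only [mem_inter_iff, mem_Iio, mem_Ioc, mem_Ioo]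
    exact ⟨fun h => ⟨h.2.1, h.1⟩, fun h => ⟨h.2, h.1, h.2.le.trans hτ.2⟩⟩
  rw [intervalIntegral.integral_of_le hst, intervalIntegral.integral_of_le hst,
    ← integral_prod_bilin B hm' hn', ← e1, ← e2, ← e0]

/-- Product rule for indefinite integrals. -/
lemma bilin_eq_add_integral (B : G₁ →L[ℝ] G₂ →L[ℝ] G₃) {m M : ℝ → G₁} {n N : ℝ → G₂}
    (hm : Integrable m μI) (hn : Integrable n μI)
    (hM : ∀ s t, M t = M s + ∫ τ in s..t, m τ ∂μI)
    (hN : ∀ s t, N t = N s + ∫ τ in s..t, n τ ∂μI) (s t : ℝ) :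
    B (M t) (N t) = B (M s) (N s) + ∫ τ in s..t, (B (m τ) (N τ) + B (M τ) (n τ)) ∂μI := by
  have hi1 : ∀ s t : ℝ, ∀ N : ℝ → G₂, Continuous N →
      IntervalIntegrable (fun τ => B (m τ) (N τ)) μI s t := fun s t N hNc => by
    obtain ⟨c, hc⟩ := isCompact_uIcc.exists_bound_of_continuousOn (s := uIcc s t) hNc.continuousOn
    rw [intervalIntegrable_iff]
    refine Integrable.mono' (g := fun τ => ‖B‖ * ‖m τ‖ * c) ?_ ?_ ?_
    · exact ((hm.norm.const_mul _).mul_const _).restrict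
    · exact (B.aestronglyMeasurable_comp₂ hm.1 hNc.aestronglyMeasurable).restrict
    · refine (ae_restrict_iff' measurableSet_uIoc).2 (ae_of_all _ fun τ hτ => ?_)
      exact (B.le_opNorm₂ _ _).trans
        (mul_le_mul_of_nonneg_left (hc τ (uIoc_subset_uIcc hτ)) (by positivity))
  have hi2 : ∀ s t : ℝ, ∀ M : ℝ → G₁, Continuous M →
      IntervalIntegrable (fun τ => B (M τ) (n τ)) μI s t := fun s t M hMc => by
    obtain ⟨c, hc⟩ := isCompact_uIcc.exists_bound_of_continuousOn (s := uIcc s t) hMc.continuousOn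
    rw [intervalIntegrable_iff]
    refine Integrable.mono' (g := fun τ => ‖B‖ * c * ‖n τ‖) ?_ ?_ ?_
    · exact (hn.norm.const_mul _).restrict
    · exact (B.aestronglyMeasurable_comp₂ hMc.aestronglyMeasurable hn.1).restrict
    · refine (ae_restrict_iff' measurableSet_uIoc).2 (ae_of_all _ fun τ hτ => ?_)
      refine (B.le_opNorm₂ _ _).trans ?_
      gcongr
      exact hc τ (uIoc_subset_uIcc hτ)
  have main : ∀ s t : ℝ, s ≤ t →
      B (M t) (N t) = B (M s) (N s) + ∫ τ in s..t, (B (m τ) (N τ) + B (M τ) (n τ)) ∂μI := by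
    intro s t hst
    have hpM : Continuous fun τ => ∫ σ in s..τ, m σ ∂μI :=
      intervalIntegral.continuous_primitive (fun _ _ => hm.intervalIntegrable) s
    have hpN : Continuous fun τ => ∫ σ in s..τ, n σ ∂μI :=
      intervalIntegral.continuous_primitive (fun _ _ => hn.intervalIntegrable) s
    have h1 : ∀ τ, B (m τ) (N τ) + B (M τ) (n τ) =
        (B.flip (N s) (m τ) + B (m τ) (∫ σ in s..τ, n σ ∂μI))
          + (B (M s) (n τ) + B (∫ σ in s..τ, m σ ∂μI) (n τ)) := fun τ => by
      rw [hM s τ, hN s τ]; simp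
    have j1 := ((B.flip (N s)).integrable_comp hm).intervalIntegrable (a := s) (b := t)
    have j2 := ((B (M s)).integrable_comp hn).intervalIntegrable (a := s) (b := t)
    simp_rw [h1]
    rw [intervalIntegral.integral_add (j1.add (hi1 _ _ _ hpN)) (j2.add (hi2 _ _ _ hpM)),
      intervalIntegral.integral_add j1 (hi1 _ _ _ hpN),
      intervalIntegral.integral_add j2 (hi2 _ _ _ hpM),
      ContinuousLinearMap.intervalIntegral_comp_comm _ hm.intervalIntegrable,
      ContinuousLinearMap.intervalIntegral_comp_comm _ hn.intervalIntegrable,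
      hM s t, hN s t]
    have := bilin_integral_integral_eq B hm hn hst
    simp only [map_add, FunLike.coe_add, Pi.add_apply, ContinuousLinearMap.flip_apply]
    rw [this]; abel
  rcases le_total s t with h | h
  · exact main s t h
  · rw [main t s h, intervalIntegral.integral_symm]; abel

end ProductRule

section BoundedFamily

variable {V E : Type*} [NormedAddCommGroup V] [NormedSpace ℝ V]
  [NormedAddCommGroup E] [NormedSpace ℝ E]

/-- A linear family of vector fields on `E`, bounded in `C¹` by the norm of the parameter space `V`,
and with uniformly continuous derivatives. -/
structure IsBoundedC1Family (X : V →ₗ[ℝ] (E → E)) (C : ℝ) : Prop where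
  pos : 0 < C
  norm_le : ∀ u x, ‖X u x‖ ≤ C * ‖u‖
  contDiff : ∀ u, ContDiff ℝ 1 (X u)
  norm_fderiv_le : ∀ u x, ‖fderiv ℝ (X u) x‖ ≤ C * ‖u‖
  uniformContinuous_fderiv : ∀ u, UniformContinuous (fderiv ℝ (X u))

/-- The modulus of continuity of a map. -/
noncomputable def modulusOfContinuity {F : Type*} [NormedAddCommGroup F] (D : E → F) (δ : ℝ) : ℝ :=
  ⨆ p : {p : E × E // dist p.1 p.2 ≤ δ}, ‖D p.1.1 - D p.1.2‖

namespace IsBoundedC1Family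

variable {X : V →ₗ[ℝ] (E → E)} {C : ℝ}

lemma differentiable (hX : IsBoundedC1Family X C) (u : V) : Differentiable ℝ (X u) :=
  (hX.contDiff u).differentiable one_ne_zero

lemma norm_sub_le (hX : IsBoundedC1Family X C) (u : V) (x y : E) :
    ‖X u x - X u y‖ ≤ C * ‖u‖ * ‖x - y‖ :=
  convex_univ.norm_image_sub_le_of_norm_fderiv_le (fun z _ => hX.differentiable u z)
    (fun z _ => hX.norm_fderiv_le u z) (mem_univ y) (mem_univ x)

lemma fderiv_sub (hX : IsBoundedC1Family X C) (u w : V) (x : E) :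
    fderiv ℝ (X (u - w)) x = fderiv ℝ (X u) x - fderiv ℝ (X w) x := by
  rw [map_sub]
  exact _root_.fderiv_sub (hX.differentiable u x) (hX.differentiable w x)

lemma continuous_eval (hX : IsBoundedC1Family X C) : Continuous fun p : V × E => X p.1 p.2 := by
  rw [continuous_iff_continuousAt]
  rintro ⟨u, x⟩
  have h2 : ContinuousAt (fun p : V × E => X u p.2) (u, x) :=
    ((hX.differentiable u).continuous.comp continuous_snd).continuousAt
  have h1 : Tendsto (fun p : V × E => X p.1 p.2 - X u p.2) (𝓝 (u, x)) (𝓝 0) := by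
    refine squeeze_zero_norm (a := fun p : V × E => C * ‖p.1 - u‖) (fun p => ?_) ?_
    · have := hX.norm_le (p.1 - u) p.2
      rwa [map_sub, Pi.sub_apply] at this
    · have : Continuous fun p : V × E => C * ‖p.1 - u‖ := by fun_prop
      simpa using this.tendsto (u, x)
  simpa [ContinuousAt] using h1.add h2

lemma continuous_fderiv (hX : IsBoundedC1Family X C) :
    Continuous fun p : V × E => fderiv ℝ (X p.1) p.2 := by
  rw [continuous_iff_continuousAt]
  rintro ⟨u, x⟩
  have h2 : ContinuousAt (fun p : V × E => fderiv ℝ (X u) p.2) (u, x) :=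
    (((hX.contDiff u).continuous_fderiv one_ne_zero).comp continuous_snd).continuousAt
  have h1 : Tendsto (fun p : V × E => fderiv ℝ (X p.1) p.2 - fderiv ℝ (X u) p.2)
      (𝓝 (u, x)) (𝓝 0) := by
    refine squeeze_zero_norm (a := fun p : V × E => C * ‖p.1 - u‖) (fun p => ?_) ?_
    · rw [← hX.fderiv_sub]; exact hX.norm_fderiv_le _ _
    · have : Continuous fun p : V × E => C * ‖p.1 - u‖ := by fun_prop
      simpa using this.tendsto (u, x)
  simpa [ContinuousAt] using h1.add h2

lemma norm_fderiv_sub_le_two_mul (hX : IsBoundedC1Family X C) (u : V) (x y : E) :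
    ‖fderiv ℝ (X u) x - fderiv ℝ (X u) y‖ ≤ 2 * C * ‖u‖ :=
  (_root_.norm_sub_le _ _).trans (by linarith [hX.norm_fderiv_le u x, hX.norm_fderiv_le u y])

lemma norm_fderiv_sub_le_modulus (hX : IsBoundedC1Family X C) (u : V) {x y : E} {δ : ℝ}
    (h : ‖x - y‖ ≤ δ) :
    ‖fderiv ℝ (X u) x - fderiv ℝ (X u) y‖ ≤ modulusOfContinuity (fderiv ℝ (X u)) δ :=
  le_ciSup (f := fun p : {p : E × E // dist p.1 p.2 ≤ δ} =>
      ‖fderiv ℝ (X u) p.1.1 - fderiv ℝ (X u) p.1.2‖)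
    ⟨2 * C * ‖u‖, by rintro _ ⟨p, rfl⟩; exact hX.norm_fderiv_sub_le_two_mul _ _ _⟩
    ⟨(x, y), by rwa [dist_eq_norm]⟩

lemma modulus_le (hX : IsBoundedC1Family X C) (u : V) (δ : ℝ) :
    modulusOfContinuity (fderiv ℝ (X u)) δ ≤ 2 * C * ‖u‖ :=
  Real.iSup_le (fun _ => hX.norm_fderiv_sub_le_two_mul _ _ _)
    (mul_nonneg (by linarith [hX.pos]) (norm_nonneg _))

lemma modulus_nonneg (u : V) (δ : ℝ) : 0 ≤ modulusOfContinuity (fderiv ℝ (X u)) δ :=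
  Real.iSup_nonneg fun _ => norm_nonneg _

lemma modulus_le_add (hX : IsBoundedC1Family X C) (u w : V) (δ : ℝ) :
    modulusOfContinuity (fderiv ℝ (X u)) δ ≤
      modulusOfContinuity (fderiv ℝ (X w)) δ + 2 * C * ‖u - w‖ := by
  refine Real.iSup_le (fun p => ?_) (add_nonneg (modulus_nonneg w δ)
    (mul_nonneg (by linarith [hX.pos]) (norm_nonneg _)))
  have h1 := hX.norm_fderiv_sub_le_two_mul (u - w) p.1.1 p.1.2
  have h2 := hX.norm_fderiv_sub_le_modulus w (x := p.1.1) (y := p.1.2) (δ := δ)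
    (by rw [← dist_eq_norm]; exact p.2)
  have h3 : fderiv ℝ (X u) p.1.1 - fderiv ℝ (X u) p.1.2 =
      (fderiv ℝ (X w) p.1.1 - fderiv ℝ (X w) p.1.2)
        + (fderiv ℝ (X (u - w)) p.1.1 - fderiv ℝ (X (u - w)) p.1.2) := by
    rw [hX.fderiv_sub, hX.fderiv_sub]; abel
  rw [h3]
  exact (norm_add_le _ _).trans (add_le_add h2 h1)

lemma continuous_modulus (hX : IsBoundedC1Family X C) (δ : ℝ) :
    Continuous fun u => modulusOfContinuity (fderiv ℝ (X u)) δ := by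
  have hC : (0 : ℝ) ≤ 2 * C := by linarith [hX.pos]
  refine (LipschitzWith.of_dist_le_mul (K := (2 * C).toNNReal) fun u w => ?_).continuous
  rw [Real.dist_eq, abs_le, dist_eq_norm, Real.coe_toNNReal _ hC]
  have h1 := hX.modulus_le_add u w δ
  have h2 := hX.modulus_le_add w u δ
  rw [norm_sub_rev] at h2
  constructor <;> linarith

lemma tendsto_modulus (hX : IsBoundedC1Family X C) (u : V) :
    Tendsto (fun k : ℕ => modulusOfContinuity (fderiv ℝ (X u)) (1 / (k + 1))) atTop (𝓝 0) := by
  rw [Metric.tendsto_atTop]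
  intro ε hε
  obtain ⟨δ, hδ, h⟩ := Metric.uniformContinuous_iff.1 (hX.uniformContinuous_fderiv u) (ε / 2)
    (by positivity)
  obtain ⟨k₀, hk₀⟩ := exists_nat_one_div_lt hδ
  refine ⟨k₀, fun k hk => ?_⟩
  rw [Real.dist_eq, sub_zero, abs_of_nonneg (modulus_nonneg _ _)]
  refine (Real.iSup_le (fun p => ?_) (by positivity)).trans_lt (half_lt_self hε)
  rw [← dist_eq_norm]
  refine (h (p.2.trans_lt (lt_of_le_of_lt ?_ hk₀))).le
  exact Nat.one_div_le_one_div hk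

lemma exists_integral_modulus_le (hX : IsBoundedC1Family X C) {v : ℝ → V}
    (hv : Integrable v μI) {ε : ℝ} (hε : 0 < ε) :
    ∃ δ > 0, δ ≤ ε ∧ ∫ τ, modulusOfContinuity (fderiv ℝ (X (v τ))) δ ∂μI ≤ ε := by
  have h : Tendsto (fun k : ℕ => ∫ τ, modulusOfContinuity (fderiv ℝ (X (v τ))) (1 / (k + 1)) ∂μI)
      atTop (𝓝 (∫ _, (0 : ℝ) ∂μI)) := by
    refine tendsto_integral_of_dominated_convergence (fun τ => 2 * C * ‖v τ‖) (fun k => ?_)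
      (hv.norm.const_mul _) (fun k => ae_of_all _ fun τ => ?_)
      (ae_of_all _ fun τ => hX.tendsto_modulus (v τ))
    · exact (hX.continuous_modulus _).comp_aestronglyMeasurable hv.1
    · rw [Real.norm_of_nonneg (modulus_nonneg _ _)]; exact hX.modulus_le _ _
  rw [integral_zero] at h
  obtain ⟨k, h1, h2⟩ := ((h.eventually (ge_mem_nhds hε)).and
    (tendsto_one_div_add_atTop_nhds_zero_nat.eventually (ge_mem_nhds hε))).exists
  exact ⟨1 / (k + 1), by positivity, h2, h1⟩

lemma integrable_modulus (hX : IsBoundedC1Family X C) {v : ℝ → V}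
    (hv : Integrable v μI) (δ : ℝ) :
    Integrable (fun τ => modulusOfContinuity (fderiv ℝ (X (v τ))) δ) μI := by
  refine Integrable.mono' (hv.norm.const_mul (2 * C))
    ((hX.continuous_modulus _).comp_aestronglyMeasurable hv.1) (ae_of_all _ fun τ => ?_)
  rw [Real.norm_of_nonneg (modulus_nonneg _ _)]; exact hX.modulus_le _ _

end IsBoundedC1Family

end BoundedFamily

section Velocity

variable {V : Type*} [NormedAddCommGroup V]

lemma integrable_velocity (v : Lp V 2 μI) : Integrable v μI :=
  (Lp.memLp v).integrable (by norm_num)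

lemma integral_norm_sq_velocity (v : Lp V 2 μI) : ∫ τ, ‖v τ‖ ^ 2 ∂μI = ‖v‖ ^ 2 := by
  have h := integral_eq_lintegral_of_nonneg_ae (μ := μI) (f := fun τ => ‖v τ‖ ^ 2)
    (ae_of_all _ fun τ => by positivity) ((Lp.aestronglyMeasurable v).norm.pow 2)
  rw [h, Lp.norm_def, eLpNorm_eq_lintegral_rpow_enorm_toReal (by norm_num) (by norm_num)]
  simp only [ENNReal.toReal_ofNat, ENNReal.rpow_ofNat]
  rw [← ENNReal.toReal_rpow, one_div, ← Real.rpow_natCast, ← Real.rpow_mul (by positivity)]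
  norm_num

lemma integral_norm_velocity_le (v : Lp V 2 μI) : ∫ τ, ‖v τ‖ ∂μI ≤ ‖v‖ := by
  have h := eLpNorm_le_eLpNorm_of_exponent_le (μ := μI) (p := 1) (q := 2) (by norm_num)
    (Lp.aestronglyMeasurable v)
  rw [integral_norm_eq_lintegral_enorm (Lp.aestronglyMeasurable v),
    ← eLpNorm_one_eq_lintegral_enorm, Lp.norm_def]
  exact ENNReal.toReal_mono (Lp.memLp v).2.ne h

lemma norm_intervalIntegral_le_integral {G : Type*} [NormedAddCommGroup G] [NormedSpace ℝ G]
    {f : ℝ → G} {g : ℝ → ℝ} (hg : Integrable g μI) (h : ∀ᵐ τ ∂μI, ‖f τ‖ ≤ g τ) (s t : ℝ) :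
    ‖∫ τ in s..t, f τ ∂μI‖ ≤ ∫ τ, g τ ∂μI := by
  have hg0 : 0 ≤ᵐ[μI] g := h.mono fun τ hτ => (norm_nonneg _).trans hτ
  calc ‖∫ τ in s..t, f τ ∂μI‖ ≤ ∫ τ in uIoc s t, ‖f τ‖ ∂μI :=
        intervalIntegral.norm_integral_le_integral_norm_uIoc
    _ ≤ ∫ τ in uIoc s t, g τ ∂μI := integral_mono_of_nonneg (ae_of_all _ fun τ => norm_nonneg _)
        hg.restrict (ae_restrict_of_ae h)
    _ ≤ _ := setIntegral_le_integral hg hg0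

lemma norm_intervalIntegral_le_mul_norm {G : Type*} [NormedAddCommGroup G] [NormedSpace ℝ G]
    {f : ℝ → G} {c : ℝ} (hc : 0 ≤ c) (v : Lp V 2 μI) (h : ∀ᵐ τ ∂μI, ‖f τ‖ ≤ c * ‖v τ‖) (s t : ℝ) :
    ‖∫ τ in s..t, f τ ∂μI‖ ≤ c * ‖v‖ := by
  refine (norm_intervalIntegral_le_integral ((integrable_velocity v).norm.const_mul c) h s t).trans ?_
  rw [integral_const_mul]
  gcongr
  exact integral_norm_velocity_le v

lemma integral_lip_sq (C : ℝ) (v : Lp V 2 μI) :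
    ∫ τ, (C * ‖v τ‖) ^ 2 ∂μI ≤ (C * ‖v‖) ^ 2 := by
  simp_rw [mul_pow]
  rw [integral_const_mul, integral_norm_sq_velocity]

end Velocity

section Flow

variable {V E : Type*} [NormedAddCommGroup V] [NormedSpace ℝ V]
  [NormedAddCommGroup E] [NormedSpace ℝ E]
  {X : V →ₗ[ℝ] (E → E)} {C : ℝ}

namespace IsBoundedC1Family

lemma isCaratheodory (hX : IsBoundedC1Family X C) (v : Lp V 2 μI) :
    IsCaratheodory (fun τ => X (v τ)) (fun τ => C * ‖v τ‖) (fun τ => C * ‖v τ‖) where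
  memLp_lip := (Lp.memLp v).norm.const_mul C
  memLp_bound := (Lp.memLp v).norm.const_mul C
  lip_nonneg _ := mul_nonneg hX.pos.le (norm_nonneg _)
  lip τ x y := hX.norm_sub_le (v τ) x y
  bound _ := hX.norm_le _ _
  aestronglyMeasurable _ hx := hX.continuous_eval.comp_aestronglyMeasurable
    ((Lp.aestronglyMeasurable v).prodMk hx.aestronglyMeasurable)

/-- The linearized field along a trajectory. -/
lemma isCaratheodory_linearized (hX : IsBoundedC1Family X C) (v h : Lp V 2 μI) {x : ℝ → E}
    (hx : Continuous x) :
    IsCaratheodory (fun τ z => fderiv ℝ (X (v τ)) (x τ) z + X (h τ) (x τ))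
      (fun τ => C * ‖v τ‖) (fun τ => C * ‖h τ‖) where
  memLp_lip := (Lp.memLp v).norm.const_mul C
  memLp_bound := (Lp.memLp h).norm.const_mul C
  lip_nonneg _ := mul_nonneg hX.pos.le (norm_nonneg _)
  lip τ y z := by
    rw [add_sub_add_right_eq_sub, ← map_sub]
    exact (ContinuousLinearMap.le_opNorm _ _).trans
      (mul_le_mul_of_nonneg_right (hX.norm_fderiv_le _ _) (norm_nonneg _))
  bound τ := by simpa using hX.norm_le _ _
  aestronglyMeasurable z hz := by
    refine AEStronglyMeasurable.add ?_ ?_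
    · exact (ContinuousLinearMap.id ℝ (E →L[ℝ] E)).aestronglyMeasurable_comp₂
        (hX.continuous_fderiv.comp_aestronglyMeasurable ((Lp.aestronglyMeasurable v).prodMk
          hx.aestronglyMeasurable)) hz.aestronglyMeasurable
    · exact hX.continuous_eval.comp_aestronglyMeasurable
        ((Lp.aestronglyMeasurable h).prodMk hx.aestronglyMeasurable)

end IsBoundedC1Family

variable [CompleteSpace E]

open Classical in
/-- The flow of `v ∈ L²([0,1], V)` from time `s` to time `t`, for a family of fields `X`. -/
noncomputable def familyFlow (X : V →ₗ[ℝ] (E → E)) (v : Lp V 2 μI) (s t : ℝ) (y : E) : E :=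
  if h : ∃ x, IsSolution (fun τ => X (v τ)) s y x then h.choose t else y

/-- Constant in the stability estimates for flows of velocity fields of norm at most `R`. -/
noncomputable def flowConst (C R : ℝ) : ℝ := 2 * Real.exp (2 * (C * R) ^ 2 + 1)

lemma flowConst_pos (C R : ℝ) : 0 < flowConst C R := by unfold flowConst; positivity

lemma exp_le_flowConst {C r R T : ℝ} (hC : 0 ≤ C) (hr : 0 ≤ r) (hrR : r ≤ R) (hT : T ≤ 1) :
    2 * Real.exp ((2 * (C * r) ^ 2 + 1) * T) ≤ flowConst C R := by
  unfold flowConst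
  gcongr
  calc (2 * (C * r) ^ 2 + 1) * T ≤ (2 * (C * r) ^ 2 + 1) * 1 := by gcongr
    _ = 2 * (C * r) ^ 2 + 1 := mul_one _
    _ ≤ _ := by gcongr

lemma abs_sub_le_one {s t : ℝ} (hs : s ∈ Icc (0 : ℝ) 1) (ht : t ∈ Icc (0 : ℝ) 1) : |t - s| ≤ 1 := by
  rw [abs_le]; constructor <;> linarith [hs.1, hs.2, ht.1, ht.2]

namespace IsBoundedC1Family

lemma isSolution_familyFlow (hX : IsBoundedC1Family X C) (v : Lp V 2 μI) (s : ℝ) (y : E) :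
    IsSolution (fun τ => X (v τ)) s y (fun t => familyFlow X v s t y) := by
  have h : ∃ x, IsSolution (fun τ => X (v τ)) s y x := (hX.isCaratheodory v).exists_isSolution s y
  simp only [familyFlow, dif_pos h]
  exact h.choose_spec

lemma familyFlow_eq (hX : IsBoundedC1Family X C) {v : Lp V 2 μI} {s : ℝ} {y : E} {x : ℝ → E}
    (hx : IsSolution (fun τ => X (v τ)) s y x) (t : ℝ) : familyFlow X v s t y = x t :=
  congrFun ((hX.isCaratheodory v).eq_of_isSolution (hX.isSolution_familyFlow v s y) hx) t

lemma familyFlow_self (hX : IsBoundedC1Family X C) (v : Lp V 2 μI) (s : ℝ) (y : E) :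
    familyFlow X v s s y = y := (hX.isSolution_familyFlow v s y).apply_initial

lemma familyFlow_familyFlow (hX : IsBoundedC1Family X C) (v : Lp V 2 μI) (s r t : ℝ) (y : E) :
    familyFlow X v r t (familyFlow X v s r y) = familyFlow X v s t y :=
  hX.familyFlow_eq ((hX.isSolution_familyFlow v s y).restart (hX.isCaratheodory v) r) t

lemma continuous_familyFlow_time (hX : IsBoundedC1Family X C) (v : Lp V 2 μI) (s : ℝ) (y : E) :
    Continuous fun t => familyFlow X v s t y := (hX.isSolution_familyFlow v s y).continuous

lemma norm_familyFlow_sub_le (hX : IsBoundedC1Family X C) (v w : Lp V 2 μI) (s t : ℝ) (y z : E) :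
    ‖familyFlow X v s t y - familyFlow X w s t z‖ ≤
      2 * Real.exp ((2 * (C * ‖w‖) ^ 2 + 1) * |t - s|) * (‖y - z‖ + C * ‖v - w‖) := by
  refine (hX.isCaratheodory w).norm_sub_le (integral_lip_sq C w)
    (hX.isSolution_familyFlow w s z) (hX.continuous_familyFlow_time v s y) (fun r => ?_) t
  have hc := hX.continuous_familyFlow_time v s y
  have e : familyFlow X v s r y - z - ∫ τ in s..r, X (w τ) (familyFlow X v s τ y) ∂μI =
      (y - z) + ∫ τ in s..r, (X (v τ) (familyFlow X v s τ y)
        - X (w τ) (familyFlow X v s τ y)) ∂μI := by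
    rw [intervalIntegral.integral_sub ((hX.isCaratheodory v).intervalIntegrable hc _ _)
      ((hX.isCaratheodory w).intervalIntegrable hc _ _), (hX.isSolution_familyFlow v s y).eq r]
    abel
  rw [e]
  refine (norm_add_le _ _).trans (add_le_add le_rfl
    (norm_intervalIntegral_le_mul_norm hX.pos.le _ ?_ _ _))
  filter_upwards [Lp.coeFn_sub v w] with τ hτ
  rw [hτ, Pi.sub_apply, ← Pi.sub_apply, ← map_sub]
  exact hX.norm_le _ _

lemma norm_familyFlow_sub_le_flowConst (hX : IsBoundedC1Family X C) {v w : Lp V 2 μI} {R : ℝ}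
    (hw : ‖w‖ ≤ R) {s t : ℝ} (hs : s ∈ Icc (0 : ℝ) 1) (ht : t ∈ Icc (0 : ℝ) 1) (y z : E) :
    ‖familyFlow X v s t y - familyFlow X w s t z‖ ≤
      flowConst C R * (‖y - z‖ + C * ‖v - w‖) := by
  refine (hX.norm_familyFlow_sub_le v w s t y z).trans ?_
  have := hX.pos
  gcongr
  exact exp_le_flowConst hX.pos.le (norm_nonneg _) hw (abs_sub_le_one hs ht)

lemma continuous_familyFlow (hX : IsBoundedC1Family X C) :
    Continuous fun p : Lp V 2 μI × ℝ × ℝ × E => familyFlow X p.1 p.2.1 p.2.2.1 p.2.2.2 := by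
  rw [continuous_iff_continuousAt]
  rintro ⟨v, s, t, y⟩
  have h2 : ContinuousAt (fun p : Lp V 2 μI × ℝ × ℝ × E => familyFlow X v s p.2.2.1 y)
      (v, s, t, y) :=
    ((hX.continuous_familyFlow_time v s y).comp (by fun_prop : Continuous
      fun p : Lp V 2 μI × ℝ × ℝ × E => p.2.2.1)).continuousAt
  have h1 : Tendsto (fun p : Lp V 2 μI × ℝ × ℝ × E => familyFlow X p.1 p.2.1 p.2.2.1 p.2.2.2
      - familyFlow X v s p.2.2.1 y) (𝓝 (v, s, t, y)) (𝓝 0) := by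
    refine squeeze_zero_norm (a := fun p : Lp V 2 μI × ℝ × ℝ × E =>
      2 * Real.exp ((2 * (C * ‖v‖) ^ 2 + 1) * |p.2.2.1 - p.2.1|) *
        (‖p.2.2.2 - familyFlow X v s p.2.1 y‖ + C * ‖p.1 - v‖)) (fun p => ?_) ?_
    · rw [← hX.familyFlow_familyFlow v s p.2.1 p.2.2.1 y]
      exact hX.norm_familyFlow_sub_le _ _ _ _ _ _
    · have hc : Continuous fun p : Lp V 2 μI × ℝ × ℝ × E => familyFlow X v s p.2.1 y :=
        (hX.continuous_familyFlow_time v s y).comp (by fun_prop)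
      have : Continuous fun p : Lp V 2 μI × ℝ × ℝ × E =>
          2 * Real.exp ((2 * (C * ‖v‖) ^ 2 + 1) * |p.2.2.1 - p.2.1|) *
        (‖p.2.2.2 - familyFlow X v s p.2.1 y‖ + C * ‖p.1 - v‖) := by fun_prop
      have h3 := this.tendsto (v, s, t, y)
      simpa [hX.familyFlow_self] using h3
  simpa [ContinuousAt] using h1.add h2

lemma continuous_familyFlow_point (hX : IsBoundedC1Family X C) (v : Lp V 2 μI) (s t : ℝ) :
    Continuous (familyFlow X v s t) :=
  hX.continuous_familyFlow.comp (by fun_prop : Continuous fun y : E =>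
    ((v, s, t, y) : Lp V 2 μI × ℝ × ℝ × E))

end IsBoundedC1Family

end Flow

section LinearizedFlow

variable {V E : Type*} [NormedAddCommGroup V] [NormedSpace ℝ V]
  [NormedAddCommGroup E] [NormedSpace ℝ E]
  {X : V →ₗ[ℝ] (E → E)} {C : ℝ}

namespace IsBoundedC1Family

lemma norm_linearized_le (hX : IsBoundedC1Family X C) {v h : Lp V 2 μI} {R : ℝ} (hv : ‖v‖ ≤ R)
    {x : ℝ → E} (hx : Continuous x) {s : ℝ} {k : E} {η : ℝ → E}
    (hη : IsSolution (fun τ z => fderiv ℝ (X (v τ)) (x τ) z + X (h τ) (x τ)) s k η)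
    (hs : s ∈ Icc (0 : ℝ) 1) {t : ℝ} (ht : t ∈ Icc (0 : ℝ) 1) :
    ‖η t‖ ≤ flowConst C R * (‖k‖ + C * ‖h‖) := by
  have h1 := (hX.isCaratheodory_linearized v h hx).norm_sub_le (integral_lip_sq C v) hη
    (y := fun _ => 0) continuous_const (e := ‖k‖ + C * ‖h‖) (fun r => ?_) t
  · rw [zero_sub, norm_neg] at h1
    refine h1.trans ?_
    have := hX.pos
    gcongr
    exact exp_le_flowConst hX.pos.le (norm_nonneg _) hv (abs_sub_le_one hs ht)
  · rw [zero_sub, ← norm_neg, neg_sub, sub_neg_eq_add, add_comm]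
    refine (norm_add_le _ _).trans (add_le_add le_rfl
      (norm_intervalIntegral_le_mul_norm hX.pos.le _ (ae_of_all _ fun τ => ?_) _ _))
    simpa using hX.norm_le _ _

variable [CompleteSpace E]

/-- The flow is strictly differentiable in the velocity and the initial point, uniformly in the
times and the initial point. -/
theorem exists_norm_familyFlow_sub_sub_le (hX : IsBoundedC1Family X C) (v : Lp V 2 μI) {ε : ℝ}
    (hε : 0 < ε) : ∃ r > 0, ∀ v₁ v₂ : Lp V 2 μI, ∀ y y₁ y₂ : E, ‖v₁ - v‖ ≤ r → ‖v₂ - v‖ ≤ r →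
      ‖y₁ - y‖ ≤ r → ‖y₂ - y‖ ≤ r → ∀ s ∈ Icc (0 : ℝ) 1, ∀ t ∈ Icc (0 : ℝ) 1, ∀ η : ℝ → E,
      IsSolution (fun τ z => fderiv ℝ (X (v τ)) (familyFlow X v s τ y) z
        + X ((v₁ - v₂ : Lp V 2 μI) τ) (familyFlow X v s τ y)) s (y₁ - y₂) η →
      ‖familyFlow X v₁ s t y₁ - familyFlow X v₂ s t y₂ - η t‖ ≤
        ε * (‖v₁ - v₂‖ + ‖y₁ - y₂‖) := by
  have hC := hX.pos
  set R := ‖v‖ + 1 with hR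
  set K := flowConst C R with hK
  have hK0 : 0 < K := flowConst_pos _ _
  set κ := ε / (K * (1 + 2 * K * (1 + C))) with hκ
  have hκ0 : 0 < κ := by positivity
  obtain ⟨δ, hδ0, hδκ, hδ⟩ := hX.exists_integral_modulus_le (integrable_velocity v)
    (lt_min hκ0 (div_pos hκ0 hC))
  have hCδ : C * δ ≤ κ := by
    have := hδκ.trans (min_le_right _ _)
    rwa [le_div_iff₀ hC, mul_comm] at this
  set r := min 1 (min (δ / (K * (1 + C))) (κ / C)) with hr
  have hr1 : r ≤ 1 := min_le_left _ _
  have hr2 : K * (r + C * r) ≤ δ := by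
    have : r ≤ δ / (K * (1 + C)) := (min_le_right _ _).trans (min_le_left _ _)
    rw [le_div_iff₀ (by positivity)] at this
    linarith
  have hr3 : C * r ≤ κ := by
    have : r ≤ κ / C := (min_le_right _ _).trans (min_le_right _ _)
    rwa [le_div_iff₀ hC, mul_comm] at this
  refine ⟨r, by positivity, fun v₁ v₂ y y₁ y₂ hv₁ hv₂ hy₁ hy₂ s hs t ht η hη => ?_⟩
  set x := fun τ => familyFlow X v s τ y with hx
  set x₁ := fun τ => familyFlow X v₁ s τ y₁ with hx₁
  set x₂ := fun τ => familyFlow X v₂ s τ y₂ with hx₂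
  have hxc : Continuous x := hX.continuous_familyFlow_time v s y
  have hxc₁ : Continuous x₁ := hX.continuous_familyFlow_time v₁ s y₁
  have hxc₂ : Continuous x₂ := hX.continuous_familyFlow_time v₂ s y₂
  have hvR : ‖v‖ ≤ R := by linarith
  have hvR₂ : ‖v₂‖ ≤ R := by
    have := norm_add_le (v₂ - v) v
    rw [sub_add_cancel] at this; linarith
  have hd₁ : ∀ τ ∈ Icc (0 : ℝ) 1, ‖x₁ τ - x τ‖ ≤ δ := fun τ hτ =>
    (hX.norm_familyFlow_sub_le_flowConst hvR hs hτ y₁ y).trans ((by gcongr : _ ≤ _).trans hr2)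
  have hd₂ : ∀ τ ∈ Icc (0 : ℝ) 1, ‖x₂ τ - x τ‖ ≤ δ := fun τ hτ =>
    (hX.norm_familyFlow_sub_le_flowConst hvR hs hτ y₂ y).trans ((by gcongr : _ ≤ _).trans hr2)
  set D := K * (‖y₁ - y₂‖ + C * ‖v₁ - v₂‖) with hD
  have hd₁₂ : ∀ τ ∈ Icc (0 : ℝ) 1, ‖x₁ τ - x₂ τ‖ ≤ D := fun τ hτ =>
    hX.norm_familyFlow_sub_le_flowConst hvR₂ hs hτ y₁ y₂
  have hD0 : 0 ≤ D := by positivity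
  set g : ℝ → ℝ := fun τ => C * δ * ‖(v₁ - v₂ : Lp V 2 μI) τ‖ + (C * D * ‖(v₂ - v : Lp V 2 μI) τ‖
    + D * modulusOfContinuity (fderiv ℝ (X (v τ))) δ) with hg
  have hi1 := (integrable_velocity (v₁ - v₂)).norm.const_mul (C * δ)
  have hi2 := (integrable_velocity (v₂ - v)).norm.const_mul (C * D)
  have hi3 := (hX.integrable_modulus (integrable_velocity v) δ).const_mul D
  have hgi : Integrable g μI := hi1.add (hi2.add hi3)
  have hgle : ∫ τ, g τ ∂μI ≤ κ * ‖v₁ - v₂‖ + 2 * κ * D := by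
    have e : ∫ τ, g τ ∂μI = C * δ * ∫ τ, ‖(v₁ - v₂ : Lp V 2 μI) τ‖ ∂μI
        + (C * D * ∫ τ, ‖(v₂ - v : Lp V 2 μI) τ‖ ∂μI
          + D * ∫ τ, modulusOfContinuity (fderiv ℝ (X (v τ))) δ ∂μI) := by
      rw [← integral_const_mul, ← integral_const_mul, ← integral_const_mul,
        ← integral_add hi2 hi3]
      exact integral_add hi1 (hi2.add hi3)
    rw [e]
    have n1 := integral_norm_velocity_le (v₁ - v₂)
    have n2 := (integral_norm_velocity_le (v₂ - v)).trans hv₂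
    have n3 := hδ.trans (min_le_left _ _)
    calc _ ≤ C * δ * ‖v₁ - v₂‖ + (C * D * r + D * κ) := by gcongr
      _ ≤ κ * ‖v₁ - v₂‖ + (κ * D + D * κ) := by
          have : C * δ * ‖v₁ - v₂‖ ≤ κ * ‖v₁ - v₂‖ := by gcongr
          have : C * r * D ≤ κ * D := by gcongr
          linarith
      _ = _ := by ring
  have hmain := (hX.isCaratheodory_linearized v (v₁ - v₂) hxc).norm_sub_le (integral_lip_sq C v) hη
    (y := fun τ => x₁ τ - x₂ τ) (hxc₁.sub hxc₂) (e := κ * ‖v₁ - v₂‖ + 2 * κ * D) (fun q => ?_) t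
  · refine hmain.trans ?_
    calc _ ≤ K * (κ * ‖v₁ - v₂‖ + 2 * κ * D) := by
          gcongr; exact exp_le_flowConst hC.le (norm_nonneg _) hvR (abs_sub_le_one hs ht)
      _ ≤ K * (κ * (‖v₁ - v₂‖ + ‖y₁ - y₂‖)
            + 2 * κ * (K * ((1 + C) * (‖v₁ - v₂‖ + ‖y₁ - y₂‖)))) := by
          rw [hD]
          gcongr
          · linarith [norm_nonneg (y₁ - y₂)]
          · nlinarith [norm_nonneg (y₁ - y₂), norm_nonneg (v₁ - v₂),
              mul_nonneg hC.le (norm_nonneg (y₁ - y₂))]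
      _ = ε * (‖v₁ - v₂‖ + ‖y₁ - y₂‖) := by rw [hκ]; field_simp
  · have hI₁ := (hX.isCaratheodory v₁).intervalIntegrable hxc₁ s q
    have hI₂ := (hX.isCaratheodory v₂).intervalIntegrable hxc₂ s q
    have hI₃ : IntervalIntegrable (fun τ => fderiv ℝ (X (v τ)) (x τ) (x₁ τ - x₂ τ)
        + X ((v₁ - v₂ : Lp V 2 μI) τ) (x τ)) μI s q :=
      (hX.isCaratheodory_linearized v (v₁ - v₂) hxc).intervalIntegrable (hxc₁.sub hxc₂) s q
    have q₁ : x₁ q = y₁ + ∫ τ in s..q, X (v₁ τ) (x₁ τ) ∂μI :=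
      (hX.isSolution_familyFlow v₁ s y₁).eq q
    have q₂ : x₂ q = y₂ + ∫ τ in s..q, X (v₂ τ) (x₂ τ) ∂μI :=
      (hX.isSolution_familyFlow v₂ s y₂).eq q
    have e : x₁ q - x₂ q - (y₁ - y₂) - ∫ τ in s..q, (fderiv ℝ (X (v τ)) (x τ) (x₁ τ - x₂ τ)
          + X ((v₁ - v₂ : Lp V 2 μI) τ) (x τ)) ∂μI =
        ∫ τ in s..q, (X (v₁ τ) (x₁ τ) - X (v₂ τ) (x₂ τ) - (fderiv ℝ (X (v τ)) (x τ) (x₁ τ - x₂ τ)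
          + X ((v₁ - v₂ : Lp V 2 μI) τ) (x τ))) ∂μI := by
      rw [intervalIntegral.integral_sub (hI₁.sub hI₂) hI₃,
        intervalIntegral.integral_sub hI₁ hI₂, q₁, q₂]
      abel
    rw [e]
    refine (norm_intervalIntegral_le_integral hgi ?_ _ _).trans hgle
    filter_upwards [Lp.coeFn_sub v₁ v₂, Lp.coeFn_sub v₂ v, ae_restrict_mem measurableSet_Icc]
      with τ h₁ h₂ hτ
    have e1 : X ((v₁ - v₂ : Lp V 2 μI) τ) = X (v₁ τ) - X (v₂ τ) := by
      rw [h₁, Pi.sub_apply, map_sub]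
    have e2 : X ((v₂ - v : Lp V 2 μI) τ) = X (v₂ τ) - X (v τ) := by
      rw [h₂, Pi.sub_apply, map_sub]
    have e3 : X (v₁ τ) (x₁ τ) - X (v₂ τ) (x₂ τ) - (fderiv ℝ (X (v τ)) (x τ) (x₁ τ - x₂ τ)
          + X ((v₁ - v₂ : Lp V 2 μI) τ) (x τ)) =
        (X ((v₁ - v₂ : Lp V 2 μI) τ) (x₁ τ) - X ((v₁ - v₂ : Lp V 2 μI) τ) (x τ))
        + ((X ((v₂ - v : Lp V 2 μI) τ) (x₁ τ) - X ((v₂ - v : Lp V 2 μI) τ) (x₂ τ))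
        + (X (v τ) (x₁ τ) - X (v τ) (x₂ τ) - fderiv ℝ (X (v τ)) (x τ) (x₁ τ - x₂ τ))) := by
      rw [e1, e2]; simp only [Pi.sub_apply]; abel
    rw [e3, hg]
    refine (norm_add_le _ _).trans (add_le_add ?_ ((norm_add_le _ _).trans (add_le_add ?_ ?_)))
    · refine (hX.norm_sub_le _ _ _).trans ?_
      calc _ = C * ‖x₁ τ - x τ‖ * ‖(v₁ - v₂ : Lp V 2 μI) τ‖ := by ring
        _ ≤ _ := by gcongr; exact hd₁ τ hτ
    · refine (hX.norm_sub_le _ _ _).trans ?_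
      calc _ = C * ‖x₁ τ - x₂ τ‖ * ‖(v₂ - v : Lp V 2 μI) τ‖ := by ring
        _ ≤ _ := by gcongr; exact hd₁₂ τ hτ
    · have hcv := (convex_closedBall (x τ) δ).norm_image_sub_le_of_norm_fderiv_le' (𝕜 := ℝ)
        (f := X (v τ)) (φ := fderiv ℝ (X (v τ)) (x τ))
        (C := modulusOfContinuity (fderiv ℝ (X (v τ))) δ) (x := x₂ τ) (y := x₁ τ)
        (fun z _ => hX.differentiable (v τ) z)
        (fun z hz => hX.norm_fderiv_sub_le_modulus (v τ) (by
          rwa [mem_closedBall_iff_norm] at hz))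
        (by rw [mem_closedBall_iff_norm]; exact hd₂ τ hτ)
        (by rw [mem_closedBall_iff_norm]; exact hd₁ τ hτ)
      refine hcv.trans ?_
      rw [mul_comm]
      exact mul_le_mul_of_nonneg_right (hd₁₂ τ hτ) (modulus_nonneg _ _)

end IsBoundedC1Family

end LinearizedFlow

section Fundamental

lemma IsCaratheodory.integrable {G : Type*} [NormedAddCommGroup G] {F : ℝ → G → G} {a b : ℝ → ℝ}
    (hF : IsCaratheodory F a b) {x : ℝ → G} (hx : Continuous x) :
    Integrable (fun τ => F τ (x τ)) μI := by
  have h := (hF.intervalIntegrable hx (-1) 1).def'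
  have hsub : Icc (0 : ℝ) 1 ⊆ Ioc (-1) 1 := fun τ hτ => ⟨by linarith [hτ.1], hτ.2⟩
  rwa [uIoc_of_le (by norm_num), IntegrableOn, Measure.restrict_restrict measurableSet_Ioc,
    inter_eq_right.2 hsub] at h

variable {V E : Type*} [NormedAddCommGroup V] [NormedSpace ℝ V]
  [NormedAddCommGroup E] [NormedSpace ℝ E]

/-- The derivative of the inverse flow `(φₜᵛ)⁻¹ = φ_{t,0}ᵛ` in the direction `h` of velocities. -/
noncomputable def flowVariation (X : V →ₗ[ℝ] (E → E)) (v : Lp V 2 μI) (t : ℝ) (h : Lp V 2 μI)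
    (y : E) : E :=
  -∫ τ in (0 : ℝ)..t, fderiv ℝ (familyFlow X v τ 0) (familyFlow X v t τ y)
    (X (h τ) (familyFlow X v t τ y)) ∂μI

lemma flowVariation_smul {X : V →ₗ[ℝ] (E → E)} (v : Lp V 2 μI) (t : ℝ) (c : ℝ) (h : Lp V 2 μI) (y : E) :
    flowVariation X v t (c • h) y = c • flowVariation X v t h y := by
  rw [flowVariation, flowVariation, smul_neg, ← intervalIntegral.integral_smul]
  congr 1
  have : ∀ᵐ τ ∂μI, fderiv ℝ (familyFlow X v τ 0) (familyFlow X v t τ y)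
      (X ((c • h : Lp V 2 μI) τ) (familyFlow X v t τ y)) =
      c • fderiv ℝ (familyFlow X v τ 0) (familyFlow X v t τ y)
        (X (h τ) (familyFlow X v t τ y)) := by
    filter_upwards [Lp.coeFn_smul c h] with τ hτ
    rw [hτ, Pi.smul_apply, map_smul, Pi.smul_apply, map_smul]
  exact intervalIntegral.integral_congr_ae' (this.mono fun τ hτ _ => hτ)
    (this.mono fun τ hτ _ => hτ)

variable [FiniteDimensional ℝ E]
  {X : V →ₗ[ℝ] (E → E)} {C : ℝ}

lemma ContinuousLinearMap.mul_eq_one_comm_of_finiteDimensional {A B : E →L[ℝ] E} :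
    A * B = 1 ↔ B * A = 1 := by
  have key : ∀ {A B : E →L[ℝ] E}, A * B = 1 → B * A = 1 := fun {A B} h => by
    have h1 : (A : E →ₗ[ℝ] E) * (B : E →ₗ[ℝ] E) = 1 := by
      ext z; exact DFunLike.congr_fun h z
    have h2 := _root_.mul_eq_one_comm.1 h1
    ext z; exact DFunLike.congr_fun h2 z
  exact ⟨key, key⟩

namespace IsBoundedC1Family

/-- Existence of a fundamental matrix `M`, its inverse `Q`, and variation of constants for the
linearization of the flow along a curve. -/
theorem exists_fundamental (hX : IsBoundedC1Family X C) (v : Lp V 2 μI) {x : ℝ → E}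
    (hx : Continuous x) (s : ℝ) :
    ∃ M Q : ℝ → E →L[ℝ] E, Continuous M ∧ Continuous Q ∧ M s = 1 ∧ (∀ t, Q t * M t = 1) ∧
      ∀ (h : Lp V 2 μI) (k : E),
        Integrable (fun τ => Q τ (X (h τ) (x τ))) μI ∧
        IsSolution (fun τ z => fderiv ℝ (X (v τ)) (x τ) z + X (h τ) (x τ)) s k
        (fun t => M t (k + ∫ τ in s..t, Q τ (X (h τ) (x τ)) ∂μI)) := by
  have : CompleteSpace E := FiniteDimensional.complete ℝ E
  have hBm : AEStronglyMeasurable (fun τ => fderiv ℝ (X (v τ)) (x τ)) μI :=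
    hX.continuous_fderiv.comp_aestronglyMeasurable
      ((Lp.aestronglyMeasurable v).prodMk hx.aestronglyMeasurable)
  have hBn : ∀ τ, ‖fderiv ℝ (X (v τ)) (x τ)‖ ≤ C * ‖v τ‖ := fun τ => hX.norm_fderiv_le _ _
  have hcM : IsCaratheodory (fun τ (M : E →L[ℝ] E) => fderiv ℝ (X (v τ)) (x τ) * M)
      (fun τ => C * ‖v τ‖) (fun _ => 0) :=
    { memLp_lip := (Lp.memLp v).norm.const_mul C
      memLp_bound := MemLp.zero
      lip_nonneg := fun τ => mul_nonneg hX.pos.le (norm_nonneg _)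
      lip := fun τ M N => by
        rw [← mul_sub]
        exact (norm_mul_le _ _).trans (mul_le_mul_of_nonneg_right (hBn τ) (norm_nonneg _))
      bound := fun τ => by simp
      aestronglyMeasurable := fun M hM => hBm.mul hM.aestronglyMeasurable }
  have hcQ : IsCaratheodory (fun τ (Q : E →L[ℝ] E) => -(Q * fderiv ℝ (X (v τ)) (x τ)))
      (fun τ => C * ‖v τ‖) (fun _ => 0) :=
    { memLp_lip := (Lp.memLp v).norm.const_mul C
      memLp_bound := MemLp.zero
      lip_nonneg := fun τ => mul_nonneg hX.pos.le (norm_nonneg _)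
      lip := fun τ M N => by
        rw [← neg_add', ← sub_eq_add_neg, norm_neg, ← sub_mul, mul_comm (C * _)]
        exact (norm_mul_le _ _).trans (mul_le_mul_of_nonneg_left (hBn τ) (norm_nonneg _))
      bound := fun τ => by simp
      aestronglyMeasurable := fun M hM => (hM.aestronglyMeasurable.mul hBm).neg }
  obtain ⟨M, hM⟩ := hcM.exists_isSolution s 1
  obtain ⟨Q, hQ⟩ := hcQ.exists_isSolution s 1
  have hQM : ∀ t, Q t * M t = 1 := fun t => by
    have := bilin_eq_add_integral (ContinuousLinearMap.mul ℝ (E →L[ℝ] E))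
      (hcQ.integrable hQ.continuous) (hcM.integrable hM.continuous)
      (fun s t => (hQ.restart hcQ s).eq t) (fun s t => (hM.restart hcM s).eq t) s t
    simpa [hM.apply_initial, hQ.apply_initial, mul_assoc] using this
  have hMQ : ∀ t, M t * Q t = 1 := fun t =>
    ContinuousLinearMap.mul_eq_one_comm_of_finiteDimensional.1 (hQM t)
  refine ⟨M, Q, hM.continuous, hQ.continuous, hM.apply_initial, hQM, fun h k => ?_⟩
  have hhi : Integrable (fun τ => X (h τ) (x τ)) μI := (hX.isCaratheodory h).integrable hx
  have hQi : Integrable (fun τ => Q τ (X (h τ) (x τ))) μI := by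
    obtain ⟨c, hc⟩ := (isCompact_Icc (a := (0 : ℝ)) (b := 1)).exists_bound_of_continuousOn
      hQ.continuous.continuousOn
    refine Integrable.mono' (hhi.norm.const_mul c) ((ContinuousLinearMap.id ℝ
      (E →L[ℝ] E)).aestronglyMeasurable_comp₂ hQ.continuous.aestronglyMeasurable hhi.1) ?_
    filter_upwards [ae_restrict_mem measurableSet_Icc] with τ hτ
    exact (ContinuousLinearMap.le_opNorm _ _).trans
      (mul_le_mul_of_nonneg_right (hc τ hτ) (norm_nonneg _))
  have hN : Continuous fun t => k + ∫ τ in s..t, Q τ (X (h τ) (x τ)) ∂μI :=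
    continuous_const.add (intervalIntegral.continuous_primitive
      (fun _ _ => hQi.intervalIntegrable) s)
  refine ⟨hQi, hM.continuous.clm_apply hN, fun t => ?_⟩
  have := bilin_eq_add_integral (ContinuousLinearMap.id ℝ (E →L[ℝ] E))
      (N := fun t => k + ∫ τ in s..t, Q τ (X (h τ) (x τ)) ∂μI)
      (hcM.integrable hM.continuous) hQi (fun s t => (hM.restart hcM s).eq t)
      (fun r t => by
        rw [add_assoc, intervalIntegral.integral_add_adjacent_intervals hQi.intervalIntegrable
          hQi.intervalIntegrable]) s t
  simp only [ContinuousLinearMap.id_apply, hM.apply_initial, intervalIntegral.integral_same,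
    add_zero, one_apply_eq_self, mul_apply_eq_comp] at this
  rw [this]
  congr 1
  refine intervalIntegral.integral_congr fun τ _ => ?_
  have h1 : M τ (Q τ (X (h τ) (x τ))) = X (h τ) (x τ) := DFunLike.congr_fun (hMQ τ) _
  simp only [h1]

/-- The spatial derivative of the flow along a trajectory is a fundamental matrix. -/
theorem exists_fundamental_familyFlow (hX : IsBoundedC1Family X C) (v : Lp V 2 μI) {s : ℝ}
    (hs : s ∈ Icc (0 : ℝ) 1) (y : E) :
    ∃ M Q : ℝ → E →L[ℝ] E, Continuous M ∧ Continuous Q ∧ M s = 1 ∧ (∀ t, Q t * M t = 1) ∧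
      (∀ t ∈ Icc (0 : ℝ) 1, HasFDerivAt (familyFlow X v s t) (M t) y) ∧
      ∀ (h : Lp V 2 μI) (k : E),
        Integrable (fun τ => Q τ (X (h τ) (familyFlow X v s τ y))) μI ∧
        IsSolution (fun τ z => fderiv ℝ (X (v τ)) (familyFlow X v s τ y) z
          + X (h τ) (familyFlow X v s τ y)) s k
        (fun t => M t (k + ∫ τ in s..t, Q τ (X (h τ) (familyFlow X v s τ y)) ∂μI)) := by
  have : CompleteSpace E := FiniteDimensional.complete ℝ E
  obtain ⟨M, Q, hMc, hQc, hM1, hQM, hsol⟩ :=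
    hX.exists_fundamental v (hX.continuous_familyFlow_time v s y) s
  refine ⟨M, Q, hMc, hQc, hM1, hQM, fun t ht => ?_, hsol⟩
  rw [hasFDerivAt_iff_isLittleO_nhds_zero, Asymptotics.isLittleO_iff]
  intro ε hε
  obtain ⟨r, hr, H⟩ := hX.exists_norm_familyFlow_sub_sub_le v hε
  filter_upwards [Metric.closedBall_mem_nhds (0 : E) hr] with k hk
  rw [mem_closedBall_zero_iff] at hk
  have h1 := H v v y (y + k) y (by simpa using hr.le) (by simpa using hr.le) (by simpa using hk)
    (by simpa using hr.le) s hs t ht _ (hsol (v - v) (y + k - y)).2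
  have h2 : ∫ τ in s..t, Q τ (X ((v - v : Lp V 2 μI) τ) (familyFlow X v s τ y)) ∂μI = 0 := by
    refine (intervalIntegral.integral_congr_ae' (g := fun _ => 0) ?_ ?_).trans (by simp) <;>
    · rw [sub_self]
      filter_upwards [Lp.coeFn_zero V 2 μI] with τ hτ _
      rw [hτ, Pi.zero_apply, map_zero, Pi.zero_apply, map_zero]
  simpa [h2] using h1

lemma hasFDerivAt_familyFlow (hX : IsBoundedC1Family X C) (v : Lp V 2 μI) {s t : ℝ}
    (hs : s ∈ Icc (0 : ℝ) 1) (ht : t ∈ Icc (0 : ℝ) 1) (y : E) :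
    HasFDerivAt (familyFlow X v s t) (fderiv ℝ (familyFlow X v s t) y) y := by
  obtain ⟨M, Q, -, -, -, -, h, -⟩ := hX.exists_fundamental_familyFlow v hs y
  exact (h t ht).differentiableAt.hasFDerivAt

theorem det_fderiv_familyFlow_pos (hX : IsBoundedC1Family X C) (v : Lp V 2 μI) {s t : ℝ}
    (hs : s ∈ Icc (0 : ℝ) 1) (ht : t ∈ Icc (0 : ℝ) 1) (y : E) :
    0 < (fderiv ℝ (familyFlow X v s t) y).det := by
  obtain ⟨M, Q, hMc, -, hM1, hQM, hd, -⟩ := hX.exists_fundamental_familyFlow v hs y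
  rw [(hd t ht).fderiv]
  have hdet : Continuous fun t => (M t).det := ContinuousLinearMap.continuous_det.comp hMc
  have hne : ∀ t, (M t).det ≠ 0 := fun t h0 => by
    have h1 : (Q t * M t).det = (Q t).det * (M t).det := by
      simp only [ContinuousLinearMap.det]
      exact LinearMap.det_comp _ _
    rw [hQM, h0, mul_zero] at h1
    have : (1 : E →L[ℝ] E).det = 1 := by
      simp only [ContinuousLinearMap.det]; exact LinearMap.det_id
    rw [this] at h1
    exact one_ne_zero h1
  have h1 : (M s).det = 1 := by
    rw [hM1]; simp only [ContinuousLinearMap.det]; exact LinearMap.det_id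
  by_contra hneg
  obtain ⟨r, -, hr⟩ := intermediate_value_uIcc (a := s) (b := t) hdet.continuousOn
    (show (0 : ℝ) ∈ uIcc _ _ by rw [mem_uIcc]; right; exact ⟨not_lt.1 hneg, by rw [h1]; norm_num⟩)
  exact hne r hr

variable [CompleteSpace E]

lemma norm_fderiv_familyFlow_le (hX : IsBoundedC1Family X C) {v : Lp V 2 μI} {R : ℝ}
    (hv : ‖v‖ ≤ R) {s t : ℝ} (hs : s ∈ Icc (0 : ℝ) 1) (ht : t ∈ Icc (0 : ℝ) 1) (y : E) :
    ‖fderiv ℝ (familyFlow X v s t) y‖ ≤ flowConst C R := by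
  refine (hX.hasFDerivAt_familyFlow v hs ht y).le_of_lip' (flowConst_pos _ _).le
    (Eventually.of_forall fun z => ?_)
  simpa using hX.norm_familyFlow_sub_le_flowConst (v := v) hv hs ht z y

theorem contDiff_familyFlow (hX : IsBoundedC1Family X C) (v : Lp V 2 μI) {s t : ℝ}
    (hs : s ∈ Icc (0 : ℝ) 1) (ht : t ∈ Icc (0 : ℝ) 1) :
    ContDiff ℝ 1 (familyFlow X v s t) := by
  rw [contDiff_one_iff_fderiv]
  refine ⟨fun y => (hX.hasFDerivAt_familyFlow v hs ht y).differentiableAt, ?_⟩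
  rw [Metric.continuous_iff]
  intro y ε hε
  obtain ⟨r, hr, H⟩ := hX.exists_norm_familyFlow_sub_sub_le v (half_pos hε)
  refine ⟨r, hr, fun y₁ hy₁ => lt_of_le_of_lt ?_ (half_lt_self hε)⟩
  obtain ⟨M, Q, -, -, -, -, hd, hsol⟩ := hX.exists_fundamental_familyFlow v hs y
  rw [dist_eq_norm, (hd t ht).fderiv]
  refine ((hX.hasFDerivAt_familyFlow v hs ht y₁).sub (M t).hasFDerivAt).le_of_lip' (by positivity) ?_
  filter_upwards [Metric.isOpen_ball.mem_nhds (show y₁ ∈ Metric.ball y r from hy₁)] with z hz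
  rw [mem_ball_iff_norm] at hz
  rw [dist_eq_norm] at hy₁
  have h1 := H v v y z y₁ (by simpa using hr.le) (by simpa using hr.le) hz.le hy₁.le s hs t ht _
    (hsol (v - v) (z - y₁)).2
  have h2 : ∫ τ in s..t, Q τ (X ((v - v : Lp V 2 μI) τ) (familyFlow X v s τ y)) ∂μI = 0 := by
    refine (intervalIntegral.integral_congr_ae' (g := fun _ => 0) ?_ ?_).trans (by simp) <;>
    · rw [sub_self]
      filter_upwards [Lp.coeFn_zero V 2 μI] with τ hτ _
      rw [hτ, Pi.zero_apply, map_zero, Pi.zero_apply, map_zero]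
  rw [h2, add_zero, map_sub, sub_self, norm_zero, zero_add] at h1
  refine le_trans (le_of_eq ?_) h1
  simp only [Pi.sub_apply]
  congr 1; abel

lemma exists_flowVariation_eq (hX : IsBoundedC1Family X C) (v : Lp V 2 μI) {t : ℝ}
    (ht : t ∈ Icc (0 : ℝ) 1) (y : E) (h : Lp V 2 μI) :
    Integrable (fun τ => fderiv ℝ (familyFlow X v τ 0) (familyFlow X v t τ y)
      (X (h τ) (familyFlow X v t τ y))) μI ∧
    ∃ η, IsSolution (fun τ z => fderiv ℝ (X (v τ)) (familyFlow X v t τ y) z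
      + X (h τ) (familyFlow X v t τ y)) t 0 η ∧ flowVariation X v t h y = η 0 := by
  obtain ⟨M, Q, hMc, hQc, hM1, hQM, hd, hsol⟩ := hX.exists_fundamental_familyFlow v ht y
  have hMQ : ∀ t, M t * Q t = 1 := fun t =>
    ContinuousLinearMap.mul_eq_one_comm_of_finiteDimensional.1 (hQM t)
  have h0 : (0 : ℝ) ∈ Icc (0 : ℝ) 1 := by simp
  have e1 : ∀ τ ∈ Icc (0 : ℝ) 1, fderiv ℝ (familyFlow X v τ 0) (familyFlow X v t τ y)
      (X (h τ) (familyFlow X v t τ y)) = M 0 (Q τ (X (h τ) (familyFlow X v t τ y))) := by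
    intro τ hτ
    have c1 := (hX.hasFDerivAt_familyFlow v hτ h0 (familyFlow X v t τ y)).comp y (hd τ hτ)
    have c2 : familyFlow X v τ 0 ∘ familyFlow X v t τ = familyFlow X v t 0 := by
      funext z; exact hX.familyFlow_familyFlow v t τ 0 z
    rw [c2] at c1
    rw [(hd 0 h0).unique c1]
    have := DFunLike.congr_fun (hMQ τ) (X (h τ) (familyFlow X v t τ y))
    simp only [mul_apply_eq_comp, one_apply_eq_self] at this
    rw [ContinuousLinearMap.comp_apply, this]
  have e2 : ∀ᵐ τ ∂μI, fderiv ℝ (familyFlow X v τ 0) (familyFlow X v t τ y)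
      (X (h τ) (familyFlow X v t τ y)) = M 0 (Q τ (X (h τ) (familyFlow X v t τ y))) := by
    filter_upwards [ae_restrict_mem measurableSet_Icc] with τ hτ using e1 τ hτ
  refine ⟨(((M 0).integrable_comp (hsol h 0).1).congr (e2.mono fun τ hτ => hτ.symm)),
    _, (hsol h 0).2, ?_⟩
  have e3 : ∫ τ in (0 : ℝ)..t, fderiv ℝ (familyFlow X v τ 0) (familyFlow X v t τ y)
      (X (h τ) (familyFlow X v t τ y)) ∂μI =
      ∫ τ in (0 : ℝ)..t, M 0 (Q τ (X (h τ) (familyFlow X v t τ y))) ∂μI :=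
    intervalIntegral.integral_congr_ae' (e2.mono fun τ hτ _ => hτ) (e2.mono fun τ hτ _ => hτ)
  rw [flowVariation, e3, ContinuousLinearMap.intervalIntegral_comp_comm _
    (hsol h 0).1.intervalIntegrable, zero_add, intervalIntegral.integral_symm t 0, map_neg,
    neg_neg]

theorem exists_norm_sub_flowVariation_le (hX : IsBoundedC1Family X C) (v : Lp V 2 μI) {ε : ℝ}
    (hε : 0 < ε) : ∃ r > 0, ∀ v₁ v₂ : Lp V 2 μI, ‖v₁ - v‖ ≤ r → ‖v₂ - v‖ ≤ r →
      ∀ t ∈ Icc (0 : ℝ) 1, ∀ y, ‖familyFlow X v₁ t 0 y - familyFlow X v₂ t 0 y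
        - flowVariation X v t (v₁ - v₂) y‖ ≤ ε * ‖v₁ - v₂‖ := by
  obtain ⟨r, hr, H⟩ := hX.exists_norm_familyFlow_sub_sub_le v hε
  refine ⟨r, hr, fun v₁ v₂ h₁ h₂ t ht y => ?_⟩
  obtain ⟨-, η, hη, e⟩ := hX.exists_flowVariation_eq v ht y (v₁ - v₂)
  have := H v₁ v₂ y y y h₁ h₂ (by simpa using hr.le) (by simpa using hr.le) t ht 0 (by simp) η
    (by simpa using hη)
  rw [e]; simpa using this

lemma flowVariation_add (hX : IsBoundedC1Family X C) (v : Lp V 2 μI) {t : ℝ}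
    (ht : t ∈ Icc (0 : ℝ) 1) (g h : Lp V 2 μI) (y : E) :
    flowVariation X v t (g + h) y = flowVariation X v t g y + flowVariation X v t h y := by
  rw [flowVariation, flowVariation, flowVariation, ← neg_add, ← intervalIntegral.integral_add
    (hX.exists_flowVariation_eq v ht y g).1.intervalIntegrable
    (hX.exists_flowVariation_eq v ht y h).1.intervalIntegrable]
  congr 1
  have : ∀ᵐ τ ∂μI, fderiv ℝ (familyFlow X v τ 0) (familyFlow X v t τ y)
      (X ((g + h : Lp V 2 μI) τ) (familyFlow X v t τ y)) =
      fderiv ℝ (familyFlow X v τ 0) (familyFlow X v t τ y) (X (g τ) (familyFlow X v t τ y))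
      + fderiv ℝ (familyFlow X v τ 0) (familyFlow X v t τ y) (X (h τ) (familyFlow X v t τ y)) := by
    filter_upwards [Lp.coeFn_add g h] with τ hτ
    rw [hτ, Pi.add_apply, map_add, Pi.add_apply, map_add]
  exact intervalIntegral.integral_congr_ae' (this.mono fun τ hτ _ => hτ)
    (this.mono fun τ hτ _ => hτ)

theorem hasDerivAt_familyFlow_velocity (hX : IsBoundedC1Family X C) (v h : Lp V 2 μI) {t : ℝ}
    (ht : t ∈ Icc (0 : ℝ) 1) (y : E) (e : ℝ) :
    HasDerivAt (fun e : ℝ => familyFlow X (v + e • h) t 0 y)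
      (flowVariation X (v + e • h) t h y) e := by
  rw [hasDerivAt_iff_isLittleO, Asymptotics.isLittleO_iff]
  intro ε hε
  obtain ⟨r, hr, H⟩ := hX.exists_norm_sub_flowVariation_le (v + e • h)
    (div_pos hε (by positivity : 0 < ‖h‖ + 1))
  have hev : ∀ᶠ e' in 𝓝 e, ‖(v + e' • h) - (v + e • h)‖ ≤ r := by
    have hc : Continuous fun e' : ℝ => ‖(v + e' • h) - (v + e • h)‖ := by fun_prop
    have := hc.tendsto e
    simp only [sub_self, norm_zero] at this
    exact this.eventually (ge_mem_nhds hr)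
  filter_upwards [hev] with e' he'
  have h1 := H _ (v + e • h) he' (by simpa using hr.le) t ht y
  have h2 : v + e' • h - (v + e • h) = (e' - e) • h := by rw [sub_smul]; abel
  rw [h2, flowVariation_smul, norm_smul] at h1
  refine h1.trans ?_
  have : ε / (‖h‖ + 1) * ‖h‖ ≤ ε := by
    rw [div_mul_eq_mul_div, div_le_iff₀ (by positivity)]
    nlinarith [norm_nonneg h]
  calc _ = (ε / (‖h‖ + 1) * ‖h‖) * ‖e' - e‖ := by ring
    _ ≤ _ := by gcongr

lemma norm_flowVariation_le (hX : IsBoundedC1Family X C) {v : Lp V 2 μI} {R : ℝ} (hv : ‖v‖ ≤ R)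
    {t : ℝ} (ht : t ∈ Icc (0 : ℝ) 1) (h : Lp V 2 μI) (y : E) :
    ‖flowVariation X v t h y‖ ≤ flowConst C R * C * ‖h‖ := by
  obtain ⟨-, η, hη, e⟩ := hX.exists_flowVariation_eq v ht y h
  rw [e, mul_assoc]
  simpa using hX.norm_linearized_le hv (hX.continuous_familyFlow_time v t y) hη ht
    (show (0 : ℝ) ∈ Icc (0 : ℝ) 1 by simp)

theorem exists_norm_flowVariation_sub_le (hX : IsBoundedC1Family X C) (v : Lp V 2 μI) {ε : ℝ}
    (hε : 0 < ε) : ∃ r > 0, ∀ v₁ : Lp V 2 μI, ‖v₁ - v‖ < r → ∀ t ∈ Icc (0 : ℝ) 1,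
      ∀ h y, ‖flowVariation X v₁ t h y - flowVariation X v t h y‖ ≤ ε * ‖h‖ := by
  obtain ⟨r, hr, H⟩ := hX.exists_norm_sub_flowVariation_le v hε
  refine ⟨r, hr, fun v₁ h₁ t ht h y => ?_⟩
  have hd := (hX.hasDerivAt_familyFlow_velocity v₁ h ht y 0).sub
    ((hasDerivAt_id (0 : ℝ)).smul_const (flowVariation X v t h y))
  simp only [zero_smul, add_zero, one_smul] at hd
  refine hd.le_of_lip' (by positivity) ?_
  have hev : ∀ᶠ e' : ℝ in 𝓝 0, ‖(v₁ + e' • h) - v‖ < r := by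
    have hc : Continuous fun e' : ℝ => ‖(v₁ + e' • h) - v‖ := by fun_prop
    have := hc.tendsto 0
    simp only [zero_smul, add_zero] at this
    exact this.eventually (gt_mem_nhds h₁)
  filter_upwards [hev] with e he
  have h2 := H _ _ he.le h₁.le t ht y
  rw [add_sub_cancel_left, flowVariation_smul, norm_smul] at h2
  simp only [Pi.sub_apply, zero_smul, add_zero, sub_zero, id]
  refine le_trans (le_of_eq ?_) (h2.trans (le_of_eq (by ring)))
  congr 1; abel

end IsBoundedC1Family

end Fundamental

section SquareIntegrals

lemma eLpNorm_two_sq {α F : Type*} [MeasurableSpace α] [NormedAddCommGroup F] (f : α → F)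
    (ν : Measure α) : eLpNorm f 2 ν ^ 2 = ∫⁻ x, ‖f x‖ₑ ^ 2 ∂ν := by
  have := eLpNorm_nnreal_pow_eq_lintegral (f := f) (μ := ν) (p := 2) two_ne_zero
  simpa using this

lemma eLpNorm_comp_le_of_lintegral_le {α F : Type*} [MeasurableSpace α] [NormedAddCommGroup F]
    {ν : Measure α} {ψ : α → α} {B : ENNReal}
    (hB : ∀ g : α → ENNReal, ∫⁻ x, g (ψ x) ∂ν ≤ B ^ 2 * ∫⁻ x, g x ∂ν) (f : α → F) :
    eLpNorm (f ∘ ψ) 2 ν ≤ B * eLpNorm f 2 ν := by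
  rw [← ENNReal.pow_le_pow_left_iff two_ne_zero, mul_pow, eLpNorm_two_sq, eLpNorm_two_sq]
  exact hB fun x => ‖f x‖ₑ ^ 2

/-- If the sections of `g` are bounded by `c` in `L²`, so is the average over `[0,1]`. -/
lemma lintegral_sq_lintegral_le {α F : Type*} [MeasurableSpace α] [NormedAddCommGroup F]
    {ν : Measure α} [SFinite ν] {g : ℝ → α → F} {κ : Measure ℝ} [IsProbabilityMeasure κ]
    (hg : AEStronglyMeasurable (Function.uncurry g) (κ.prod ν)) {c : ENNReal}
    (hc : ∀ᵐ e ∂κ, eLpNorm (g e) 2 ν ≤ c) :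
    ∫⁻ y, (∫⁻ e, ‖g e y‖ₑ ∂κ) ^ 2 ∂ν ≤ c ^ 2 := by
  have hsec : ∀ᵐ y ∂ν, AEStronglyMeasurable (fun e => g e y) κ :=
    (hg.prod_swap).prodMk_left
  calc ∫⁻ y, (∫⁻ e, ‖g e y‖ₑ ∂κ) ^ 2 ∂ν ≤ ∫⁻ y, ∫⁻ e, ‖g e y‖ₑ ^ 2 ∂κ ∂ν := by
        refine lintegral_mono_ae (hsec.mono fun y hy => ?_)
        rw [← eLpNorm_two_sq (fun e => g e y) κ, ← eLpNorm_one_eq_lintegral_enorm]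
        gcongr
        exact eLpNorm_le_eLpNorm_of_exponent_le (by norm_num) hy
    _ = ∫⁻ e, ∫⁻ y, ‖g e y‖ₑ ^ 2 ∂ν ∂κ := by
        rw [lintegral_lintegral_swap]
        exact (hg.prod_swap.enorm.pow_const 2)
    _ ≤ ∫⁻ _, c ^ 2 ∂κ := lintegral_mono_ae (hc.mono fun e he => by
        rw [← eLpNorm_two_sq]; gcongr)
    _ = c ^ 2 := by simp

/-- Continuity in `L²` of composition with maps that do not concentrate mass. -/
lemma tendsto_eLpNorm_comp_sub {E F ι : Type*} [NormedAddCommGroup E] [NormedSpace ℝ E]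
    [FiniteDimensional ℝ E] [MeasurableSpace E] [BorelSpace E] [NormedAddCommGroup F]
    [NormedSpace ℝ F] {ν : Measure E} [ν.Regular] {Ω : Set E} (hΩ : MeasurableSet Ω)
    {l : Filter ι} {ψ : ι → E → E} {ψ₀ : E → E}
    (hψ : ∀ i, Continuous (ψ i)) (hψ₀ : Continuous ψ₀) {B : ENNReal} (hBt : B ≠ ⊤)
    (hB : ∀ᶠ i in l, ∀ g : E → ENNReal,
      ∫⁻ x in Ω, g (ψ i x) ∂ν ≤ B ^ 2 * ∫⁻ x in Ω, g x ∂ν)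
    (hB₀ : ∀ g : E → ENNReal, ∫⁻ x in Ω, g (ψ₀ x) ∂ν ≤ B ^ 2 * ∫⁻ x in Ω, g x ∂ν)
    (hlim : TendstoUniformly ψ ψ₀ l) {G : E → F} (hGm : StronglyMeasurable G)
    (hG : MemLp G 2 (ν.restrict Ω)) :
    Tendsto (fun i => eLpNorm (G ∘ ψ i - G ∘ ψ₀) 2 (ν.restrict Ω)) l (𝓝 0) := by
  rw [ENNReal.tendsto_nhds_zero]
  intro ε hε
  obtain ⟨ε', hε'0, hε'⟩ : ∃ ε' : ENNReal, ε' ≠ 0 ∧ B * ε' + B * ε' ≤ ε / 2 := by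
    rcases eq_or_ne ε ⊤ with rfl | hεt
    · exact ⟨1, one_ne_zero, by simp [ENNReal.top_div]⟩
    · rcases eq_or_ne B 0 with rfl | hB0
      · exact ⟨1, one_ne_zero, by simp⟩
      · refine ⟨ε / 2 / (2 * B), ?_, ?_⟩
        · exact (ENNReal.div_pos (ENNReal.half_pos hε.ne').ne'
            (ENNReal.mul_ne_top (by norm_num) hBt)).ne'
        · rw [← two_mul, ← mul_assoc]
          exact ENNReal.mul_div_le
  obtain ⟨g, hgs, hgε, hgc, -⟩ := (memLp_indicator_iff_restrict hΩ |>.2 hG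
    ).exists_hasCompactSupport_eLpNorm_sub_le (by norm_num) hε'0
  have hGg : eLpNorm (G - g) 2 (ν.restrict Ω) ≤ ε' := by
    refine (eLpNorm_congr_ae ?_).trans_le ((eLpNorm_restrict_le (Ω.indicator G - g) 2 ν Ω).trans hgε)
    filter_upwards [ae_restrict_mem hΩ] with x hx
    simp [indicator_of_mem hx]
  set S := tsupport g with hS
  have hSc : IsCompact S := hgs
  have hSν : (ν.restrict Ω) S ≠ ⊤ :=
    ((Measure.restrict_apply_le Ω S).trans_lt hSc.measure_lt_top).ne
  set m : ENNReal := (2 * (B ^ 2 * (ν.restrict Ω) S)) ^ (1 / (2 : ℝ)) with hm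
  have hmt : m ≠ ⊤ := ENNReal.rpow_ne_top_of_nonneg (by norm_num)
    (ENNReal.mul_ne_top (by norm_num) (ENNReal.mul_ne_top (ENNReal.pow_ne_top hBt) hSν))
  obtain ⟨d, hd0, hd⟩ : ∃ d : NNReal, 0 < d ∧ d * m ≤ ε / 2 := by
    rcases eq_or_ne ε ⊤ with rfl | hεt
    · exact ⟨1, one_pos, by simp [ENNReal.top_div]⟩
    rcases eq_or_ne m 0 with h0 | h0
    · exact ⟨1, one_pos, by simp [h0]⟩
    have h1 : ε / 2 / m ≠ 0 := (ENNReal.div_pos (ENNReal.half_pos hε.ne').ne' hmt).ne'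
    have h2 : ε / 2 / m ≠ ⊤ := (ENNReal.div_lt_top (ENNReal.div_lt_top hεt (by norm_num)).ne h0).ne
    refine ⟨(ε / 2 / m).toNNReal, ENNReal.toNNReal_pos h1 h2, ?_⟩
    rw [ENNReal.coe_toNNReal h2, ENNReal.div_mul_cancel h0 hmt]
  have hgu := hgs.uniformContinuous_of_continuous hgc
  obtain ⟨δ, hδ0, hδ⟩ := Metric.uniformContinuous_iff.1 hgu d (by exact_mod_cast hd0)
  filter_upwards [hB, Metric.tendstoUniformly_iff.1 hlim δ hδ0] with i hBi hi
  have e : G ∘ ψ i - G ∘ ψ₀ =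
      ((G - g) ∘ ψ i + (-((G - g) ∘ ψ₀))) + (g ∘ ψ i - g ∘ ψ₀) := by
    ext x; simp only [Function.comp_apply, Pi.add_apply, Pi.sub_apply, Pi.neg_apply]; abel
  have hm1 : AEStronglyMeasurable ((G - g) ∘ ψ i) (ν.restrict Ω) :=
    ((hGm.sub hgc.stronglyMeasurable).comp_measurable (hψ i).measurable).aestronglyMeasurable
  have hm0 : AEStronglyMeasurable (-((G - g) ∘ ψ₀)) (ν.restrict Ω) :=
    ((hGm.sub hgc.stronglyMeasurable).comp_measurable hψ₀.measurable).neg.aestronglyMeasurable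
  have hm2 : AEStronglyMeasurable (g ∘ ψ i - g ∘ ψ₀) (ν.restrict Ω) :=
    ((hgc.comp (hψ i)).sub (hgc.comp hψ₀)).aestronglyMeasurable
  rw [e]
  refine (eLpNorm_add_le (hm1.add hm0) hm2 (by norm_num)).trans ?_
  rw [← ENNReal.add_halves ε]
  refine add_le_add ((eLpNorm_add_le hm1 hm0 (by norm_num)).trans (le_trans ?_ hε')) (le_trans ?_ hd)
  · rw [eLpNorm_neg]
    exact add_le_add
      ((eLpNorm_comp_le_of_lintegral_le hBi _).trans (by gcongr))
      ((eLpNorm_comp_le_of_lintegral_le hB₀ _).trans (by gcongr))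
  · set A := ψ i ⁻¹' S ∪ ψ₀ ⁻¹' S with hA
    have hSm : MeasurableSet S := (isClosed_tsupport g).measurableSet
    have hAm : MeasurableSet A := ((hψ i).measurable hSm).union (hψ₀.measurable hSm)
    have hpre : ∀ φ : E → E, Continuous φ → (∀ g : E → ENNReal,
        ∫⁻ x in Ω, g (φ x) ∂ν ≤ B ^ 2 * ∫⁻ x in Ω, g x ∂ν) →
        (ν.restrict Ω) (φ ⁻¹' S) ≤ B ^ 2 * (ν.restrict Ω) S := fun φ hφ h => by
      have := h (S.indicator 1)
      rw [lintegral_indicator_one hSm] at this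
      rwa [← lintegral_indicator_one (hφ.measurable hSm)]
    have hAν : (ν.restrict Ω) A ≤ 2 * (B ^ 2 * (ν.restrict Ω) S) := by
      rw [two_mul]
      exact (measure_union_le _ _).trans
        (add_le_add (hpre _ (hψ i) hBi) (hpre _ hψ₀ hB₀))
    calc eLpNorm (g ∘ ψ i - g ∘ ψ₀) 2 (ν.restrict Ω)
        ≤ eLpNorm (A.indicator fun _ => (d : ℝ)) 2 (ν.restrict Ω) := by
          refine eLpNorm_mono fun x => ?_
          by_cases hx : x ∈ A
          · rw [indicator_of_mem hx, NNReal.norm_eq]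
            have := (hδ (hi x)).le
            rwa [dist_comm, dist_eq_norm] at this
          · have h1 : ψ i x ∉ S := fun h => hx (Or.inl h)
            have h2 : ψ₀ x ∉ S := fun h => hx (Or.inr h)
            simp [image_eq_zero_of_notMem_tsupport h1, image_eq_zero_of_notMem_tsupport h2, hx]
      _ = d * (ν.restrict Ω) A ^ (1 / (2 : ℝ)) := by
          rw [eLpNorm_indicator_const hAm (by norm_num) (by norm_num)]
          simp
      _ ≤ d * m := by rw [hm]; gcongr

end SquareIntegrals

section FlowOnDomain

variable {V E : Type*} [NormedAddCommGroup V] [NormedSpace ℝ V]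
  [NormedAddCommGroup E] [NormedSpace ℝ E] [CompleteSpace E]
  {X : V →ₗ[ℝ] (E → E)} {C : ℝ} {Ω : Set E}

namespace IsBoundedC1Family

lemma familyFlow_mem (hX : IsBoundedC1Family X C) (h0 : ∀ u, ∀ x ∉ Ω, X u x = 0)
    (v : Lp V 2 μI) (s t : ℝ) {y : E} (hy : y ∈ Ω) : familyFlow X v s t y ∈ Ω := by
  by_contra hn
  have hsol : IsSolution (fun τ => X (v τ)) t (familyFlow X v s t y)
      (fun _ => familyFlow X v s t y) :=
    ⟨continuous_const, fun r => by simp [h0 _ _ hn]⟩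
  have h1 := hX.familyFlow_eq hsol s
  rw [hX.familyFlow_familyFlow, hX.familyFlow_self] at h1
  exact hn (h1 ▸ hy)

lemma familyFlow_leftInverse (hX : IsBoundedC1Family X C) (v : Lp V 2 μI) (s t : ℝ) (y : E) :
    familyFlow X v t s (familyFlow X v s t y) = y := by
  rw [hX.familyFlow_familyFlow, hX.familyFlow_self]

lemma bijOn_familyFlow (hX : IsBoundedC1Family X C) (h0 : ∀ u, ∀ x ∉ Ω, X u x = 0)
    (v : Lp V 2 μI) (s t : ℝ) : BijOn (familyFlow X v s t) Ω Ω :=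
  ⟨fun _ hy => hX.familyFlow_mem h0 v s t hy,
    (Function.LeftInverse.injective (hX.familyFlow_leftInverse v s t)).injOn,
    fun y hy => ⟨familyFlow X v t s y, hX.familyFlow_mem h0 v t s hy,
      hX.familyFlow_leftInverse v t s y⟩⟩

variable [FiniteDimensional ℝ E] [MeasurableSpace E] [BorelSpace E] {m : Measure E}
  [m.IsAddHaarMeasure]

lemma setIntegral_eq_setIntegral_familyFlow (hX : IsBoundedC1Family X C)
    (h0 : ∀ u, ∀ x ∉ Ω, X u x = 0) (hΩ : MeasurableSet Ω) (v : Lp V 2 μI) {s t : ℝ}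
    (hs : s ∈ Icc (0 : ℝ) 1) (ht : t ∈ Icc (0 : ℝ) 1) {F : Type*} [NormedAddCommGroup F]
    [NormedSpace ℝ F] (g : E → F) :
    ∫ y in Ω, g y ∂m =
      ∫ z in Ω, (fderiv ℝ (familyFlow X v s t) z).det • g (familyFlow X v s t z) ∂m := by
  have hb := hX.bijOn_familyFlow h0 v s t
  have h1 := integral_image_eq_integral_abs_det_fderiv_smul m hΩ
    (fun x _ => (hX.hasFDerivAt_familyFlow v hs ht x).hasFDerivWithinAt) hb.injOn g
  rw [hb.image_eq] at h1
  rw [h1]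
  refine integral_congr_ae (ae_of_all _ fun z => ?_)
  simp only
  rw [abs_of_pos (hX.det_fderiv_familyFlow_pos v hs ht z)]

/-- Flows of velocity fields of bounded norm do not concentrate mass. -/
lemma exists_lintegral_familyFlow_le (hX : IsBoundedC1Family X C)
    (h0 : ∀ u, ∀ x ∉ Ω, X u x = 0) (hΩ : MeasurableSet Ω) (R : ℝ) :
    ∃ B : ENNReal, B ≠ ⊤ ∧ ∀ v : Lp V 2 μI, ‖v‖ ≤ R → ∀ s ∈ Icc (0 : ℝ) 1, ∀ t ∈ Icc (0 : ℝ) 1,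
      ∀ g : E → ENNReal,
        ∫⁻ y in Ω, g (familyFlow X v s t y) ∂m ≤ B ^ 2 * ∫⁻ y in Ω, g y ∂m := by
  obtain ⟨c, hc⟩ := (isCompact_closedBall (0 : E →L[ℝ] E) (flowConst C R)).exists_bound_of_continuousOn
    (f := fun A : E →L[ℝ] E => A.det) ContinuousLinearMap.continuous_det.continuousOn
  refine ⟨ENNReal.ofReal √|c|, ENNReal.ofReal_ne_top, fun v hv s hs t ht g => ?_⟩
  have hb := hX.bijOn_familyFlow h0 v t s
  have h1 := lintegral_image_eq_lintegral_abs_det_fderiv_mul m hΩ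
    (fun x _ => (hX.hasFDerivAt_familyFlow v ht hs x).hasFDerivWithinAt) hb.injOn
    (fun y => g (familyFlow X v s t y))
  rw [hb.image_eq] at h1
  rw [h1, ← ENNReal.ofReal_pow (Real.sqrt_nonneg _), Real.sq_sqrt (abs_nonneg _),
    ← lintegral_const_mul' _ _ ENNReal.ofReal_ne_top]
  refine lintegral_mono fun z => ?_
  simp only [hX.familyFlow_leftInverse v t s]
  refine mul_le_mul_left (ENNReal.ofReal_le_ofReal ?_) _
  refine (hc _ ?_).trans (le_abs_self c)
  rw [mem_closedBall_zero_iff]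
  exact hX.norm_fderiv_familyFlow_le hv ht hs z

end IsBoundedC1Family

end FlowOnDomain

section Composition

variable {V E : Type*} [NormedAddCommGroup V] [NormedSpace ℝ V]
  [NormedAddCommGroup E] [InnerProductSpace ℝ E] [CompleteSpace E]
  {X : V →ₗ[ℝ] (E → E)} {C : ℝ} {f : E → ℝ} {t : ℝ}

/-- The linearization at `v` of `v ↦ f ∘ φ_{t,0}ᵛ`, as a function on the domain. -/
noncomputable def compVariation (X : V →ₗ[ℝ] (E → E)) (f : E → ℝ) (v : Lp V 2 μI) (t : ℝ)
    (h : Lp V 2 μI) (y : E) : ℝ :=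
  inner ℝ (∇ f (familyFlow X v t 0 y)) (flowVariation X v t h y)

lemma compVariation_smul (v : Lp V 2 μI) (c : ℝ) (h : Lp V 2 μI) :
    compVariation X f v t (c • h) = c • compVariation X f v t h := by
  funext y
  simp only [compVariation, flowVariation_smul, inner_smul_right, Pi.smul_apply, smul_eq_mul]

variable [FiniteDimensional ℝ E]

lemma IsBoundedC1Family.compVariation_add (hX : IsBoundedC1Family X C) (v : Lp V 2 μI)
    (ht : t ∈ Icc (0 : ℝ) 1) (g h : Lp V 2 μI) :
    compVariation X f v t (g + h) = compVariation X f v t g + compVariation X f v t h := by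
  funext y
  simp only [compVariation, hX.flowVariation_add v ht g h y, inner_add_right, Pi.add_apply]

variable [MeasurableSpace E] [BorelSpace E] {Ω : Set E} {m : Measure E} [m.IsAddHaarMeasure]

lemma stronglyMeasurable_gradient (f : E → ℝ) :
    StronglyMeasurable fun x => ∇ f x :=
  ((InnerProductSpace.toDual ℝ E).symm.continuous.measurable.comp
    (measurable_fderiv ℝ f)).stronglyMeasurable

namespace IsBoundedC1Family

lemma measurable_flowVariation (hX : IsBoundedC1Family X C) (v h : Lp V 2 μI)
    (ht : t ∈ Icc (0 : ℝ) 1) :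
    Measurable fun p : E × ℝ => flowVariation X (v + p.2 • h) t h p.1 := by
  have hc : Continuous (Function.uncurry fun (y : E) (e : ℝ) => familyFlow X (v + e • h) t 0 y) :=
    hX.continuous_familyFlow.comp (by fun_prop : Continuous fun p : E × ℝ =>
      ((v + p.2 • h, t, 0, p.1) : Lp V 2 μI × ℝ × ℝ × E))
  have e : (fun p : E × ℝ => flowVariation X (v + p.2 • h) t h p.1) =
      fun p : E × ℝ => deriv (fun e : ℝ => familyFlow X (v + e • h) t 0 p.1) p.2 :=
    funext fun p => (hX.hasDerivAt_familyFlow_velocity v h ht p.1 p.2).deriv.symm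
  rw [e]
  exact measurable_deriv_with_param hc

lemma measurable_flowVariation_const (hX : IsBoundedC1Family X C) (v h : Lp V 2 μI)
    (ht : t ∈ Icc (0 : ℝ) 1) : Measurable (flowVariation X v t h) := by
  have := (hX.measurable_flowVariation v h ht).comp (measurable_id.prodMk (measurable_const (a := 0)))
  simpa [Function.comp_def] using this

lemma memLp_comp_familyFlow (hX : IsBoundedC1Family X C) (h0 : ∀ u, ∀ x ∉ Ω, X u x = 0)
    (hΩ : MeasurableSet Ω) (v : Lp V 2 μI) {s : ℝ} (hs : s ∈ Icc (0 : ℝ) 1)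
    (ht : t ∈ Icc (0 : ℝ) 1) (hf : ContinuousOn f Ω) (hf2 : MemLp f 2 (m.restrict Ω)) :
    MemLp (f ∘ familyFlow X v s t) 2 (m.restrict Ω) := by
  obtain ⟨B, hBt, hB⟩ := hX.exists_lintegral_familyFlow_le (m := m) h0 hΩ ‖v‖
  refine ⟨(hf.comp (hX.continuous_familyFlow_point v s t).continuousOn
    fun _ hy => hX.familyFlow_mem h0 v s t hy).aestronglyMeasurable hΩ, ?_⟩
  exact (eLpNorm_comp_le_of_lintegral_le (hB v le_rfl s hs t ht) f).trans_lt
    (ENNReal.mul_lt_top hBt.lt_top hf2.2)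

lemma stronglyMeasurable_compVariation (hX : IsBoundedC1Family X C) (v h : Lp V 2 μI)
    (ht : t ∈ Icc (0 : ℝ) 1) : StronglyMeasurable (compVariation X f v t h) :=
  ((stronglyMeasurable_gradient f).comp_measurable
    (hX.continuous_familyFlow_point v t 0).measurable).inner
    (hX.measurable_flowVariation_const v h ht).stronglyMeasurable

lemma exists_eLpNorm_compVariation_le (hX : IsBoundedC1Family X C)
    (h0 : ∀ u, ∀ x ∉ Ω, X u x = 0) (hΩ : MeasurableSet Ω)
    (hf2 : MemLp (fun x => ∇ f x) 2 (m.restrict Ω)) (v : Lp V 2 μI) (ht : t ∈ Icc (0 : ℝ) 1) :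
    ∃ L : NNReal, ∀ h, eLpNorm (compVariation X f v t h) 2 (m.restrict Ω) ≤
      ENNReal.ofReal (L * ‖h‖) := by
  obtain ⟨B, hBt, hB⟩ := hX.exists_lintegral_familyFlow_le (m := m) h0 hΩ ‖v‖
  have hfin : B * eLpNorm (fun x => ∇ f x) 2 (m.restrict Ω) ≠ ⊤ := ENNReal.mul_ne_top hBt hf2.2.ne
  have hK : 0 ≤ flowConst C ‖v‖ * C := mul_nonneg (flowConst_pos _ _).le hX.pos.le
  refine ⟨(flowConst C ‖v‖ * C).toNNReal * (B * eLpNorm (fun x => ∇ f x) 2 (m.restrict Ω)).toNNReal,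
    fun h => ?_⟩
  have h1 : eLpNorm (compVariation X f v t h) 2 (m.restrict Ω) ≤
      ENNReal.ofReal (flowConst C ‖v‖ * C * ‖h‖) *
        eLpNorm ((fun x => ∇ f x) ∘ familyFlow X v t 0) 2 (m.restrict Ω) := by
    refine eLpNorm_le_mul_eLpNorm_of_ae_le_mul (ae_of_all _ fun y => ?_) _
    refine (norm_inner_le_norm _ _).trans ?_
    rw [mul_comm]
    exact mul_le_mul_of_nonneg_right (hX.norm_flowVariation_le le_rfl ht h y) (norm_nonneg _)
  refine h1.trans ?_
  have h2 := eLpNorm_comp_le_of_lintegral_le (hB v le_rfl t ht 0 (by simp)) (fun x => ∇ f x)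
  refine (mul_le_mul_right h2 _).trans (le_of_eq ?_)
  have e : ∀ a b c : ℝ, a * b * c = a * c * b := fun a b c => by ring
  rw [NNReal.coe_mul, Real.coe_toNNReal _ hK, e _ (NNReal.toReal _),
    ENNReal.ofReal_mul (mul_nonneg hK (norm_nonneg _)), ENNReal.ofReal_coe_nnreal,
    ENNReal.coe_toNNReal hfin]

lemma memLp_compVariation (hX : IsBoundedC1Family X C)
    (h0 : ∀ u, ∀ x ∉ Ω, X u x = 0) (hΩ : MeasurableSet Ω)
    (hf2 : MemLp (fun x => ∇ f x) 2 (m.restrict Ω)) (v : Lp V 2 μI) (ht : t ∈ Icc (0 : ℝ) 1)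
    (h : Lp V 2 μI) : MemLp (compVariation X f v t h) 2 (m.restrict Ω) := by
  obtain ⟨L, hL⟩ := hX.exists_eLpNorm_compVariation_le h0 hΩ hf2 v ht
  exact ⟨(hX.stronglyMeasurable_compVariation v h ht).aestronglyMeasurable,
    (hL h).trans_lt ENNReal.ofReal_lt_top⟩

/-- The linearization at `v` of `v ↦ f ∘ φ_{t,0}ᵛ`, as a bounded operator into `L²`. -/
lemma exists_clm_compVariation (hX : IsBoundedC1Family X C)
    (h0 : ∀ u, ∀ x ∉ Ω, X u x = 0) (hΩ : MeasurableSet Ω)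
    (hf2 : MemLp (fun x => ∇ f x) 2 (m.restrict Ω)) (v : Lp V 2 μI) (ht : t ∈ Icc (0 : ℝ) 1) :
    ∃ D : Lp V 2 μI →L[ℝ] Lp ℝ 2 (m.restrict Ω),
      ∀ h, D h = (hX.memLp_compVariation h0 hΩ hf2 v ht h).toLp := by
  obtain ⟨L, hL⟩ := hX.exists_eLpNorm_compVariation_le h0 hΩ hf2 v ht
  let D : Lp V 2 μI →ₗ[ℝ] Lp ℝ 2 (m.restrict Ω) :=
    { toFun := fun h => (hX.memLp_compVariation h0 hΩ hf2 v ht h).toLp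
      map_add' := fun g h => by
        rw [← MemLp.toLp_add]; congr 1; exact hX.compVariation_add v ht g h
      map_smul' := fun c h => by
        rw [RingHom.id_apply, ← MemLp.toLp_const_smul]; congr 1; exact compVariation_smul v c h }
  refine ⟨D.mkContinuous L fun h => ?_, fun h => rfl⟩
  change ‖(hX.memLp_compVariation h0 hΩ hf2 v ht h).toLp‖ ≤ _
  rw [Lp.norm_toLp]
  exact ENNReal.toReal_le_of_le_ofReal (by positivity) (hL h)

/-- The key remainder estimate in `L²`. -/
theorem exists_eLpNorm_comp_sub_sub_le (hX : IsBoundedC1Family X C)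
    (h0 : ∀ u, ∀ x ∉ Ω, X u x = 0) (hΩ : IsOpen Ω) (hf : DifferentiableOn ℝ f Ω)
    (hf2 : MemLp (fun x => ∇ f x) 2 (m.restrict Ω)) (v : Lp V 2 μI) (ht : t ∈ Icc (0 : ℝ) 1)
    {ε : ℝ} (hε : 0 < ε) : ∃ r > 0, ∀ h : Lp V 2 μI, ‖h‖ < r →
      eLpNorm (f ∘ familyFlow X (v + h) t 0 - f ∘ familyFlow X v t 0 - compVariation X f v t h) 2
        (m.restrict Ω) ≤ ENNReal.ofReal (ε * ‖h‖) := by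
  set ν := m.restrict Ω with hν
  have hΩm := hΩ.measurableSet
  have h0I : (0 : ℝ) ∈ Icc (0 : ℝ) 1 := by simp
  set R := ‖v‖ + 1 with hR
  obtain ⟨B, hBt, hB⟩ := hX.exists_lintegral_familyFlow_le (m := m) h0 hΩm R
  set K := flowConst C R with hK
  have hK0 : 0 < K := flowConst_pos _ _
  have hC := hX.pos
  have hvR : ‖v‖ ≤ R := by linarith
  set G : E → E := fun x => ∇ f x with hG
  have hGm : StronglyMeasurable G := stronglyMeasurable_gradient f
  set N : ENNReal := eLpNorm (G ∘ familyFlow X v t 0) 2 ν with hN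
  have hNt : N ≠ ⊤ := ((eLpNorm_comp_le_of_lintegral_le (hB v hvR t ht 0 h0I) G).trans_lt
    (ENNReal.mul_lt_top hBt.lt_top hf2.2)).ne
  -- continuity of the gradient along the flows
  have hlim : Tendsto (fun w => eLpNorm (G ∘ familyFlow X w t 0 - G ∘ familyFlow X v t 0) 2 ν)
      (𝓝 v) (𝓝 0) := by
    have hev : ∀ᶠ w : Lp V 2 μI in 𝓝 v, ‖w‖ ≤ R := by
      have : Tendsto (fun w : Lp V 2 μI => ‖w‖) (𝓝 v) (𝓝 ‖v‖) := continuous_norm.tendsto v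
      exact this.eventually (ge_mem_nhds (by linarith))
    refine tendsto_eLpNorm_comp_sub hΩm (fun w => hX.continuous_familyFlow_point w t 0)
      (hX.continuous_familyFlow_point v t 0) hBt (hev.mono fun w hw => hB w hw t ht 0 h0I)
      (hB v hvR t ht 0 h0I) ?_ hGm hf2
    rw [Metric.tendstoUniformly_iff]
    intro δ hδ
    filter_upwards [Metric.ball_mem_nhds v (show 0 < δ / (K * C) by positivity)] with w hw y
    rw [dist_comm, dist_eq_norm]
    rw [mem_ball_iff_norm, lt_div_iff₀ (by positivity)] at hw
    refine (hX.norm_familyFlow_sub_le_flowConst hvR ht h0I y y).trans_lt ?_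
    rw [sub_self, norm_zero, zero_add]
    linarith
  obtain ⟨r₁, hr₁, H₁⟩ := Metric.eventually_nhds_iff.1
    (hlim.eventually (ge_mem_nhds (show (0 : ENNReal) < ENNReal.ofReal (ε / (2 * (K * C))) by
      rw [ENNReal.ofReal_pos]; positivity)))
  obtain ⟨r₂, hr₂, H₂⟩ := hX.exists_norm_flowVariation_sub_le v
    (show 0 < ε / (2 * (N.toReal + 1)) by positivity)
  refine ⟨min 1 (min r₁ r₂), by positivity, fun h hh => ?_⟩
  have hh1 : ‖h‖ ≤ 1 := (hh.trans_le (min_le_left _ _)).le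
  have hhr₁ : ‖h‖ < r₁ := hh.trans_le ((min_le_right _ _).trans (min_le_left _ _))
  have hhr₂ : ‖h‖ < r₂ := hh.trans_le ((min_le_right _ _).trans (min_le_right _ _))
  have heh : ∀ e ∈ Icc (0 : ℝ) 1, ‖e • h‖ ≤ ‖h‖ := fun e he => by
    rw [norm_smul, Real.norm_of_nonneg he.1]
    exact mul_le_of_le_one_left (norm_nonneg _) he.2
  set a : ℝ → E → ℝ := fun e y =>
    inner ℝ (G (familyFlow X (v + e • h) t 0 y)) (flowVariation X (v + e • h) t h y) with ha
  set g : ℝ → E → ℝ := fun e y => a e y - compVariation X f v t h y with hg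
  have hψc : Continuous fun p : ℝ × E => familyFlow X (v + p.1 • h) t 0 p.2 :=
    hX.continuous_familyFlow.comp (by fun_prop : Continuous fun p : ℝ × E =>
      ((v + p.1 • h, t, 0, p.2) : Lp V 2 μI × ℝ × ℝ × E))
  have ham : StronglyMeasurable (Function.uncurry a) :=
    (hGm.comp_measurable hψc.measurable).inner
      ((hX.measurable_flowVariation v h ht).comp measurable_swap).stronglyMeasurable
  have hgm : StronglyMeasurable (Function.uncurry g) :=
    ham.sub ((hX.stronglyMeasurable_compVariation v h ht).comp_measurable measurable_snd)
  have hsec : ∀ e ∈ Icc (0 : ℝ) 1, eLpNorm (g e) 2 ν ≤ ENNReal.ofReal (ε * ‖h‖) := by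
    intro e he
    have hw : dist (v + e • h) v < r₁ := by
      rw [dist_eq_norm, add_sub_cancel_left]; exact (heh e he).trans_lt hhr₁
    have hw₂ : ‖v + e • h - v‖ < r₂ := by
      rw [add_sub_cancel_left]; exact (heh e he).trans_lt hhr₂
    have hwR : ‖v + e • h‖ ≤ R := (norm_add_le _ _).trans (by linarith [heh e he])
    set g₁ : E → ℝ := fun y => inner ℝ ((G ∘ familyFlow X (v + e • h) t 0
      - G ∘ familyFlow X v t 0) y) (flowVariation X (v + e • h) t h y) with hg₁
    set g₂ : E → ℝ := fun y => inner ℝ ((G ∘ familyFlow X v t 0) y)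
      (flowVariation X (v + e • h) t h y - flowVariation X v t h y) with hg₂
    have e1 : g e = g₁ + g₂ := by
      funext y
      simp only [hg, hg₁, hg₂, ha, compVariation, Pi.add_apply, Pi.sub_apply, Function.comp_apply,
        inner_sub_left, inner_sub_right]
      ring
    have m₁ : AEStronglyMeasurable g₁ ν :=
      (((hGm.comp_measurable (hX.continuous_familyFlow_point _ t 0).measurable).sub
        (hGm.comp_measurable (hX.continuous_familyFlow_point _ t 0).measurable)).inner
        (hX.measurable_flowVariation_const _ h ht).stronglyMeasurable).aestronglyMeasurable
    have m₂ : AEStronglyMeasurable g₂ ν :=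
      ((hGm.comp_measurable (hX.continuous_familyFlow_point _ t 0).measurable).inner
        ((hX.measurable_flowVariation_const _ h ht).stronglyMeasurable.sub
          (hX.measurable_flowVariation_const _ h ht).stronglyMeasurable)).aestronglyMeasurable
    rw [e1]
    refine (eLpNorm_add_le m₁ m₂ (by norm_num)).trans ?_
    have n₁ : eLpNorm g₁ 2 ν ≤ ENNReal.ofReal (ε / 2 * ‖h‖) := by
      have : eLpNorm g₁ 2 ν ≤ ENNReal.ofReal (K * C * ‖h‖) *
          eLpNorm (G ∘ familyFlow X (v + e • h) t 0 - G ∘ familyFlow X v t 0) 2 ν := by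
        refine eLpNorm_le_mul_eLpNorm_of_ae_le_mul (ae_of_all _ fun y => ?_) _
        refine (norm_inner_le_norm _ _).trans ?_
        rw [mul_comm]
        exact mul_le_mul_of_nonneg_right (hX.norm_flowVariation_le hwR ht h y) (norm_nonneg _)
      refine this.trans ((mul_le_mul_right (H₁ hw) _).trans (le_of_eq ?_))
      rw [← ENNReal.ofReal_mul (by positivity)]
      congr 1; field_simp
    have n₂ : eLpNorm g₂ 2 ν ≤ ENNReal.ofReal (ε / 2 * ‖h‖) := by
      have : eLpNorm g₂ 2 ν ≤ ENNReal.ofReal (ε / (2 * (N.toReal + 1)) * ‖h‖) * N := by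
        refine eLpNorm_le_mul_eLpNorm_of_ae_le_mul (ae_of_all _ fun y => ?_) _
        refine (norm_inner_le_norm _ _).trans ?_
        rw [mul_comm]
        exact mul_le_mul_of_nonneg_right (H₂ _ hw₂ t ht h y) (norm_nonneg _)
      refine this.trans ?_
      rw [← ENNReal.ofReal_toReal hNt, ← ENNReal.ofReal_mul (by positivity)]
      refine ENNReal.ofReal_le_ofReal ?_
      rw [ENNReal.toReal_ofReal ENNReal.toReal_nonneg]
      have hN1 : N.toReal / (N.toReal + 1) ≤ 1 := by
        rw [div_le_one (by positivity)]; linarith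
      calc _ = ε / 2 * ‖h‖ * (N.toReal / (N.toReal + 1)) := by field_simp
        _ ≤ ε / 2 * ‖h‖ * 1 := by gcongr
        _ = _ := mul_one _
    refine (add_le_add n₁ n₂).trans (le_of_eq ?_)
    rw [← ENNReal.ofReal_add (by positivity) (by positivity)]
    congr 1; ring
  have hJ : ∫⁻ y, (∫⁻ e, ‖g e y‖ₑ ∂μI) ^ 2 ∂ν ≤ ENNReal.ofReal (ε * ‖h‖) ^ 2 :=
    lintegral_sq_lintegral_le hgm.aestronglyMeasurable
      ((ae_restrict_mem measurableSet_Icc).mono fun e he => hsec e he)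
  have hfin : ∀ᵐ y ∂ν, ∫⁻ e, ‖g e y‖ₑ ∂μI < ⊤ := by
    have hmeas : Measurable fun y => (∫⁻ e, ‖g e y‖ₑ ∂μI) ^ 2 :=
      (Measurable.lintegral_prod_left' (f := fun p : ℝ × E => ‖g p.1 p.2‖ₑ) hgm.enorm).pow_const 2
    have := ae_lt_top hmeas (hJ.trans_lt (ENNReal.pow_lt_top ENNReal.ofReal_lt_top)).ne
    filter_upwards [this] with y hy
    by_contra hcon
    rw [not_lt, top_le_iff] at hcon
    simp [hcon] at hy
  have hpt : ∀ᵐ y ∂ν, ‖(f ∘ familyFlow X (v + h) t 0 - f ∘ familyFlow X v t 0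
      - compVariation X f v t h) y‖ₑ ≤ ∫⁻ e, ‖g e y‖ₑ ∂μI := by
    filter_upwards [hfin, ae_restrict_mem hΩm] with y hy hyΩ
    have hgi : Integrable (fun e => g e y) μI :=
      ⟨(hgm.comp_measurable (measurable_id.prodMk measurable_const)).aestronglyMeasurable, hy⟩
    have hgi' : IntervalIntegrable (fun e => g e y) volume 0 1 :=
      (intervalIntegrable_iff_integrableOn_Icc_of_le zero_le_one).2 hgi
    have hai : IntervalIntegrable (fun e => a e y) volume 0 1 := by
      have := hgi'.add (intervalIntegrable_const (c := compVariation X f v t h y))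
      refine this.congr (fun e _ => ?_)
      simp [hg]
    have hd : ∀ e ∈ uIcc (0 : ℝ) 1, HasDerivAt
        (fun e : ℝ => f (familyFlow X (v + e • h) t 0 y)) (a e y) e := fun e _ => by
      have hm : familyFlow X (v + e • h) t 0 y ∈ Ω := hX.familyFlow_mem h0 _ t 0 hyΩ
      have hfd := (hf.differentiableAt (hΩ.mem_nhds hm)).hasGradientAt.hasFDerivAt
      exact hfd.comp_hasDerivAt e (hX.hasDerivAt_familyFlow_velocity v h ht y e)
    have hftc := intervalIntegral.integral_eq_sub_of_hasDerivAt hd hai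
    have e2 : (f ∘ familyFlow X (v + h) t 0 - f ∘ familyFlow X v t 0
        - compVariation X f v t h) y = ∫ e in (0 : ℝ)..1, g e y := by
      rw [hg]
      rw [intervalIntegral.integral_sub hai intervalIntegrable_const, hftc]
      simp
    rw [e2, intervalIntegral.integral_of_le zero_le_one, ← integral_Icc_eq_integral_Ioc]
    exact enorm_integral_le_lintegral_enorm _
  rw [← ENNReal.pow_le_pow_left_iff two_ne_zero, eLpNorm_two_sq]
  exact (lintegral_mono_ae (hpt.mono fun y hy => by gcongr)).trans hJ

/-- `v ↦ f ∘ φ_{t,0}ᵛ` is Fréchet differentiable into `L²(Ω)`. -/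
theorem hasFDerivAt_toLp_comp (hX : IsBoundedC1Family X C)
    (h0 : ∀ u, ∀ x ∉ Ω, X u x = 0) (hΩ : IsOpen Ω) (hf : DifferentiableOn ℝ f Ω)
    (hf2 : MemLp (fun x => ∇ f x) 2 (m.restrict Ω)) (v : Lp V 2 μI) (ht : t ∈ Icc (0 : ℝ) 1)
    (hmem : ∀ w : Lp V 2 μI, MemLp (f ∘ familyFlow X w t 0) 2 (m.restrict Ω))
    {D : Lp V 2 μI →L[ℝ] Lp ℝ 2 (m.restrict Ω)}
    (hD : ∀ h, D h = (hX.memLp_compVariation h0 hΩ.measurableSet hf2 v ht h).toLp) :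
    HasFDerivAt (fun w => (hmem w).toLp) D v := by
  rw [hasFDerivAt_iff_isLittleO_nhds_zero, Asymptotics.isLittleO_iff]
  intro ε hε
  obtain ⟨r, hr, H⟩ := hX.exists_eLpNorm_comp_sub_sub_le h0 hΩ hf hf2 v ht hε
  filter_upwards [Metric.ball_mem_nhds (0 : Lp V 2 μI) hr] with h hh
  rw [mem_ball_zero_iff] at hh
  rw [hD, ← MemLp.toLp_sub, ← MemLp.toLp_sub, Lp.norm_toLp]
  exact ENNReal.toReal_le_of_le_ofReal (by positivity) (H h hh)

end IsBoundedC1Family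

end Composition

section Duality

variable {V E : Type*} [NormedAddCommGroup V] [NormedSpace ℝ V]
  [NormedAddCommGroup E] [InnerProductSpace ℝ E] [CompleteSpace E] [FiniteDimensional ℝ E]
  {X : V →ₗ[ℝ] (E → E)} {C : ℝ} {f : E → ℝ} {s t : ℝ} {Ω : Set E}

lemma IsBoundedC1Family.inner_gradient_comp_familyFlow (hX : IsBoundedC1Family X C)
    (h0 : ∀ u, ∀ x ∉ Ω, X u x = 0) (hΩ : IsOpen Ω) (hf : DifferentiableOn ℝ f Ω)
    (v : Lp V 2 μI) (hs : s ∈ Icc (0 : ℝ) 1) (ht : t ∈ Icc (0 : ℝ) 1) {z : E} (hz : z ∈ Ω) (w : E) :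
    inner ℝ (∇ (f ∘ familyFlow X v s t) z) w =
      inner ℝ (∇ f (familyFlow X v s t z)) (fderiv ℝ (familyFlow X v s t) z w) := by
  have hd := hX.hasFDerivAt_familyFlow v hs ht z
  have hfd := hf.differentiableAt (hΩ.mem_nhds (hX.familyFlow_mem h0 v s t hz))
  have h1 := (hfd.hasFDerivAt.comp z hd).hasGradientAt.gradient
  rw [h1, InnerProductSpace.toDual_symm_apply, ContinuousLinearMap.comp_apply, gradient,
    InnerProductSpace.toDual_symm_apply]

variable [MeasurableSpace E] [BorelSpace E] {m : Measure E} [m.IsAddHaarMeasure]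

namespace IsBoundedC1Family

lemma memLp_gradient_comp_familyFlow (hX : IsBoundedC1Family X C)
    (h0 : ∀ u, ∀ x ∉ Ω, X u x = 0) (hΩ : IsOpen Ω) (hf : DifferentiableOn ℝ f Ω)
    (hf2 : MemLp (fun x => ∇ f x) 2 (m.restrict Ω)) (v : Lp V 2 μI) (hs : s ∈ Icc (0 : ℝ) 1)
    (ht : t ∈ Icc (0 : ℝ) 1) :
    MemLp (fun x => ∇ (f ∘ familyFlow X v s t) x) 2 (m.restrict Ω) := by
  obtain ⟨B, hBt, hB⟩ := hX.exists_lintegral_familyFlow_le (m := m) h0 hΩ.measurableSet ‖v‖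
  refine ⟨(stronglyMeasurable_gradient _).aestronglyMeasurable, ?_⟩
  have h1 : eLpNorm (fun x => ∇ (f ∘ familyFlow X v s t) x) 2 (m.restrict Ω) ≤
      ENNReal.ofReal (flowConst C ‖v‖) *
        eLpNorm ((fun x => ∇ f x) ∘ familyFlow X v s t) 2 (m.restrict Ω) := by
    refine eLpNorm_le_mul_eLpNorm_of_ae_le_mul ?_ _
    filter_upwards [ae_restrict_mem hΩ.measurableSet] with z hz
    have h2 := hX.inner_gradient_comp_familyFlow h0 hΩ hf v hs ht hz
      (∇ (f ∘ familyFlow X v s t) z)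
    rcases eq_or_ne (∇ (f ∘ familyFlow X v s t) z) 0 with h3 | h3
    · rw [h3, norm_zero]; exact mul_nonneg (flowConst_pos _ _).le (norm_nonneg _)
    · have h4 : 0 < ‖∇ (f ∘ familyFlow X v s t) z‖ := norm_pos_iff.2 h3
      rw [real_inner_self_eq_norm_sq] at h2
      refine le_of_mul_le_mul_right ?_ h4
      calc _ = ‖∇ (f ∘ familyFlow X v s t) z‖ ^ 2 := by ring
        _ ≤ ‖∇ f (familyFlow X v s t z)‖ * (flowConst C ‖v‖ * ‖∇ (f ∘ familyFlow X v s t) z‖) := by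
            rw [h2]
            refine (real_inner_le_norm _ _).trans ?_
            gcongr
            refine (ContinuousLinearMap.le_opNorm _ _).trans ?_
            gcongr
            exact hX.norm_fderiv_familyFlow_le le_rfl hs ht z
        _ = _ := by simp only [Function.comp_apply]; ring
  exact h1.trans_lt (ENNReal.mul_lt_top ENNReal.ofReal_lt_top
    ((eLpNorm_comp_le_of_lintegral_le (hB v le_rfl s hs t ht) _).trans_lt
      (ENNReal.mul_lt_top hBt.lt_top hf2.2)))

lemma memLp_det_mul_comp_familyFlow (hX : IsBoundedC1Family X C)
    (h0 : ∀ u, ∀ x ∉ Ω, X u x = 0) (hΩ : IsOpen Ω) {G : E → ℝ} (hGm : StronglyMeasurable G)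
    (hG : MemLp G 2 (m.restrict Ω)) (v : Lp V 2 μI) (hs : s ∈ Icc (0 : ℝ) 1)
    (ht : t ∈ Icc (0 : ℝ) 1) :
    MemLp (fun z => (fderiv ℝ (familyFlow X v s t) z).det * G (familyFlow X v s t z)) 2
      (m.restrict Ω) := by
  obtain ⟨B, hBt, hB⟩ := hX.exists_lintegral_familyFlow_le (m := m) h0 hΩ.measurableSet ‖v‖
  obtain ⟨c, hc⟩ := (isCompact_closedBall (0 : E →L[ℝ] E)
    (flowConst C ‖v‖)).exists_bound_of_continuousOn
    (f := fun A : E →L[ℝ] E => A.det) ContinuousLinearMap.continuous_det.continuousOn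
  refine ⟨((ContinuousLinearMap.continuous_det.comp ((hX.contDiff_familyFlow v hs
    ht).continuous_fderiv one_ne_zero)).stronglyMeasurable.mul (hGm.comp_measurable
    (hX.continuous_familyFlow_point v s t).measurable)).aestronglyMeasurable, ?_⟩
  have h1 : eLpNorm (fun z => (fderiv ℝ (familyFlow X v s t) z).det * G (familyFlow X v s t z)) 2
      (m.restrict Ω) ≤ ENNReal.ofReal c * eLpNorm (G ∘ familyFlow X v s t) 2 (m.restrict Ω) := by
    refine eLpNorm_le_mul_eLpNorm_of_ae_le_mul (ae_of_all _ fun z => ?_) _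
    rw [norm_mul]
    exact mul_le_mul_of_nonneg_right (hc _ (mem_closedBall_zero_iff.2
      (hX.norm_fderiv_familyFlow_le le_rfl hs ht z))) (norm_nonneg _)
  exact h1.trans_lt (ENNReal.mul_lt_top ENNReal.ofReal_lt_top
    ((eLpNorm_comp_le_of_lintegral_le (hB v le_rfl s hs t ht) _).trans_lt
      (ENNReal.mul_lt_top hBt.lt_top hG.2)))

/-- The adjoint of the linearization of `v ↦ f ∘ φ_{t,0}ᵛ`, by Fubini and change of variables. -/
theorem integral_mul_compVariation (hX : IsBoundedC1Family X C)
    (h0 : ∀ u, ∀ x ∉ Ω, X u x = 0) (hΩ : IsOpen Ω) (hf : DifferentiableOn ℝ f Ω)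
    (hf2 : MemLp (fun x => ∇ f x) 2 (m.restrict Ω)) (v h : Lp V 2 μI) (ht : t ∈ Icc (0 : ℝ) 1)
    {G : E → ℝ} (hGm : StronglyMeasurable G) (hG : MemLp G 2 (m.restrict Ω)) :
    IntegrableOn (fun τ => ∫ z in Ω, (fderiv ℝ (familyFlow X v τ t) z).det
      * G (familyFlow X v τ t z) * inner ℝ (∇ (f ∘ familyFlow X v τ 0) z) (X (h τ) z) ∂m)
      (Ioc 0 t) ∧
    ∫ y in Ω, G y * compVariation X f v t h y ∂m =
      -∫ τ in Ioc 0 t, ∫ z in Ω, (fderiv ℝ (familyFlow X v τ t) z).det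
        * G (familyFlow X v τ t z) * inner ℝ (∇ (f ∘ familyFlow X v τ 0) z) (X (h τ) z) ∂m := by
  have h0I : (0 : ℝ) ∈ Icc (0 : ℝ) 1 := by simp
  have hsub : ∀ τ ∈ Ioc 0 t, τ ∈ Icc (0 : ℝ) 1 := fun τ hτ => ⟨hτ.1.le, hτ.2.trans ht.2⟩
  have hsub' : Ioc 0 t ⊆ Icc (0 : ℝ) 1 := hsub
  set ν := m.restrict Ω with hν
  set κ : Measure ℝ := volume.restrict (Ioc 0 t) with hκ
  have hκμ : (μI).restrict (Ioc 0 t) = κ := by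
    rw [Measure.restrict_restrict measurableSet_Ioc, inter_eq_left.2 hsub']
  set K := flowConst C ‖v‖ with hK
  have hK0 : 0 < K := flowConst_pos _ _
  have hC := hX.pos
  set b : ℝ → E → ℝ := fun τ y => inner ℝ (∇ f (familyFlow X v t 0 y))
    (fderiv ℝ (familyFlow X v τ 0) (familyFlow X v t τ y) (X (h τ) (familyFlow X v t τ y))) with hb
  have hflow : Continuous fun p : ℝ × E => familyFlow X v t p.1 p.2 :=
    hX.continuous_familyFlow.comp (by fun_prop : Continuous fun p : ℝ × E =>
      ((v, t, p.1, p.2) : Lp V 2 μI × ℝ × ℝ × E))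
  have hbm : StronglyMeasurable (Function.uncurry b) := by
    have h1 : StronglyMeasurable fun p : ℝ × E => ∇ f (familyFlow X v t 0 p.2) :=
      (stronglyMeasurable_gradient f).comp_measurable
        ((hX.continuous_familyFlow_point v t 0).measurable.comp measurable_snd)
    have h2 : StronglyMeasurable fun p : ℝ × E => X (h p.1) (familyFlow X v t p.1 p.2) :=
      hX.continuous_eval.comp_stronglyMeasurable
        (((Lp.stronglyMeasurable h).comp_measurable measurable_fst).prodMk
          hflow.stronglyMeasurable)
    have h3 : StronglyMeasurable fun p : ℝ × E =>
        fderiv ℝ (familyFlow X v p.1 0) (familyFlow X v t p.1 p.2) := by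
      have h4 := measurable_fderiv_with_param ℝ (f := fun τ : ℝ => familyFlow X v τ 0)
        (hX.continuous_familyFlow.comp (by fun_prop : Continuous fun p : ℝ × E =>
          ((v, p.1, 0, p.2) : Lp V 2 μI × ℝ × ℝ × E)))
      exact (h4.comp (measurable_fst.prodMk hflow.measurable)).stronglyMeasurable
    exact h1.inner ((continuous_fst.clm_apply continuous_snd : Continuous
      fun q : (E →L[ℝ] E) × E => q.1 q.2).comp_stronglyMeasurable (h3.prodMk h2))
  have hbi : Integrable (Function.uncurry fun τ y => G y * b τ y) (κ.prod ν) := by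
    have hi1 : Integrable (fun y => ‖G y‖ * ‖∇ f (familyFlow X v t 0 y)‖) ν := by
      have h1 : MemLp (fun y => ∇ f (familyFlow X v t 0 y)) 2 ν := by
        obtain ⟨B, hBt, hB⟩ := hX.exists_lintegral_familyFlow_le (m := m) h0 hΩ.measurableSet ‖v‖
        exact ⟨((stronglyMeasurable_gradient f).comp_measurable
          (hX.continuous_familyFlow_point v t 0).measurable).aestronglyMeasurable,
          (eLpNorm_comp_le_of_lintegral_le (hB v le_rfl t ht 0 h0I) (fun x => ∇ f x)).trans_lt
            (ENNReal.mul_lt_top hBt.lt_top hf2.2)⟩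
      exact hG.norm.integrable_mul h1.norm
    have hi2 : Integrable (fun τ => K * C * ‖h τ‖) κ := by
      rw [← hκμ]; exact ((integrable_velocity h).norm.const_mul _).restrict
    refine (hi2.mul_prod hi1).mono' ((hGm.comp_measurable measurable_snd).mul
      hbm).aestronglyMeasurable ?_
    have hae : ∀ᵐ p : ℝ × E ∂(κ.prod ν), p.1 ∈ Ioc 0 t :=
      Measure.quasiMeasurePreserving_fst.ae (ae_restrict_mem measurableSet_Ioc)
    filter_upwards [hae] with p hp
    simp only [Function.uncurry, norm_mul]
    have h1 : ‖b p.1 p.2‖ ≤ ‖∇ f (familyFlow X v t 0 p.2)‖ * (K * (C * ‖h p.1‖)) := by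
      refine (norm_inner_le_norm _ _).trans ?_
      gcongr
      refine (ContinuousLinearMap.le_opNorm _ _).trans ?_
      gcongr
      · exact hX.norm_fderiv_familyFlow_le le_rfl (hsub _ hp) h0I _
      · exact hX.norm_le _ _
    calc ‖G p.2‖ * ‖b p.1 p.2‖ ≤ ‖G p.2‖ * (‖∇ f (familyFlow X v t 0 p.2)‖ * (K * (C * ‖h p.1‖))) := by
          gcongr
      _ = _ := by ring
  -- change of variables at a fixed time
  have hcv : ∀ τ ∈ Ioc 0 t, ∫ y, G y * b τ y ∂ν =
      ∫ z in Ω, (fderiv ℝ (familyFlow X v τ t) z).det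
        * G (familyFlow X v τ t z) * inner ℝ (∇ (f ∘ familyFlow X v τ 0) z) (X (h τ) z) ∂m := by
    intro τ hτ
    rw [hν, hX.setIntegral_eq_setIntegral_familyFlow h0 hΩ.measurableSet v (hsub τ hτ) ht]
    refine setIntegral_congr_fun hΩ.measurableSet fun z hz => ?_
    simp only [hb, smul_eq_mul, hX.familyFlow_leftInverse, hX.familyFlow_familyFlow]
    rw [hX.inner_gradient_comp_familyFlow h0 hΩ hf v (hsub τ hτ) h0I hz, mul_assoc]
  have hint : Integrable (fun τ => ∫ y, G y * b τ y ∂ν) κ := hbi.integral_prod_left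
  refine ⟨hint.congr ?_, ?_⟩
  · filter_upwards [ae_restrict_mem measurableSet_Ioc] with τ hτ using hcv τ hτ
  · have h1 : ∀ y, G y * compVariation X f v t h y = -∫ τ, G y * b τ y ∂κ := fun y => by
      have hi := (hX.exists_flowVariation_eq v ht y h).1
      rw [compVariation, flowVariation, inner_neg_right, intervalIntegral.integral_of_le ht.1, hκμ,
        integral_const_mul, mul_neg]
      congr 2
      rw [← hκμ]
      exact ((innerSL ℝ (∇ f (familyFlow X v t 0 y))).integral_comp_comm hi.restrict).symm
    simp_rw [h1]
    rw [integral_neg, ← integral_integral_swap hbi]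
    congr 1
    exact setIntegral_congr_fun measurableSet_Ioc hcv

end IsBoundedC1Family

end Duality

section BoundaryValues

variable {n : ℕ} {Ω : Set (EuclideanSpace ℝ (Fin n))}

lemma IsC10.continuous_extension {w : EuclideanSpace ℝ (Fin n) → EuclideanSpace ℝ (Fin n)}
    (hΩ : IsOpen Ω) (hw : IsC10 Ω w) (h0 : ∀ x ∉ Ω, w x = 0) : Continuous w := by
  rw [continuous_iff_continuousAt]
  intro p
  by_cases hp : p ∈ Ω
  · exact hw.contDiffOn.continuousOn.continuousAt (hΩ.mem_nhds hp)
  · rw [Metric.continuousAt_iff']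
    intro ε hε
    obtain ⟨K, hK, hKΩ, h⟩ := hw.vanish ε hε
    filter_upwards [hK.isClosed.isOpen_compl.mem_nhds fun h => hp (hKΩ h)] with x hx
    rw [h0 p hp, dist_zero_right]
    by_cases hxΩ : x ∈ Ω
    · exact (h x ⟨hxΩ, hx⟩).1
    · rwa [h0 x hxΩ, norm_zero]

lemma IsC10.hasFDerivAt_zero {w : EuclideanSpace ℝ (Fin n) → EuclideanSpace ℝ (Fin n)}
    (hΩ : IsOpen Ω) (hw : IsC10 Ω w) (h0 : ∀ x ∉ Ω, w x = 0) {p : EuclideanSpace ℝ (Fin n)}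
    (hp : p ∉ Ω) : HasFDerivAt w (0 : _ →L[ℝ] EuclideanSpace ℝ (Fin n)) p := by
  have hc := hw.continuous_extension hΩ h0
  rw [hasFDerivAt_iff_isLittleO, Asymptotics.isLittleO_iff]
  intro ε hε
  obtain ⟨K, hK, hKΩ, h⟩ := hw.vanish ε hε
  obtain ⟨r, hr, hball⟩ := Metric.mem_nhds_iff.1
    (hK.isClosed.isOpen_compl.mem_nhds fun h => hp (hKΩ h))
  filter_upwards [Metric.ball_mem_nhds p hr] with x hx
  rw [h0 p hp, sub_zero, FunLike.coe_zero, Pi.zero_apply, sub_zero]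
  by_cases hxΩ : x ∈ Ω
  swap
  · rw [h0 x hxΩ, norm_zero]; positivity
  set γ : ℝ → EuclideanSpace ℝ (Fin n) := fun θ => x + θ • (p - x) with hγ
  have hγc : Continuous γ := by fun_prop
  set S : Set ℝ := Icc 0 1 ∩ γ ⁻¹' Ωᶜ with hS
  have hSc : IsCompact S := isCompact_Icc.inter_right (hΩ.isClosed_compl.preimage hγc)
  have hSn : S.Nonempty := ⟨1, by simp, by simpa [hγ] using hp⟩
  have hθS := hSc.sInf_mem hSn
  set θ₁ := sInf S with hθ₁
  have hbd : ∀ θ ∈ Ico 0 θ₁, γ θ ∈ Ω ∧ ‖fderiv ℝ w (γ θ)‖ < ε := fun θ hθ => by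
    have hθ1 : θ ∈ Icc (0 : ℝ) 1 := ⟨hθ.1, hθ.2.le.trans hθS.1.2⟩
    have h1 : γ θ ∈ Ω := by
      by_contra hn
      exact absurd (csInf_le hSc.bddBelow ⟨hθ1, hn⟩) (not_le.2 hθ.2)
    have h2 : γ θ ∈ Metric.ball p r :=
      (convex_ball p r).add_smul_sub_mem hx (Metric.mem_ball_self hr) hθ1
    exact ⟨h1, (h _ ⟨h1, hball h2⟩).2⟩
  have hseg := norm_image_sub_le_of_norm_deriv_right_le_segment (a := 0) (b := θ₁) (f := w ∘ γ)
    (f' := fun θ => fderiv ℝ w (γ θ) (p - x)) (C := ε * ‖p - x‖) (hc.comp hγc).continuousOn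
    (fun θ hθ => by
      have h1 : HasDerivAt γ (p - x) θ := by
        have h := ((hasDerivAt_id θ).smul_const (p - x)).const_add x
        rwa [one_smul] at h
      have h2 := (hw.contDiffOn.differentiableOn one_ne_zero).differentiableAt
        (hΩ.mem_nhds (hbd θ hθ).1)
      exact (h2.hasFDerivAt.comp_hasDerivAt θ h1).hasDerivWithinAt)
    (fun θ hθ => (ContinuousLinearMap.le_opNorm _ _).trans (by gcongr; exact (hbd θ hθ).2.le))
    θ₁ ⟨hθS.1.1, le_rfl⟩
  have e1 : (w ∘ γ) θ₁ = 0 := h0 _ hθS.2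
  have e0 : (w ∘ γ) 0 = w x := by simp [hγ]
  rw [e1, e0, zero_sub, norm_neg, sub_zero, norm_sub_rev p x] at hseg
  exact hseg.trans (mul_le_of_le_one_right (by positivity) hθS.1.2)

end BoundaryValues

section Extension

variable {n : ℕ} {Ω : Set (EuclideanSpace ℝ (Fin n))}
  {V : Type*} [NormedAddCommGroup V] [InnerProductSpace ℝ V]
  [RKHS ℝ V Ω (EuclideanSpace ℝ (Fin n))]

lemma vectorField_of_mem (u : V) {x : EuclideanSpace ℝ (Fin n)} (hx : x ∈ Ω) :
    vectorField u x = u ⟨x, hx⟩ :=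
  Subtype.val_injective.extend_apply (fun x => u x) 0 ⟨x, hx⟩

lemma vectorField_of_notMem (u : V) {x : EuclideanSpace ℝ (Fin n)} (hx : x ∉ Ω) :
    vectorField u x = 0 :=
  Function.extend_apply' _ _ _ (by rintro ⟨y, rfl⟩; exact hx y.2)

variable (V) in
/-- The vector field given by an element of `V`, as a linear map. -/
noncomputable def vectorFieldₗ :
    V →ₗ[ℝ] (EuclideanSpace ℝ (Fin n) → EuclideanSpace ℝ (Fin n)) where
  toFun := vectorField
  map_add' u w := by
    funext x
    by_cases hx : x ∈ Ω
    · simp [vectorField_of_mem _ hx]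
    · simp [vectorField_of_notMem _ hx]
  map_smul' c u := by
    funext x
    by_cases hx : x ∈ Ω
    · simp [vectorField_of_mem _ hx]
    · simp [vectorField_of_notMem _ hx]

lemma vectorFieldₗ_apply (u : V) : vectorFieldₗ V u = vectorField u := rfl

/-- Elements of an admissible space extend by zero to a bounded family of `C¹` fields on `ℝⁿ`. -/
theorem IsAdmissible.exists_isBoundedC1Family (hΩ : IsOpen Ω) (hV : IsAdmissible V) :
    ∃ C, IsBoundedC1Family (vectorFieldₗ V) C := by
  obtain ⟨C, hC, hbound⟩ := hV.bound
  have hout : ∀ u : V, ∀ x ∉ Ω, vectorField u x = 0 := fun u x hx => vectorField_of_notMem u hx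
  have hzero : ∀ u : V, ∀ x ∉ Ω, HasFDerivAt (vectorField u)
      (0 : _ →L[ℝ] EuclideanSpace ℝ (Fin n)) x := fun u x hx =>
    (hV.isC10 u).hasFDerivAt_zero hΩ (hout u) hx
  have hcd : ∀ u : V, Continuous (fderiv ℝ (vectorField u)) := fun u => by
    rw [continuous_iff_continuousAt]
    intro p
    by_cases hp : p ∈ Ω
    · exact ((hV.isC10 u).contDiffOn.continuousOn_fderiv_of_isOpen hΩ le_rfl).continuousAt
        (hΩ.mem_nhds hp)
    · rw [Metric.continuousAt_iff']
      intro ε hε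
      obtain ⟨K, hK, hKΩ, h⟩ := (hV.isC10 u).vanish ε hε
      filter_upwards [hK.isClosed.isOpen_compl.mem_nhds fun h => hp (hKΩ h)] with x hx
      rw [(hzero u p hp).fderiv, dist_zero_right]
      by_cases hxΩ : x ∈ Ω
      · exact (h x ⟨hxΩ, hx⟩).2
      · rwa [(hzero u x hxΩ).fderiv, norm_zero]
  refine ⟨C, hC, fun u x => ?_, fun u => ?_, fun u x => ?_, fun u => ?_⟩
  · rw [vectorFieldₗ_apply]
    by_cases hx : x ∈ Ω
    · exact (le_add_of_nonneg_right (norm_nonneg _)).trans (hbound u x hx x hx)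
    · rw [hout u x hx, norm_zero]; positivity
  · rw [vectorFieldₗ_apply, contDiff_one_iff_fderiv]
    refine ⟨fun x => ?_, hcd u⟩
    by_cases hx : x ∈ Ω
    · exact ((hV.isC10 u).contDiffOn.differentiableOn one_ne_zero).differentiableAt
        (hΩ.mem_nhds hx)
    · exact (hzero u x hx).differentiableAt
  · rw [vectorFieldₗ_apply]
    by_cases hx : x ∈ Ω
    · exact (le_add_of_nonneg_left (norm_nonneg _)).trans (hbound u x hx x hx)
    · rw [(hzero u x hx).fderiv, norm_zero]; positivity
  · rw [vectorFieldₗ_apply]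
    refine (hcd u).uniformContinuous_of_tendsto_cocompact (x := 0) ?_
    rw [Metric.tendsto_nhds]
    intro ε hε
    obtain ⟨K, hK, hKΩ, h⟩ := (hV.isC10 u).vanish ε hε
    filter_upwards [hK.compl_mem_cocompact] with x hx
    rw [dist_zero_right]
    by_cases hxΩ : x ∈ Ω
    · exact (h x ⟨hxΩ, hx⟩).2
    · rwa [(hzero u x hxΩ).fderiv, norm_zero]

end Extension

section TimeInterval

lemma restrict_Icc_restrict_Ioc {t : ℝ} (ht : t ∈ Icc (0 : ℝ) 1) :
    (μI).restrict (Ioc 0 t) = volume.restrict (Ioc 0 t) := by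
  rw [Measure.restrict_restrict measurableSet_Ioc, inter_eq_left.2]
  exact Ioc_subset_Icc_self.trans (Icc_subset_Icc_right ht.2)

lemma intervalIntegral_restrict_Icc {G : Type*} [NormedAddCommGroup G] [NormedSpace ℝ G]
    (F : ℝ → G) {t : ℝ} (ht : t ∈ Icc (0 : ℝ) 1) :
    ∫ τ in (0 : ℝ)..t, F τ ∂μI = ∫ τ in (0 : ℝ)..t, F τ := by
  rw [intervalIntegral.integral_of_le ht.1, intervalIntegral.integral_of_le ht.1,
    restrict_Icc_restrict_Ioc ht]

end TimeInterval

section Identification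

variable {n : ℕ} {Ω : Set (EuclideanSpace ℝ (Fin n))}
  {V : Type*} [NormedAddCommGroup V] [InnerProductSpace ℝ V]
  [RKHS ℝ V Ω (EuclideanSpace ℝ (Fin n))] {C : ℝ} {s t : ℝ}

lemma vectorFieldₗ_of_notMem (u : V) (x : EuclideanSpace ℝ (Fin n)) (hx : x ∉ Ω) :
    vectorFieldₗ V u x = 0 :=
  vectorField_of_notMem u hx

lemma isFlow_familyFlow (hX : IsBoundedC1Family (vectorFieldₗ V) C) (v : VelocitySpace V) :
    IsFlow (⇑v) (familyFlow (vectorFieldₗ V) v 0) where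
  mapsTo t _ x hx := hX.familyFlow_mem vectorFieldₗ_of_notMem v 0 t hx
  intervalIntegrable x _ := by
    rw [intervalIntegrable_iff_integrableOn_Icc_of_le zero_le_one]
    exact (hX.isCaratheodory v).integrable (hX.continuous_familyFlow_time v 0 x)
  eq x _ t ht := by
    rw [← intervalIntegral_restrict_Icc _ ht]
    exact (hX.isSolution_familyFlow v 0 x).eq t

lemma IsFlow.eq_familyFlow (hX : IsBoundedC1Family (vectorFieldₗ V) C) {v : VelocitySpace V}
    {φ : ℝ → EuclideanSpace ℝ (Fin n) → EuclideanSpace ℝ (Fin n)} (hφ : IsFlow (⇑v) φ)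
    (ht : t ∈ Icc (0 : ℝ) 1) {x : EuclideanSpace ℝ (Fin n)} (hx : x ∈ Ω) :
    φ t x = familyFlow (vectorFieldₗ V) v 0 t x := by
  set F : ℝ → EuclideanSpace ℝ (Fin n) := fun τ => vectorField (v τ) (φ τ x) with hF
  have hFi : Integrable F μI :=
    (intervalIntegrable_iff_integrableOn_Icc_of_le zero_le_one).1 (hφ.intervalIntegrable x hx)
  have hy : ∀ r ∈ Icc (0 : ℝ) 1, x + ∫ τ in (0 : ℝ)..r, F τ ∂μI = φ r x := fun r hr => by
    rw [intervalIntegral_restrict_Icc F hr, hφ.eq x hx r hr]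
  have hsol : IsSolution (fun τ => vectorFieldₗ V (v τ)) 0 x
      fun r => x + ∫ τ in (0 : ℝ)..r, F τ ∂μI := by
    refine ⟨continuous_const.add (intervalIntegral.continuous_primitive
      (fun a b => hFi.intervalIntegrable) 0), fun r => ?_⟩
    congr 1
    refine intervalIntegral.integral_congr_ae ?_
    filter_upwards [ae_restrict_mem measurableSet_Icc] with τ hτ _
    rw [hy τ hτ]; rfl
  rw [hX.familyFlow_eq hsol, hy t ht]

lemma isFlow_flow (hX : IsBoundedC1Family (vectorFieldₗ V) C) (v : VelocitySpace V) :
    IsFlow (⇑v) (flow v) := by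
  have h : ∃ φ, IsFlow (⇑v) φ := ⟨_, isFlow_familyFlow hX v⟩
  rw [flow, dif_pos h]
  exact h.choose_spec

lemma eqOn_flow (hX : IsBoundedC1Family (vectorFieldₗ V) C) (v : VelocitySpace V)
    (ht : t ∈ Icc (0 : ℝ) 1) : EqOn (flow v t) (familyFlow (vectorFieldₗ V) v 0 t) Ω :=
  fun _ hx => (isFlow_flow hX v).eq_familyFlow hX ht hx

lemma bijOn_flow (hX : IsBoundedC1Family (vectorFieldₗ V) C) (v : VelocitySpace V)
    (ht : t ∈ Icc (0 : ℝ) 1) : BijOn (flow v t) Ω Ω :=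
  (hX.bijOn_familyFlow vectorFieldₗ_of_notMem v 0 t).congr (eqOn_flow hX v ht).symm

lemma eqOn_flowBetween (hX : IsBoundedC1Family (vectorFieldₗ V) C) (v : VelocitySpace V)
    (hs : s ∈ Icc (0 : ℝ) 1) (ht : t ∈ Icc (0 : ℝ) 1) :
    EqOn (flowBetween v s t) (familyFlow (vectorFieldₗ V) v s t) Ω := fun y hy => by
  have hmem : ∃ x ∈ Ω, flow v s x = y := (bijOn_flow hX v hs).surjOn hy
  have h1 := Function.invFunOn_mem hmem
  have h2 : familyFlow (vectorFieldₗ V) v 0 s (Function.invFunOn (flow v s) Ω y) = y := by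
    rw [← eqOn_flow hX v hs h1]
    exact Function.invFunOn_eq hmem
  rw [flowBetween, Function.comp_apply, eqOn_flow hX v ht h1, ← hX.familyFlow_familyFlow v 0 s t,
    h2]

variable {f : EuclideanSpace ℝ (Fin n) → ℝ}

lemma eqOn_comp_flowBetween (hX : IsBoundedC1Family (vectorFieldₗ V) C) (v : VelocitySpace V)
    (hs : s ∈ Icc (0 : ℝ) 1) (ht : t ∈ Icc (0 : ℝ) 1) :
    EqOn (f ∘ flowBetween v s t) (f ∘ familyFlow (vectorFieldₗ V) v s t) Ω := fun y hy => by
  rw [Function.comp_apply, Function.comp_apply, eqOn_flowBetween hX v hs ht hy]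

lemma contDiffOn_flowBetween (hX : IsBoundedC1Family (vectorFieldₗ V) C) (v : VelocitySpace V)
    (hs : s ∈ Icc (0 : ℝ) 1) (ht : t ∈ Icc (0 : ℝ) 1) :
    ContDiffOn ℝ 1 (flowBetween v s t) Ω :=
  (hX.contDiff_familyFlow v hs ht).contDiffOn.congr (eqOn_flowBetween hX v hs ht)

lemma memLp_comp_flowBetween (hX : IsBoundedC1Family (vectorFieldₗ V) C) (hΩ : MeasurableSet Ω)
    (hf : ContinuousOn f Ω) (hf2 : MemLp f 2 (volume.restrict Ω)) (v : VelocitySpace V)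
    (hs : s ∈ Icc (0 : ℝ) 1) (ht : t ∈ Icc (0 : ℝ) 1) :
    MemLp (f ∘ flowBetween v s t) 2 (volume.restrict Ω) :=
  (hX.memLp_comp_familyFlow vectorFieldₗ_of_notMem hΩ v hs ht hf hf2).ae_eq
    ((ae_restrict_mem hΩ).mono fun _ hy => (eqOn_comp_flowBetween hX v hs ht hy).symm)

lemma toImage_comp_flowBetween (hX : IsBoundedC1Family (vectorFieldₗ V) C)
    (hΩ : MeasurableSet Ω) (v : VelocitySpace V) (hs : s ∈ Icc (0 : ℝ) 1)
    (ht : t ∈ Icc (0 : ℝ) 1)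
    (h : MemLp (f ∘ familyFlow (vectorFieldₗ V) v s t) 2 (volume.restrict Ω)) :
    toImage Ω (f ∘ flowBetween v s t) = h.toLp := by
  have hae : f ∘ flowBetween v s t =ᵐ[volume.restrict Ω] f ∘ familyFlow (vectorFieldₗ V) v s t :=
    (ae_restrict_mem hΩ).mono fun _ hy => eqOn_comp_flowBetween hX v hs ht hy
  have h' : MemLp (f ∘ flowBetween v s t) 2 (volume.restrict Ω) := h.ae_eq hae.symm
  rw [toImage, dif_pos h']
  exact MemLp.toLp_congr _ _ hae

lemma fderiv_flowBetween (hX : IsBoundedC1Family (vectorFieldₗ V) C) (hΩ : IsOpen Ω)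
    (v : VelocitySpace V) (hs : s ∈ Icc (0 : ℝ) 1) (ht : t ∈ Icc (0 : ℝ) 1)
    {y : EuclideanSpace ℝ (Fin n)} (hy : y ∈ Ω) :
    fderiv ℝ (flowBetween v s t) y = fderiv ℝ (familyFlow (vectorFieldₗ V) v s t) y :=
  ((eqOn_flowBetween hX v hs ht).eventuallyEq_of_mem (hΩ.mem_nhds hy)).fderiv_eq

lemma gradient_comp_flowBetween (hX : IsBoundedC1Family (vectorFieldₗ V) C) (hΩ : IsOpen Ω)
    (v : VelocitySpace V) (hs : s ∈ Icc (0 : ℝ) 1) (ht : t ∈ Icc (0 : ℝ) 1)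
    {y : EuclideanSpace ℝ (Fin n)} (hy : y ∈ Ω) :
    ∇ (f ∘ flowBetween v s t) y = ∇ (f ∘ familyFlow (vectorFieldₗ V) v s t) y := by
  rw [gradient, gradient,
    ((eqOn_comp_flowBetween hX v hs ht).eventuallyEq_of_mem (hΩ.mem_nhds hy)).fderiv_eq]

end Identification

section HasDensity

variable {V : Type*} [NormedAddCommGroup V] [InnerProductSpace ℝ V]

/-- In the direction `u`, the functional `D` on `L²([0,1], V)` is given by the density `k`. -/
structure HasDensity (D : Lp V 2 μI →L[ℝ] ℝ) (u : V) (k : ℝ → ℝ) : Prop where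
  integrable : Integrable k μI
  eq : ∀ (A : Set ℝ) (hA : MeasurableSet A),
    D (indicatorConstLp 2 hA (measure_ne_top μI A) u) = ∫ τ in A, k τ ∂μI

namespace HasDensity

variable {D D' : Lp V 2 μI →L[ℝ] ℝ} {u : V} {k k' : ℝ → ℝ}

lemma add (h : HasDensity D u k) (h' : HasDensity D' u k') :
    HasDensity (D + D') u fun τ => k τ + k' τ where
  integrable := h.integrable.add h'.integrable
  eq A hA := by
    rw [add_apply, h.eq A hA, h'.eq A hA,
      integral_add h.integrable.restrict h'.integrable.restrict]

lemma const_smul (h : HasDensity D u k) (c : ℝ) : HasDensity (c • D) u fun τ => c * k τ where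
  integrable := h.integrable.const_mul c
  eq A hA := by
    rw [smul_apply, h.eq A hA, integral_const_mul, smul_eq_mul]

lemma sum {ι : Type*} {s : Finset ι} {D : ι → Lp V 2 μI →L[ℝ] ℝ} {k : ι → ℝ → ℝ}
    (h : ∀ i ∈ s, HasDensity (D i) u (k i)) :
    HasDensity (∑ i ∈ s, D i) u fun τ => ∑ i ∈ s, k i τ where
  integrable := integrable_finsetSum s fun i hi => (h i hi).integrable
  eq A hA := by
    rw [sum_apply, integral_finsetSum s fun i hi => (h i hi).integrable.restrict]
    exact Finset.sum_congr rfl fun i hi => (h i hi).eq A hA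

lemma inner_gradient_ae_eq [CompleteSpace V] {F : Lp V 2 μI → ℝ} {v : Lp V 2 μI}
    (hF : HasFDerivAt F D v) (h : HasDensity D u k) :
    ∀ᵐ τ ∂μI, inner ℝ ((∇ F v : Lp V 2 μI) τ) u = k τ := by
  refine Integrable.ae_eq_of_forall_setIntegral_eq _ _
    ((integrable_velocity (∇ F v)).inner_const u) h.integrable fun A hA _ => ?_
  have h1 := L2.inner_indicatorConstLp_eq_setIntegral_inner ℝ (∇ F v : Lp V 2 μI) hA u
    (measure_ne_top μI A)
  rw [← h.eq A hA, ← hF.fderiv, ← InnerProductSpace.toDual_symm_apply, real_inner_comm]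
  exact (integral_congr_ae (ae_of_all _ fun τ => real_inner_comm _ _)).trans h1.symm

end HasDensity

theorem exists_hasFDerivAt_integral_norm_sq (v : Lp V 2 μI) {t : ℝ} (ht : t ∈ Icc (0 : ℝ) 1) :
    ∃ D : Lp V 2 μI →L[ℝ] ℝ,
      HasFDerivAt (fun w : Lp V 2 μI => ∫ τ in (0 : ℝ)..t, ‖w τ‖ ^ 2) D v ∧
      ∀ u, HasDensity D u ((Ioc 0 t).indicator fun τ => 2 * inner ℝ (v τ) u) := by
  set R := LpToLpRestrictCLM ℝ V ℝ μI 2 (Ioc 0 t) with hR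
  have hRw : ∀ w : Lp V 2 μI, R w =ᵐ[(μI).restrict (Ioc 0 t)] w := fun w =>
    LpToLpRestrictCLM_coeFn ℝ (Ioc 0 t) w
  have hin : ∀ w h : Lp V 2 μI,
      inner ℝ (R w) (R h) = ∫ τ in Ioc 0 t, inner ℝ (w τ) (h τ) ∂μI := fun w h => by
    rw [L2.inner_def]
    refine integral_congr_ae ?_
    filter_upwards [hRw w, hRw h] with τ h1 h2
    rw [h1, h2]
  have hQ : (fun w : Lp V 2 μI => ∫ τ in (0 : ℝ)..t, ‖w τ‖ ^ 2) = fun w => ‖R w‖ ^ 2 := by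
    funext w
    rw [← real_inner_self_eq_norm_sq, hin, ← intervalIntegral_restrict_Icc _ ht,
      intervalIntegral.integral_of_le ht.1]
    exact integral_congr_ae (ae_of_all _ fun τ => (real_inner_self_eq_norm_sq _).symm)
  rw [hQ]
  refine ⟨_, R.hasFDerivAt.norm_sq, fun u => ⟨?_, fun A hA => ?_⟩⟩
  · exact (((integrable_velocity v).inner_const u).const_mul 2).indicator measurableSet_Ioc
  · have h1 : ∀ᵐ τ ∂(μI).restrict (Ioc 0 t),
        inner ℝ (v τ) ((indicatorConstLp 2 hA (measure_ne_top μI A) u : Lp V 2 μI) τ) =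
          A.indicator (fun τ => inner ℝ (v τ) u) τ := by
      filter_upwards [ae_restrict_of_ae (indicatorConstLp_coeFn (p := 2) (hs := hA)
        (hμs := measure_ne_top μI A) (c := u))] with τ hτ
      rw [hτ]
      by_cases hτA : τ ∈ A
      · rw [indicator_of_mem hτA, indicator_of_mem hτA]
      · rw [indicator_of_notMem hτA, indicator_of_notMem hτA, inner_zero_right]
    have h2 := hin v (indicatorConstLp 2 hA (measure_ne_top μI A) u)
    rw [integral_congr_ae h1, setIntegral_indicator hA] at h2
    rw [setIntegral_indicator measurableSet_Ioc, integral_const_mul, inter_comm, ← h2]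
    simp [innerSL_apply_apply]

end HasDensity

section DataTerm

variable {V E : Type*} [NormedAddCommGroup V] [InnerProductSpace ℝ V]
  [NormedAddCommGroup E] [InnerProductSpace ℝ E] [CompleteSpace E] [FiniteDimensional ℝ E]
  {X : V →ₗ[ℝ] (E → E)} {C : ℝ} {f : E → ℝ} {s t : ℝ} {Ω : Set E}

/-- The density over `Ω` of the linearized data term at time `τ`. -/
noncomputable def adjointDensity (X : V →ₗ[ℝ] (E → E)) (f G : E → ℝ) (v : Lp V 2 μI)
    (t τ : ℝ) (z : E) : E :=
  ((fderiv ℝ (familyFlow X v τ t) z).det * G (familyFlow X v τ t z)) •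
    ∇ (f ∘ familyFlow X v τ 0) z

variable [MeasurableSpace E] [BorelSpace E] {m : Measure E} [m.IsAddHaarMeasure]

namespace IsBoundedC1Family

lemma integrable_adjointDensity (hX : IsBoundedC1Family X C)
    (h0 : ∀ u, ∀ x ∉ Ω, X u x = 0) (hΩ : IsOpen Ω) (hf : DifferentiableOn ℝ f Ω)
    (hf2 : MemLp (fun x => ∇ f x) 2 (m.restrict Ω)) (v : Lp V 2 μI) {G : E → ℝ}
    (hGm : StronglyMeasurable G) (hG : MemLp G 2 (m.restrict Ω)) (hs : s ∈ Icc (0 : ℝ) 1)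
    (ht : t ∈ Icc (0 : ℝ) 1) : IntegrableOn (adjointDensity X f G v t s) Ω m :=
  memLp_one_iff_integrable.1 ((hX.memLp_gradient_comp_familyFlow h0 hΩ hf hf2 v hs
    (by simp)).smul (hX.memLp_det_mul_comp_familyFlow h0 hΩ hGm hG v hs ht))

theorem hasDensity_of_eq_integral_mul_compVariation (hX : IsBoundedC1Family X C)
    (h0 : ∀ u, ∀ x ∉ Ω, X u x = 0) (hΩ : IsOpen Ω) (hf : DifferentiableOn ℝ f Ω)
    (hf2 : MemLp (fun x => ∇ f x) 2 (m.restrict Ω)) (v : Lp V 2 μI) (ht : t ∈ Icc (0 : ℝ) 1)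
    {G : E → ℝ} (hGm : StronglyMeasurable G) (hG : MemLp G 2 (m.restrict Ω))
    {D : Lp V 2 μI →L[ℝ] ℝ} (hD : ∀ h, D h = ∫ y in Ω, G y * compVariation X f v t h y ∂m)
    (u : V) :
    HasDensity D u ((Ioc 0 t).indicator fun τ =>
      -∫ z in Ω, inner ℝ (adjointDensity X f G v t τ z) (X u z) ∂m) := by
  have key : ∀ (A : Set ℝ) (hA : MeasurableSet A), ∀ᵐ τ ∂volume.restrict (Ioc 0 t),
      (∫ z in Ω, (fderiv ℝ (familyFlow X v τ t) z).det * G (familyFlow X v τ t z)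
        * inner ℝ (∇ (f ∘ familyFlow X v τ 0) z)
          (X ((indicatorConstLp 2 hA (measure_ne_top μI A) u : Lp V 2 μI) τ) z) ∂m) =
      A.indicator (fun τ => ∫ z in Ω, inner ℝ (adjointDensity X f G v t τ z) (X u z) ∂m) τ := by
    intro A hA
    rw [← restrict_Icc_restrict_Ioc ht]
    filter_upwards [ae_restrict_of_ae (indicatorConstLp_coeFn (p := 2) (hs := hA)
      (hμs := measure_ne_top μI A) (c := u))] with τ hτ
    rw [hτ]
    by_cases hτA : τ ∈ A
    · rw [indicator_of_mem hτA, indicator_of_mem hτA]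
      simp only [adjointDensity, real_inner_smul_left]
    · rw [indicator_of_notMem hτA, indicator_of_notMem hτA]
      simp
  constructor
  · have h1 := (hX.integral_mul_compVariation h0 hΩ hf hf2 v
      (indicatorConstLp 2 .univ (measure_ne_top μI univ) u) ht hGm hG).1.congr (key univ .univ)
    rw [indicator_univ, ← restrict_Icc_restrict_Ioc ht] at h1
    exact (integrable_indicator_iff measurableSet_Ioc).2 h1.neg
  · intro A hA
    rw [hD, (hX.integral_mul_compVariation h0 hΩ hf hf2 v _ ht hGm hG).2,
      integral_congr_ae (key A hA), ← restrict_Icc_restrict_Ioc ht, setIntegral_indicator hA,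
      setIntegral_indicator measurableSet_Ioc, integral_neg, inter_comm]

theorem exists_hasFDerivAt_norm_sq_sub (hX : IsBoundedC1Family X C)
    (h0 : ∀ u, ∀ x ∉ Ω, X u x = 0) (hΩ : IsOpen Ω) (hf : DifferentiableOn ℝ f Ω)
    (hf2 : MemLp (fun x => ∇ f x) 2 (m.restrict Ω)) (v : Lp V 2 μI) (ht : t ∈ Icc (0 : ℝ) 1)
    (hmem : ∀ w : Lp V 2 μI, MemLp (f ∘ familyFlow X w t 0) 2 (m.restrict Ω))
    {Y : Type*} [NormedAddCommGroup Y] [InnerProductSpace ℝ Y] [CompleteSpace Y]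
    (T : Lp ℝ 2 (m.restrict Ω) →L[ℝ] Y) (g : Y) :
    ∃ D : Lp V 2 μI →L[ℝ] ℝ, HasFDerivAt (fun w => ‖T (hmem w).toLp - g‖ ^ 2) D v ∧
      ∀ u, HasDensity D u fun τ => 2 * (Ioc 0 t).indicator (fun τ =>
        -∫ z in Ω, inner ℝ (adjointDensity X f
          (ContinuousLinearMap.adjoint T (T (hmem v).toLp - g)) v t τ z) (X u z) ∂m) τ := by
  obtain ⟨D, hD⟩ := hX.exists_clm_compVariation h0 hΩ.measurableSet hf2 v ht
  set G := ContinuousLinearMap.adjoint T (T (hmem v).toLp - g) with hG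
  have h1 := ((T.hasFDerivAt.comp v (hX.hasFDerivAt_toLp_comp h0 hΩ hf hf2 v ht hmem
    hD)).sub_const g).norm_sq
  have h2 : ∀ h, ((innerSL ℝ G).comp D) h = ∫ y in Ω, G y * compVariation X f v t h y ∂m := by
    intro h
    rw [ContinuousLinearMap.comp_apply, innerSL_apply_apply, hD, L2.inner_def]
    refine integral_congr_ae ?_
    filter_upwards [(hX.memLp_compVariation h0 hΩ.measurableSet hf2 v ht h).coeFn_toLp] with y hy
    rw [hy]
    exact mul_comm _ _
  have h3 := fun u => (hX.hasDensity_of_eq_integral_mul_compVariation h0 hΩ hf hf2 v ht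
    (Lp.stronglyMeasurable G) (Lp.memLp G) h2 u).const_smul 2
  refine ⟨_, h1.congr_fderiv (ContinuousLinearMap.ext fun h => ?_), h3⟩
  have h4 : inner ℝ G (D h) = inner ℝ (T (hmem v).toLp - g) (T (D h)) :=
    ContinuousLinearMap.adjoint_inner_left T _ _
  simp only [smul_apply, ContinuousLinearMap.comp_apply, innerSL_apply_apply, h4,
    Function.comp_apply, smul_eq_mul, nsmul_eq_mul, Nat.cast_ofNat]

end IsBoundedC1Family

end DataTerm

section Kernel

variable {n : ℕ} {Ω : Set (EuclideanSpace ℝ (Fin n))}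
  {V : Type*} [NormedAddCommGroup V] [InnerProductSpace ℝ V] [CompleteSpace V]
  [RKHS ℝ V Ω (EuclideanSpace ℝ (Fin n))] {C : ℝ}

lemma norm_kerFun_le (hX : IsBoundedC1Family (vectorFieldₗ V) C) (x : Ω) :
    ‖RKHS.kerFun V x‖ ≤ C := by
  rw [← LinearIsometryEquiv.norm_map ContinuousLinearMap.adjoint]
  refine ContinuousLinearMap.opNorm_le_bound _ hX.pos.le fun u => ?_
  rw [RKHS.adjoint_kerFun, ← vectorField_of_mem u x.2]
  exact hX.norm_le u x

lemma continuous_kerFun (hX : IsBoundedC1Family (vectorFieldₗ V) C) :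
    Continuous fun x : Ω => RKHS.kerFun V x := by
  refine (LipschitzWith.of_dist_le_mul (K := C.toNNReal) fun x y => ?_).continuous
  rw [dist_eq_norm, ← LinearIsometryEquiv.norm_map ContinuousLinearMap.adjoint, map_sub,
    Real.coe_toNNReal _ hX.pos.le]
  refine ContinuousLinearMap.opNorm_le_bound _ (mul_nonneg hX.pos.le dist_nonneg) fun u => ?_
  rw [sub_apply, RKHS.adjoint_kerFun, RKHS.adjoint_kerFun, ← vectorField_of_mem u x.2,
    ← vectorField_of_mem u y.2, Subtype.dist_eq, dist_eq_norm, mul_right_comm]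
  exact hX.norm_sub_le u x y

lemma continuous_kerFun_apply (hX : IsBoundedC1Family (vectorFieldₗ V) C) :
    Continuous fun p : Ω × EuclideanSpace ℝ (Fin n) => RKHS.kerFun V p.1 p.2 :=
  ((continuous_kerFun hX).comp continuous_fst).clm_apply continuous_snd

lemma integrable_kerFun_apply (hX : IsBoundedC1Family (vectorFieldₗ V) C) (hΩ : MeasurableSet Ω)
    {b : EuclideanSpace ℝ (Fin n) → EuclideanSpace ℝ (Fin n)} (hb : IntegrableOn b Ω) :
    Integrable (fun y : Ω => RKHS.kerFun V y (b y)) (volume.comap Subtype.val) := by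
  have hb' : Integrable (fun y : Ω => b y) (volume.comap Subtype.val) :=
    (integrableOn_iff_comap_subtypeVal hΩ).1 hb
  have hid : AEStronglyMeasurable (fun y : Ω => y) (volume.comap Subtype.val) :=
    continuous_id.aestronglyMeasurable
  have hp : AEStronglyMeasurable (fun y : Ω => (y, b y)) (volume.comap Subtype.val) :=
    hid.prodMk hb'.aestronglyMeasurable
  have hm := (continuous_kerFun_apply hX).comp_aestronglyMeasurable hp
  refine (hb'.norm.const_mul C).mono' hm (ae_of_all _ fun y => ?_)
  exact (RKHS.kerFun V y).le_of_opNorm_le (norm_kerFun_le hX y) _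

lemma inner_integral_kerFun_apply (hX : IsBoundedC1Family (vectorFieldₗ V) C)
    (hΩ : MeasurableSet Ω) {b : EuclideanSpace ℝ (Fin n) → EuclideanSpace ℝ (Fin n)}
    (hb : IntegrableOn b Ω) (u : V) :
    inner ℝ (∫ y : Ω, RKHS.kerFun V y (b y) ∂(volume.comap Subtype.val)) u =
      ∫ z in Ω, inner ℝ (b z) (vectorFieldₗ V u z) := by
  rw [real_inner_comm, ← integral_inner (integrable_kerFun_apply hX hΩ hb),
    ← integral_subtype_comap hΩ]
  refine integral_congr_ae (ae_of_all _ fun y => ?_)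
  change inner ℝ u (RKHS.kerFun V y (b y)) = inner ℝ (b y) (vectorField u y)
  rw [RKHS.inner_kerFun, vectorField_of_mem u y.2, real_inner_comm]

lemma integrable_kernel_apply (hX : IsBoundedC1Family (vectorFieldₗ V) C) (hΩ : MeasurableSet Ω)
    {b : EuclideanSpace ℝ (Fin n) → EuclideanSpace ℝ (Fin n)} (hb : IntegrableOn b Ω) (x : Ω) :
    Integrable (fun y : Ω => RKHS.kernel V x y (b y)) (volume.comap Subtype.val) :=
  (RKHS.kerFun V x).adjoint.integrable_comp (integrable_kerFun_apply hX hΩ hb)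

lemma integral_kerFun_apply_coe (hX : IsBoundedC1Family (vectorFieldₗ V) C)
    (hΩ : MeasurableSet Ω) {b : EuclideanSpace ℝ (Fin n) → EuclideanSpace ℝ (Fin n)}
    (hb : IntegrableOn b Ω) (x : Ω) :
    (∫ y : Ω, RKHS.kerFun V y (b y) ∂(volume.comap Subtype.val) : V) x =
      ∫ y : Ω, RKHS.kernel V x y (b y) ∂(volume.comap Subtype.val) := by
  rw [← RKHS.adjoint_kerFun, ← ContinuousLinearMap.integral_comp_comm _
    (integrable_kerFun_apply hX hΩ hb)]
  rfl

lemma ae_eq_of_forall_inner_ae_eq (hX : IsBoundedC1Family (vectorFieldₗ V) C) {α : Type*}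
    [MeasurableSpace α] {μ : Measure α} {w r : α → V}
    (h : ∀ u : V, ∀ᵐ a ∂μ, inner ℝ (w a) u = inner ℝ (r a) u) : w =ᵐ[μ] r := by
  obtain ⟨S, hS, hSd⟩ := TopologicalSpace.exists_countable_dense
    (Ω × EuclideanSpace ℝ (Fin n))
  filter_upwards [(ae_ball_iff hS).2 fun p _ => h (RKHS.kerFun V p.1 p.2)] with a ha
  have h1 : (fun p : Ω × EuclideanSpace ℝ (Fin n) => inner ℝ (w a) (RKHS.kerFun V p.1 p.2)) =
      fun p => inner ℝ (r a) (RKHS.kerFun V p.1 p.2) :=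
    Continuous.ext_on hSd (continuous_const.inner (continuous_kerFun_apply hX))
      (continuous_const.inner (continuous_kerFun_apply hX)) ha
  refine DFunLike.ext _ _ fun x => ext_inner_right ℝ fun e => ?_
  rw [← RKHS.inner_kerFun, ← RKHS.inner_kerFun]
  exact congrFun h1 (x, e)

end Kernel

section Functional

variable {n : ℕ} {Ω : Set (EuclideanSpace ℝ (Fin n))}
  {V : Type*} [NormedAddCommGroup V] [InnerProductSpace ℝ V]
  [RKHS ℝ V Ω (EuclideanSpace ℝ (Fin n))] {C : ℝ}
  {Y : Type*} [NormedAddCommGroup Y] [InnerProductSpace ℝ Y] [CompleteSpace Y]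
  {N : ℕ} {f : EuclideanSpace ℝ (Fin n) → ℝ} {t : ℝ}

lemma natCast_div_mem_Icc {i : ℕ} (hi : i ∈ Finset.Icc 1 N) : (i : ℝ) / N ∈ Icc (0 : ℝ) 1 :=
  ⟨by positivity, div_le_one_of_le₀ (by exact_mod_cast (Finset.mem_Icc.1 hi).2) (by positivity)⟩

/-- The adjoint residual `T_t*(T_t(f ∘ φ_{t,0}) - g_t)`. -/
noncomputable def adjointResidual (T : ℝ → ImageSpace Ω →L[ℝ] Y) (g : ℝ → Y)
    (f : EuclideanSpace ℝ (Fin n) → ℝ) (v : VelocitySpace V) (t : ℝ) : ImageSpace Ω :=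
  ContinuousLinearMap.adjoint (T t) (T t (toImage Ω (f ∘ flowBetween v t 0)) - g t)

/-- The total density `∑_{i ≥ 1, tᵢ ≥ t} h_{t,tᵢ} ∇(f ∘ φ_{t,0})`, in terms of flows on `ℝⁿ`. -/
noncomputable def gradientDensity (N : ℕ) (T : ℝ → ImageSpace Ω →L[ℝ] Y) (g : ℝ → Y)
    (f : EuclideanSpace ℝ (Fin n) → ℝ) (v : VelocitySpace V) (t : ℝ)
    (z : EuclideanSpace ℝ (Fin n)) : EuclideanSpace ℝ (Fin n) :=
  ∑ i ∈ (Finset.Icc 1 N).filter (fun i : ℕ => t ≤ (i : ℝ) / N),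
    adjointDensity (vectorFieldₗ V) f (adjointResidual T g f v ((i : ℝ) / N)) v ((i : ℝ) / N) t z

variable (T : ℝ → ImageSpace Ω →L[ℝ] Y) (g : ℝ → Y)

lemma integrableOn_gradientDensity (hX : IsBoundedC1Family (vectorFieldₗ V) C) (hΩ : IsOpen Ω)
    (hf : DifferentiableOn ℝ f Ω) (hf2 : MemLp (fun x => ∇ f x) 2 (volume.restrict Ω))
    (v : VelocitySpace V) (ht : t ∈ Icc (0 : ℝ) 1) :
    IntegrableOn (gradientDensity N T g f v t) Ω :=
  integrable_finsetSum _ fun _ hi => hX.integrable_adjointDensity vectorFieldₗ_of_notMem hΩ hf hf2 v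
    (Lp.stronglyMeasurable _) (Lp.memLp _) ht (natCast_div_mem_Icc (Finset.mem_filter.1 hi).1)

theorem exists_hasFDerivAt_registrationFunctional (hX : IsBoundedC1Family (vectorFieldₗ V) C)
    (hΩ : IsOpen Ω) (μ₂ : ℝ) (hf : DifferentiableOn ℝ f Ω) (hf1 : MemLp f 2 (volume.restrict Ω))
    (hf2 : MemLp (fun x => ∇ f x) 2 (volume.restrict Ω)) (v : VelocitySpace V) :
    ∃ D : VelocitySpace V →L[ℝ] ℝ, HasFDerivAt (registrationFunctional N T g μ₂ f) D v ∧
      ∀ u, HasDensity D u fun τ => (1 / (N : ℝ)) * ∑ i ∈ Finset.Icc 1 N,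
        (2 * (Ioc 0 ((i : ℝ) / N)).indicator (fun τ => -∫ z in Ω, inner ℝ
          (adjointDensity (vectorFieldₗ V) f (adjointResidual T g f v ((i : ℝ) / N)) v ((i : ℝ) / N) τ z) (vectorFieldₗ V u z)) τ +
          μ₂ * (Ioc 0 ((i : ℝ) / N)).indicator (fun τ => 2 * inner ℝ (v τ) u) τ) := by
  have hex : ∀ i : ℕ, ∃ D : VelocitySpace V →L[ℝ] ℝ, i ∈ Finset.Icc 1 N →
      HasFDerivAt (fun w : VelocitySpace V =>
        ‖T ((i : ℝ) / N) (toImage Ω (f ∘ flowBetween w ((i : ℝ) / N) 0)) - g ((i : ℝ) / N)‖ ^ 2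
          + μ₂ * ∫ τ in (0 : ℝ)..((i : ℝ) / N), ‖w τ‖ ^ 2) D v ∧
      ∀ u, HasDensity D u fun τ =>
        2 * (Ioc 0 ((i : ℝ) / N)).indicator (fun τ => -∫ z in Ω, inner ℝ
          (adjointDensity (vectorFieldₗ V) f (adjointResidual T g f v ((i : ℝ) / N)) v ((i : ℝ) / N) τ z) (vectorFieldₗ V u z)) τ +
          μ₂ * (Ioc 0 ((i : ℝ) / N)).indicator (fun τ => 2 * inner ℝ (v τ) u) τ := fun i => by
    by_cases hi : i ∈ Finset.Icc 1 N
    swap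
    · exact ⟨0, fun h => absurd h hi⟩
    have hti := natCast_div_mem_Icc hi
    have hmem : ∀ w : VelocitySpace V,
        MemLp (f ∘ familyFlow (vectorFieldₗ V) w ((i : ℝ) / N) 0) 2 (volume.restrict Ω) := fun w =>
      hX.memLp_comp_familyFlow vectorFieldₗ_of_notMem hΩ.measurableSet w hti (by simp)
        hf.continuousOn hf1
    have himg : ∀ w : VelocitySpace V,
        toImage Ω (f ∘ flowBetween w ((i : ℝ) / N) 0) = (hmem w).toLp := fun w =>
      toImage_comp_flowBetween hX hΩ.measurableSet w hti (by simp) (hmem w)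
    obtain ⟨D₁, h1, hd1⟩ := hX.exists_hasFDerivAt_norm_sq_sub vectorFieldₗ_of_notMem hΩ hf hf2 v
      hti hmem (T ((i : ℝ) / N)) (g ((i : ℝ) / N))
    obtain ⟨D₂, h2, hd2⟩ := exists_hasFDerivAt_integral_norm_sq v hti
    simp only [adjointResidual, himg]
    exact ⟨D₁ + μ₂ • D₂, fun _ => ⟨h1.add (h2.const_mul μ₂),
      fun u => (hd1 u).add ((hd2 u).const_smul μ₂)⟩⟩
  choose D hD using hex
  exact ⟨(1 / (N : ℝ)) • ∑ i ∈ Finset.Icc 1 N, D i,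
    (HasFDerivAt.fun_sum fun i hi => (hD i hi).1).const_mul (1 / (N : ℝ)),
    fun u => (HasDensity.sum fun i hi => (hD i hi).2 u).const_smul (1 / (N : ℝ))⟩

variable [CompleteSpace V]

lemma gradientIntegrand_eq (hX : IsBoundedC1Family (vectorFieldₗ V) C) (hΩ : IsOpen Ω)
    (v : VelocitySpace V) (ht : t ∈ Icc (0 : ℝ) 1) (x y : Ω) :
    gradientIntegrand N T g f v t x y =
      RKHS.kernel V x y (gradientDensity N T g f v t y) := by
  rw [gradientIntegrand, gradientDensity, Finset.sum_smul]
  congr 1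
  refine Finset.sum_congr rfl fun i hi => ?_
  have hti := natCast_div_mem_Icc (Finset.mem_filter.1 hi).1
  rw [hTerm, if_pos (Finset.mem_filter.1 hi).2, adjointDensity,
    fderiv_flowBetween hX hΩ v ht hti y.2, eqOn_flowBetween hX v ht hti y.2,
    gradient_comp_flowBetween hX hΩ v ht (by simp) y.2, adjointResidual]

theorem gradient_registrationFunctional_ae_eq (hX : IsBoundedC1Family (vectorFieldₗ V) C)
    (hΩ : IsOpen Ω) (μ₂ : ℝ) (hf : DifferentiableOn ℝ f Ω) (hf1 : MemLp f 2 (volume.restrict Ω))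
    (hf2 : MemLp (fun x => ∇ f x) 2 (volume.restrict Ω)) (v : VelocitySpace V) :
    ∀ᵐ τ ∂μI, (∇ (registrationFunctional N T g μ₂ f : VelocitySpace V → ℝ) v) τ =
      -(2 / (N : ℝ)) • (∫ y : Ω, RKHS.kerFun V y (gradientDensity N T g f v τ y)
          ∂(volume.comap Subtype.val))
        + (2 * μ₂ / (N : ℝ)) • ∑ i ∈ (Finset.Icc 1 N).filter (fun i : ℕ => τ ≤ (i : ℝ) / N),
          truncatedVelocity v τ ((i : ℝ) / N) := by
  obtain ⟨D, hD, hdens⟩ := exists_hasFDerivAt_registrationFunctional (N := N) T g hX hΩ μ₂ hf hf1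
    hf2 v
  refine ae_eq_of_forall_inner_ae_eq hX fun u => ?_
  have hne : ∀ᵐ τ ∂μI, τ ≠ 0 := ae_restrict_of_ae (Measure.ae_ne volume 0)
  filter_upwards [(hdens u).inner_gradient_ae_eq hD, ae_restrict_mem measurableSet_Icc, hne]
    with τ hτ hτI hτ0
  have hpos : 0 < τ := lt_of_le_of_ne hτI.1 (Ne.symm hτ0)
  have hint : ∀ i ∈ (Finset.Icc 1 N).filter (fun i : ℕ => τ ≤ (i : ℝ) / N),
      IntegrableOn (adjointDensity (vectorFieldₗ V) f (adjointResidual T g f v ((i : ℝ) / N)) v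
        ((i : ℝ) / N) τ) Ω := fun i hi =>
    hX.integrable_adjointDensity vectorFieldₗ_of_notMem hΩ hf hf2 v (Lp.stronglyMeasurable _)
      (Lp.memLp _) hτI (natCast_div_mem_Icc (Finset.mem_filter.1 hi).1)
  simp only [gradientDensity, map_sum]
  rw [hτ, integral_finsetSum _ fun i hi => integrable_kerFun_apply hX hΩ.measurableSet (hint i hi),
    inner_add_left, real_inner_smul_left, real_inner_smul_left, sum_inner, sum_inner,
    Finset.sum_congr rfl fun i hi => inner_integral_kerFun_apply hX hΩ.measurableSet (hint i hi) u]
  rw [Finset.mul_sum, Finset.mul_sum, Finset.mul_sum, Finset.sum_filter, Finset.sum_filter,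
    ← Finset.sum_add_distrib]
  refine Finset.sum_congr rfl fun i _ => ?_
  by_cases hi : τ ≤ (i : ℝ) / N
  · rw [if_pos hi, if_pos hi, indicator_of_mem (show τ ∈ Ioc 0 ((i : ℝ) / N) from ⟨hpos, hi⟩),
      indicator_of_mem (show τ ∈ Ioc 0 ((i : ℝ) / N) from ⟨hpos, hi⟩), truncatedVelocity,
      if_pos hi]
    ring
  · rw [if_neg hi, if_neg hi, indicator_of_notMem fun h => hi h.2,
      indicator_of_notMem fun h => hi h.2]
    ring

end Functional

theorem mainTheorem3 {n : ℕ} {Ω : Set (EuclideanSpace ℝ (Fin n))} (hΩ : IsOpen Ω)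
    {V : Type*} [NormedAddCommGroup V] [InnerProductSpace ℝ V] [CompleteSpace V]
    [RKHS ℝ V Ω (EuclideanSpace ℝ (Fin n))] (hV : IsAdmissible V)
    {Y : Type*} [NormedAddCommGroup Y] [InnerProductSpace ℝ Y] [CompleteSpace Y]
    (N : ℕ) (hN : 1 ≤ N) (T : ℝ → ImageSpace Ω →L[ℝ] Y) (g : ℝ → Y) (μ₂ : ℝ)
    (f : EuclideanSpace ℝ (Fin n) → ℝ)
    (hf : DifferentiableOn ℝ f Ω)
    (hf_L2 : MemLp f 2 (volume.restrict Ω))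
    (hgrad_L2 : MemLp (fun x => ∇ f x) 2 (volume.restrict Ω)) :
    -- the objects entering the functional are well defined
    (∀ v : VelocitySpace V, IsFlow (⇑v) (flow v) ∧
      ∀ s ∈ Icc (0 : ℝ) 1, BijOn (flow v s) Ω Ω ∧
        (∀ t ∈ Icc (0 : ℝ) 1, ContDiffOn ℝ 1 (flowBetween v s t) Ω) ∧
        MemLp (f ∘ flowBetween v s 0) 2 (volume.restrict Ω)) ∧
    -- the functional is differentiable, with the stated gradient
    ∀ v : VelocitySpace V,
      DifferentiableAt ℝ (registrationFunctional N T g μ₂ f : VelocitySpace V → ℝ) v ∧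
      (∀ t ∈ Icc (0 : ℝ) 1, ∀ x : Ω,
        Integrable (gradientIntegrand N T g f v t x) (volume.comap Subtype.val)) ∧
      ∀ᵐ t ∂(volume.restrict (Icc (0 : ℝ) 1)), ∀ x : Ω,
        (∇ (registrationFunctional N T g μ₂ f : VelocitySpace V → ℝ) v) t x =
          -(2 / (N : ℝ)) • (∫ y : Ω, gradientIntegrand N T g f v t x y ∂(volume.comap Subtype.val))
            + (2 * μ₂ / (N : ℝ)) •
              ∑ i ∈ (Finset.Icc 1 N).filter (fun i : ℕ => t ≤ (i : ℝ) / N),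
                truncatedVelocity v t ((i : ℝ) / N) x := by
  obtain ⟨C, hX⟩ := hV.exists_isBoundedC1Family hΩ
  have h0I : (0 : ℝ) ∈ Icc (0 : ℝ) 1 := by simp
  refine ⟨fun v => ⟨isFlow_flow hX v, fun s hs => ⟨bijOn_flow hX v hs,
    fun t ht => contDiffOn_flowBetween hX v hs ht,
    memLp_comp_flowBetween hX hΩ.measurableSet hf.continuousOn hf_L2 v hs h0I⟩⟩,
    fun v => ⟨?_, fun t ht x => ?_, ?_⟩⟩
  · obtain ⟨D, hD, -⟩ := exists_hasFDerivAt_registrationFunctional (N := N) T g hX hΩ μ₂ hf hf_L2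
      hgrad_L2 v
    exact hD.differentiableAt
  · rw [funext fun y => gradientIntegrand_eq (N := N) (f := f) T g hX hΩ v ht x y]
    exact integrable_kernel_apply hX hΩ.measurableSet
      (integrableOn_gradientDensity T g hX hΩ hf hgrad_L2 v ht) x
  · filter_upwards [gradient_registrationFunctional_ae_eq (N := N) T g hX hΩ μ₂ hf hf_L2 hgrad_L2 v,
      ae_restrict_mem measurableSet_Icc] with t ht htI x
    rw [ht, RKHS.coe_add, Pi.add_apply, RKHS.coe_smul, Pi.smul_apply, RKHS.coe_smul, Pi.smul_apply,
      integral_kerFun_apply_coe hX hΩ.measurableSet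
        (integrableOn_gradientDensity T g hX hΩ hf hgrad_L2 v htI)]
    simp only [← gradientIntegrand_eq T g hX hΩ v htI]
    congr 2
    simp only [← RKHS.adjoint_kerFun, map_sum]
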